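/- **Setting.** Let $M$ be a simply connected (hence connected), Hausdorff complex manifold of dimension $m$, and let $(M,\circ,e,E,g)$ be a Frobenius manifold: $\circ$ is a holomorphic commutative and associative multiplication on the tangent bundle with global unit field $e$; $g$ is a holomorphic, symmetric, nondegenerate, flat bilinear form with $g(X\circ Y,Z)=g(X,Y\circ Z)$; for its Levi-Civita connection $\nabla$ the tensor $\nabla\circ$ is symmetric and $\nabla e=0$; and $E$ is a holomorphic vector field with $\mathrm{Lie}_E(\circ)=\circ$ and $\mathrm{Lie}_E(g)=D\cdot g$ for some $D\in\mathbb C$. Suppose that $M$ is massive, i.e. the multiplication on $T_tM$ is semisimple for generic $t$ (on a dense set), and let the caustic $\mathcal K\subset M$ be the set of points where it is not semisimple. Fix an integer $n\ge 3$ and suppose that at generic points of $\mathcal K$ (a dense subset of $\mathcal K$) the germ of $(M,\circ,e)$ is of type $I_2(n)A_1^{m-2}$, i.e. isomorphic to the germ at $0$ of $\mathbb C^m$ with coordinate fields $\delta_i=\partial/\partial t_i$ and the multiplication $$\delta_1\circ\delta_2=\delta_2,\qquad \delta_2\circ\delta_2=t_2^{\,n-2}\delta_1,\qquad \delta_i\circ\delta_j=\delta_{ij}\delta_i\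 \text{ for } (i,j)\notin\{(1,2),(2,1),(2,2)\}.$$ Near each point of $M\setminus\mathcal K$ there are canonical coordinates $u_1,\dots,u_m$, unique up to renumbering, such that the fields $e_i=\partial/\partial u_i$ satisfy $e_i\circ e_j=\delta_{ij}e_i$ and $E=\sum_i u_ie_i$. Put $\eta_i=g(e_i,e_i)$ and $\eta_{ij}=e_i(\eta_j)$. The holomorphic 1-form $$d\log\tau_I:=\frac18\sum_{i\ne j}(u_i-u_j)\,\frac{\eta_{ij}^2}{\eta_i\eta_j}\,du_i$$ on $M\setminus\mathcal K$ is well defined and closed. A G-function is, locally on $M\setminus\mathcal K$, a function $G=\log\tau_I-\frac1{24}\log J$, where $\log\tau_I$ is a local primitive of this form and $J=\det(\partial\tilde t_i/\partial u_j)$ for local flat coordinates $\tilde t_1,\dots,\tilde t_m$ of $g$; it is determined up to an additive constant. **Theorem 6.3.** (a) The form $d\log\tau_I$ has a logarithmic pole along $\mathcal K$ (for each holomorphic function $h$ on an open set $U\subset M$ that vanishes on $\mathcal K\cap U$, the forms $h\,d\log\tau_I$ and $h\,d(d\log\tau_I)$ extend holomorphically from $U\setminus\mathcal K$ to $U$),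 with residue $-\frac{(n-2)^2}{16n}$ along the regular part $\mathcal K_{reg}$: wherever $\mathcal K$ is given by a holomorphic equation $h=0$ with $dh\neq0$ on $\mathcal K$, the form $d\log\tau_I+\frac{(n-2)^2}{16n}\frac{dh}{h}$ extends holomorphically over $\mathcal K$. (b) If $\mathcal K\ne\emptyset$, then the G-function extends holomorphically over $\mathcal K$ (there is a holomorphic function on $M$ which is a G-function near each point of $M\setminus\mathcal K$) if and only if $n=3$. -/

import Mathlib

open scoped Manifold ContDiff Topology

noncomputable section

/-- The model with corners of `m`-dimensional complex manifolds (without boundary). -/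
abbrev CModel (m : ℕ) : ModelWithCorners ℂ (Fin m → ℂ) (Fin m → ℂ) := 𝓘(ℂ, Fin m → ℂ)

section Holomorphic

variable {m : ℕ} {M : Type*} [TopologicalSpace M] [ChartedSpace (Fin m → ℂ) M]

/-- The function `f` is holomorphic in a neighbourhood of `p`. -/
def HolFunctionAt (f : M → ℂ) (p : M) : Prop :=
  ContMDiffAt (CModel m) 𝓘(ℂ, ℂ) ω f p

variable [IsManifold (CModel m) ω M]

/-- The vector field `X` is holomorphic in a neighbourhood of `p`. -/
def HolFieldAt (X : ∀ q : M, TangentSpace (CModel m) q) (p : M) : Prop :=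
  ContMDiffAt (CModel m) (CModel m).tangent ω
    (fun q => (⟨q, X q⟩ : TangentBundle (CModel m) M)) p

/-- The 1-form `α` is holomorphic near `p`: it sends holomorphic vector fields to holomorphic
functions. -/
def HolFormAt (α : ∀ q : M, TangentSpace (CModel m) q →L[ℂ] ℂ) (p : M) : Prop :=
  ∀ X : ∀ q : M, TangentSpace (CModel m) q, HolFieldAt X p →
    HolFunctionAt (m := m) (fun q => α q (X q)) p

/-- The (2,0)-tensor `β` is holomorphic near `p`. -/
def HolBilinAt
    (β : ∀ q : M, TangentSpace (CModel m) q →ₗ[ℂ] TangentSpace (CModel m) q →ₗ[ℂ] ℂ)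
    (p : M) : Prop :=
  ∀ X Y : ∀ q : M, TangentSpace (CModel m) q, HolFieldAt X p → HolFieldAt Y p →
    HolFunctionAt (m := m) (fun q => β q (X q) (Y q)) p

/-- The exterior derivative of the 1-form `α`, evaluated on two vector fields:
`dα(X, Y) = X(α(Y)) - Y(α(X)) - α([X, Y])`. -/
def formExtDeriv (α : ∀ q : M, TangentSpace (CModel m) q →L[ℂ] ℂ)
    (X Y : ∀ q : M, TangentSpace (CModel m) q) (q : M) : ℂ :=
  mvfderiv (CModel m) (fun r => α r (Y r)) q (X q)
    - mvfderiv (CModel m) (fun r => α r (X r)) q (Y q)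
    - α q (VectorField.mlieBracket (CModel m) X Y q)

/-- The form `α`, given on the complement of the hypersurface `K`, has a logarithmic pole along
`K`: for each local section `h` of the ideal sheaf of `K`, the forms `h α` and `h dα` extend
holomorphically over `K`. As the ideal sheaf of a hypersurface is locally generated by a
reduced equation, it is equivalent to ask this of reduced equations only; with `h = 1` on the
complement of `K` one sees that `α` is holomorphic there. The values of `α` on `K` play no role. -/
def HasLogPoleAlong (K : Set M) (α : ∀ q : M, TangentSpace (CModel m) q →L[ℂ] ℂ) : Prop :=
  ∀ (U : Set M) (h : M → ℂ), IsOpen U → (∀ q ∈ U, HolFunctionAt (m := m) h q) →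
    (∀ q ∈ U ∩ K, h q = 0) →
    (∃ β : ∀ q : M, TangentSpace (CModel m) q →L[ℂ] ℂ,
      (∀ q ∈ U, HolFormAt β q) ∧ ∀ q ∈ U \ K, β q = h q • α q) ∧
    (∃ β : ∀ q : M, TangentSpace (CModel m) q →ₗ[ℂ] TangentSpace (CModel m) q →ₗ[ℂ] ℂ,
      (∀ q ∈ U, HolBilinAt β q) ∧
      ∀ q ∈ U \ K, ∀ X Y : ∀ r : M, TangentSpace (CModel m) r,
        HolFieldAt X q → HolFieldAt Y q → β q (X q) (Y q) = h q * formExtDeriv α X Y q)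

/-- The form `α`, given on the complement of the hypersurface `K`, has constant residue `c` along
the regular part of `K`: wherever `K` is given by an equation `h = 0` with `dh ≠ 0` on `K`, the form
`α - c dh / h` extends holomorphically over `K`. -/
def HasResidueAlongReg (K : Set M) (α : ∀ q : M, TangentSpace (CModel m) q →L[ℂ] ℂ)
    (c : ℂ) : Prop :=
  ∀ (U : Set M) (h : M → ℂ), IsOpen U → (∀ q ∈ U, HolFunctionAt (m := m) h q) →
    (∀ q ∈ U, q ∈ K ↔ h q = 0) → (∀ q ∈ U ∩ K, mvfderiv (CModel m) h q ≠ 0) →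
    ∃ β : ∀ q : M, TangentSpace (CModel m) q →L[ℂ] ℂ,
      (∀ q ∈ U, HolFormAt β q) ∧
      ∀ q ∈ U \ K, α q = (c / h q) • mvfderiv (CModel m) h q + β q

/-- The local coordinate system `φ` (a holomorphic chart) is flat for the metric `g`: the
coefficients of `g` in these coordinates are constant. -/
def IsFlatChart
    (g : ∀ q : M, TangentSpace (CModel m) q →ₗ[ℂ] TangentSpace (CModel m) q →ₗ[ℂ] ℂ)
    (φ : OpenPartialHomeomorph M (Fin m → ℂ)) : Prop :=
  φ ∈ IsManifold.maximalAtlas (CModel m) ω M ∧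
  ∃ B : (Fin m → ℂ) →ₗ[ℂ] (Fin m → ℂ) →ₗ[ℂ] ℂ, ∀ q ∈ φ.source,
    ∀ v w : TangentSpace (CModel m) q,
      g q v w = B (mvfderiv (CModel m) φ q v) (mvfderiv (CModel m) φ q w)

end Holomorphic

/-- A Frobenius manifold structure `(∘, e, E, g)` on the complex manifold `M` of dimension `m`. -/
structure FrobeniusManifold (m : ℕ) (M : Type*) [TopologicalSpace M]
    [ChartedSpace (Fin m → ℂ) M] [IsManifold (CModel m) ω M] where
  /-- the multiplication `∘` on the tangent spaces -/
  mul : ∀ p : M,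
    TangentSpace (CModel m) p →ₗ[ℂ] TangentSpace (CModel m) p →ₗ[ℂ] TangentSpace (CModel m) p
  /-- the unit field `e` -/
  unit : ∀ p : M, TangentSpace (CModel m) p
  /-- the Euler field `E` -/
  euler : ∀ p : M, TangentSpace (CModel m) p
  /-- the metric `g` -/
  metric : ∀ p : M, TangentSpace (CModel m) p →ₗ[ℂ] TangentSpace (CModel m) p →ₗ[ℂ] ℂ
  /-- the Levi-Civita connection of `g`; `∇_X Y` at `p` is `nabla Y p (X p)` -/
  nabla : CovariantDerivative (CModel m) (Fin m → ℂ) (TangentSpace (CModel m) : M → Type _)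
  /-- the number `D` with `Lie_E g = D g` -/
  weight : ℂ
  mul_comm : ∀ p v w, mul p v w = mul p w v
  mul_assoc : ∀ p v w z, mul p (mul p v w) z = mul p v (mul p w z)
  mul_hol : ∀ p X Y, HolFieldAt X p → HolFieldAt Y p →
    HolFieldAt (fun q => mul q (X q) (Y q)) p
  unit_mul : ∀ p v, mul p (unit p) v = v
  unit_hol : ∀ p, HolFieldAt unit p
  euler_hol : ∀ p, HolFieldAt euler p
  metric_symm : ∀ p v w, metric p v w = metric p w v
  metric_nondeg : ∀ p v, (∀ w, metric p v w = 0) → v = 0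
  metric_hol : ∀ p, HolBilinAt metric p
  metric_mul : ∀ p v w z, metric p (mul p v w) z = metric p v (mul p w z)
  /-- `∇_X Y - ∇_Y X = [X, Y]` -/
  nabla_torsion : ∀ p X Y, HolFieldAt X p → HolFieldAt Y p →
    nabla Y p (X p) - nabla X p (Y p) = VectorField.mlieBracket (CModel m) X Y p
  /-- `X g(Y, Z) = g(∇_X Y, Z) + g(Y, ∇_X Z)` -/
  nabla_metric : ∀ p X Y Z, HolFieldAt X p → HolFieldAt Y p → HolFieldAt Z p →
    mvfderiv (CModel m) (fun q => metric q (Y q) (Z q)) p (X p)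
      = metric p (nabla Y p (X p)) (Z p) + metric p (Y p) (nabla Z p (X p))
  /-- potentiality: `(∇_X ∘)(Y, Z) = (∇_Y ∘)(X, Z)`, so the (3,1)-tensor `∇ ∘` is symmetric -/
  potentiality : ∀ p X Y Z, HolFieldAt X p → HolFieldAt Y p → HolFieldAt Z p →
    nabla (fun q => mul q (Y q) (Z q)) p (X p)
        - mul p (nabla Y p (X p)) (Z p) - mul p (Y p) (nabla Z p (X p))
      = nabla (fun q => mul q (X q) (Z q)) p (Y p)
        - mul p (nabla X p (Y p)) (Z p) - mul p (X p) (nabla Z p (Y p))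
  /-- the metric is flat: it is locally isometric to a constant metric on `ℂ^m` -/
  metric_flat : ∀ p, ∃ φ : OpenPartialHomeomorph M (Fin m → ℂ), p ∈ φ.source ∧ IsFlatChart metric φ
  unit_flat : ∀ p, nabla unit p = 0
  /-- `Lie_E (∘) = ∘` -/
  euler_mul : ∀ p X Y, HolFieldAt X p → HolFieldAt Y p →
    VectorField.mlieBracket (CModel m) euler (fun q => mul q (X q) (Y q)) p
        - mul p (VectorField.mlieBracket (CModel m) euler X p) (Y p)
        - mul p (X p) (VectorField.mlieBracket (CModel m) euler Y p)
      = mul p (X p) (Y p)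
  /-- `Lie_E g = D g` -/
  euler_metric : ∀ p X Y, HolFieldAt X p → HolFieldAt Y p →
    mvfderiv (CModel m) (fun q => metric q (X q) (Y q)) p (euler p)
        - metric p (VectorField.mlieBracket (CModel m) euler X p) (Y p)
        - metric p (X p) (VectorField.mlieBracket (CModel m) euler Y p)
      = weight * metric p (X p) (Y p)

/-- The product at the point `t` of the tangent vectors `x`, `y` of the F-manifold
`I_2(n) A_1^{m-2}` on `ℂ^m`: `δ_1 ∘ δ_1 = δ_1`, `δ_1 ∘ δ_2 = δ_2`, `δ_2 ∘ δ_2 = t_2^{n-2} δ_1`, and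
`δ_i ∘ δ_j = δ_{ij} δ_i` for the other pairs `i`, `j`. (The indices of the coordinates are shifted
by one.) -/
def modelMul {m : ℕ} (hm : 2 ≤ m) (n : ℕ) (t x y : Fin m → ℂ) : Fin m → ℂ := fun i =>
  if i = ⟨0, by lia⟩ then
    x ⟨0, by lia⟩ * y ⟨0, by lia⟩ + t ⟨1, by lia⟩ ^ (n - 2) * (x ⟨1, by lia⟩ * y ⟨1, by lia⟩)
  else if i = ⟨1, by lia⟩ then
    x ⟨0, by lia⟩ * y ⟨1, by lia⟩ + x ⟨1, by lia⟩ * y ⟨0, by lia⟩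
  else x i * y i

namespace FrobeniusManifold

variable {m : ℕ} {M : Type*} [TopologicalSpace M] [ChartedSpace (Fin m → ℂ) M]
  [IsManifold (CModel m) ω M] (F : FrobeniusManifold m M)

/-- The multiplication on `T_p M` is semisimple: `T_p M` is a direct sum of `m` one-dimensional
algebras, i.e. it has a basis of orthogonal idempotents. -/
def SemisimpleAt (p : M) : Prop :=
  ∃ b : Module.Basis (Fin m) ℂ (TangentSpace (CModel m) p),
    ∀ i j, F.mul p (b i) (b j) = if i = j then b i else 0

/-- The caustic: the set of points where the multiplication is not semisimple. -/
def caustic : Set M := {p | ¬ F.SemisimpleAt p}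

/-- The multiplication is generically semisimple. -/
def IsMassive : Prop := Dense {p | F.SemisimpleAt p}

/-- The germ at `p` of the F-manifold `(M, ∘, e)` is isomorphic to the germ at `0` of
`I_2(n) A_1^{m-2}`. (An isomorphism of the multiplications respects the units.) -/
def HasGermI2 (n : ℕ) (p : M) : Prop :=
  ∃ (hm : 2 ≤ m) (φ : OpenPartialHomeomorph M (Fin m → ℂ)),
    φ ∈ IsManifold.maximalAtlas (CModel m) ω M ∧ p ∈ φ.source ∧ φ p = 0 ∧
    ∀ q ∈ φ.source, ∀ v w : TangentSpace (CModel m) q,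
      mvfderiv (CModel m) φ q (F.mul q v w)
        = modelMul hm n (φ q) (mvfderiv (CModel m) φ q v) (mvfderiv (CModel m) φ q w)

/-- Near `p`, the functions `u_i` are canonical coordinates, normalized by `E = ∑ u_i e_i`, and
`e_i = ∂ / ∂u_i` are the idempotent vector fields. -/
structure IsCanonicalAt (p : M) (u : Fin m → M → ℂ)
    (e : Fin m → ∀ q : M, TangentSpace (CModel m) q) : Prop where
  coord_hol : ∀ i, HolFunctionAt (m := m) (u i) p
  field_hol : ∀ i, HolFieldAt (e i) p
  dual : ∀ᶠ q in 𝓝 p, ∀ i j, mvfderiv (CModel m) (u i) q (e j q) = if i = j then 1 else 0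
  idempotent : ∀ᶠ q in 𝓝 p, ∀ i j, F.mul q (e i q) (e j q) = if i = j then e i q else 0
  euler_eq : ∀ᶠ q in 𝓝 p, F.euler q = ∑ i, u i q • e i q

/-- `η_i = g(e_i, e_i)` -/
def eta (e : Fin m → ∀ q : M, TangentSpace (CModel m) q) (i : Fin m) (q : M) : ℂ :=
  F.metric q (e i q) (e i q)

/-- `η_ij = e_i η_j` -/
def eta₂ (e : Fin m → ∀ q : M, TangentSpace (CModel m) q) (i j : Fin m) (q : M) : ℂ :=
  mvfderiv (CModel m) (F.eta e j) q (e i q)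

/-- `(1/8) ∑_{i ≠ j} (u_i - u_j) η_ij² / (η_i η_j) du_i` -/
def tauForm (u : Fin m → M → ℂ) (e : Fin m → ∀ q : M, TangentSpace (CModel m) q) (q : M) :
    TangentSpace (CModel m) q →L[ℂ] ℂ :=
  (1 / 8 : ℂ) • ∑ i, ∑ j ∈ Finset.univ.erase i,
    ((u i q - u j q) * (F.eta₂ e i j q ^ 2 / (F.eta e i q * F.eta e j q))) •
      mvfderiv (CModel m) (u i) q

open Classical in
/-- The 1-form `d log τ_I` on the complement of the caustic. Canonical coordinates normalized by the
Euler field are unique up to renumbering, so that the choice does not matter. -/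
def dLogTau (q : M) : TangentSpace (CModel m) q →L[ℂ] ℂ :=
  if h : ∃ ue : (Fin m → M → ℂ) × (Fin m → ∀ r : M, TangentSpace (CModel m) r),
      F.IsCanonicalAt q ue.1 ue.2
  then F.tauForm h.choose.1 h.choose.2 q
  else 0

/-- Near `p`, the function `G` is a G-function `log τ_I - (1/24) log J`. Here `J` is the determinant
of the base change `(∂t_i / ∂u_j)` between flat coordinates `t_i` and canonical coordinates `u_j`.
(`log τ_I` is given up to an additive constant, which also accounts for a constant factor in
`J`.) -/
def IsGFunctionAt (G : M → ℂ) (p : M) : Prop :=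
  ∃ (u : Fin m → M → ℂ) (e : Fin m → ∀ q : M, TangentSpace (CModel m) q)
    (φ : OpenPartialHomeomorph M (Fin m → ℂ)) (logτ logJ : M → ℂ),
    F.IsCanonicalAt p u e ∧ IsFlatChart F.metric φ ∧ p ∈ φ.source ∧
    HolFunctionAt (m := m) logτ p ∧ HolFunctionAt (m := m) logJ p ∧
    (∀ᶠ q in 𝓝 p, mvfderiv (CModel m) logτ q = F.dLogTau q) ∧
    (∀ᶠ q in 𝓝 p, Complex.exp (logJ q) =
      Matrix.det (Matrix.of fun i j => mvfderiv (CModel m) φ q (e j q) i)) ∧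
    ∀ᶠ q in 𝓝 p, G q = logτ q - 1 / 24 * logJ q

/-- The G-function extends holomorphically over the caustic: there is a holomorphic function on `M`
which is a G-function near each semisimple point. -/
def GFunctionExtends : Prop :=
  ∃ G : M → ℂ, (∀ p, HolFunctionAt (m := m) G p) ∧ ∀ p, p ∉ F.caustic → F.IsGFunctionAt G p

end FrobeniusManifold

end

/-! ### Osgood's lemma: complex differentiability in several variables implies analyticity. -/

section Osgood

open Metric Set

variable {E F : Type} [NormedAddCommGroup E] [NormedSpace ℂ E]
  [NormedAddCommGroup F] [NormedSpace ℂ F]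

/-! The theorem is a local computation at generic points of the caustic, followed by an extension
principle of Hartogs type and, for the G-function, by integration on a simply connected manifold.

At a semisimple point the idempotents lift to holomorphic fields e_i. Potentiality, torsion freeness
and flatness of the unit give η_ij = η_ji, the formula for ∇_{e_i} e_j and [e_i, e_j] = 0; the Euler
field yields the canonical coordinates as eigenvalues of E∘. Flatness of g gives the Darboux-Egoroff
equations (`IsIdemFrame.deriv_eta₂`), and these imply that d log τ_I is closed. As J² is a constant
multiple of ∏ η_i, the G-functions are the primitives of d log τ_I - (1/48) d log ∏ η_i.

At a generic point of the caustic let t = t_2 and r² = t^{n-2}. The first two idempotents are (δ_1 ±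
r⁻¹δ_2)/2, the others are the δ_j. The difference u_1 - u_2 is 2rε, where ε is the δ_2-coefficient
of E; differentiating it gives a linear equation for ε whose only holomorphic solution is ε = (2/n)t
(`eulerCoeff_eq`). In the coefficients of d log τ_I along the δ_k, all terms coming from pairs other
than (1,2) are even in r after symmetrization and are regular. The pair (1,2) contributes only along
δ_2, with the polar part -(n-2)²/(16n) · 1/t (`germ_singular_part`, `dLogTau_chartField`). Since ∏
η_i is a unit divided by t^{n-2}, the differential of the G-function has residue -(n-2)²/(16n) +
(n-2)/48 = -(n-2)(n-3)/(24n), which for n ≥ 3 vanishes exactly when n = 3.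

The local result is known only on a dense part of the caustic. The caustic is locally the zero set
of the discriminant of the trace form, and a holomorphic function off a hypersurface which extends
over a dense part of it extends over all of it (`extendsAt_of_subset_closure`, by circle averages
and Baire's theorem). This proves (a). For n = 3 the differential of the G-function becomes a closed
holomorphic form on M, and it has a global primitive because M is simply connected. -/

theorem hasDerivAt_comp_line {f : E → F} {z v : E} {ζ : ℂ}
    (hf : DifferentiableAt ℂ f (z + ζ • v)) :
    HasDerivAt (fun η : ℂ => f (z + η • v)) (fderiv ℂ f (z + ζ • v) v) ζ := by
  have h1 : HasDerivAt (fun η : ℂ => z + η • v) v ζ := by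
    simpa using ((hasDerivAt_id ζ).smul_const v).const_add z
  exact hf.hasFDerivAt.comp_hasDerivAt ζ h1

/-- Cauchy's estimate for the derivative of a bounded holomorphic function of several variables. -/
theorem norm_fderiv_le_of_bound {f : E → F} {z : E} {ρ C : ℝ} (hρ : 0 < ρ)
    (hf : ∀ w ∈ closedBall z ρ, DifferentiableAt ℂ f w) (hC : ∀ w ∈ closedBall z ρ, ‖f w‖ ≤ C) :
    ‖fderiv ℂ f z‖ ≤ C / ρ := by
  have hC0 : 0 ≤ C := (norm_nonneg _).trans (hC z (mem_closedBall_self hρ.le))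
  -- The norm is tested on directions with 1 ≤ ‖v‖ < 2. Such v are nonzero, and the disc of radius ρ
  -- / ‖v‖ on the line z + ℂv lies in the ball, so the one-variable estimate applies.
  refine ContinuousLinearMap.opNorm_le_of_shell' (ε := 2) (c := (2 : ℂ)⁻¹) two_pos (by positivity)
    (by norm_num) fun v h1 h2 => ?_
  have hv : 0 < ‖v‖ := by
    refine lt_of_lt_of_le ?_ h1
    norm_num
  have hmem : ∀ ζ : ℂ, ζ ∈ closedBall (0 : ℂ) (ρ / ‖v‖) → z + ζ • v ∈ closedBall z ρ := by
    intro ζ hζ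
    simp only [mem_closedBall, dist_self_add_left, norm_smul, dist_zero_right] at hζ ⊢
    rwa [le_div_iff₀ hv] at hζ
  have h := Complex.norm_deriv_le_of_forall_mem_sphere_norm_le (c := 0) (R := ρ / ‖v‖) (C := C)
    (f := fun ζ : ℂ => f (z + ζ • v)) (by positivity)
    (DifferentiableOn.diffContOnCl (fun ζ hζ => by
      refine (hasDerivAt_comp_line (hf _ (hmem _ ?_))).differentiableAt.differentiableWithinAt
      exact closure_ball_subset_closedBall hζ))
    (fun ζ hζ => hC _ (hmem _ (sphere_subset_closedBall hζ)))
  have h0 := (hasDerivAt_comp_line (f := f) (z := z) (v := v) (ζ := 0)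
    (by simpa using hf z (mem_closedBall_self hρ.le))).deriv
  rw [h0] at h
  simp only [zero_smul, add_zero] at h
  calc _ ≤ _ := h
    _ = C / ρ * ‖v‖ := by field_simp

/-- Cauchy's formula on the line z + ℂv writes the derivative in the direction v as an integral of
values of f over a circle of fixed radius. The integrand is differentiable in z, with derivative
bounded by Cauchy's estimate, so one may differentiate under the integral sign. -/
theorem differentiableOn_fderiv_of_isOpen [FiniteDimensional ℂ E] [FiniteDimensional ℂ F] {f : E → F}
    {U : Set E} (hU : IsOpen U) (hf : DifferentiableOn ℂ f U) :
    DifferentiableOn ℂ (fderiv ℂ f) U := by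
  borelize E
  borelize F
  have : ProperSpace E := FiniteDimensional.proper ℂ E
  have : CompleteSpace F := FiniteDimensional.complete ℂ F
  have : ProperSpace (E →L[ℂ] F) := FiniteDimensional.proper ℂ (E →L[ℂ] F)
  -- it suffices to consider directional derivatives
  suffices H : ∀ v, DifferentiableOn ℂ (fun z => fderiv ℂ f z v) U by
    let d := Module.finrank ℂ E
    have hd : d = Module.finrank ℂ (Fin d → ℂ) := (Module.finrank_fin_fun ℂ).symm
    let e₁ := ContinuousLinearEquiv.ofFinrankEq hd
    let e₂ := (e₁.arrowCongr (1 : F ≃L[ℂ] F)).trans (ContinuousLinearEquiv.piRing (Fin d))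
    have : DifferentiableOn ℂ (e₂ ∘ fderiv ℂ f) U :=
      differentiableOn_pi.2 fun i => H _
    exact e₂.comp_differentiableOn_iff.1 this
  intro v z₀ hz₀
  obtain ⟨R, hR, hRU⟩ : ∃ R > 0, closedBall z₀ R ⊆ U :=
    nhds_basis_closedBall.mem_iff.1 (hU.mem_nhds hz₀)
  have hfc : ContinuousOn f (closedBall z₀ R) := hf.continuousOn.mono hRU
  obtain ⟨C, hC⟩ := (isCompact_closedBall z₀ R).exists_bound_of_continuousOn hfc
  -- The circle has radius s with s‖v‖ ≤ R/4: for z within R/4 of z₀ it stays within R/2 of z₀,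
  -- which leaves room R/2 for Cauchy's estimate at its points.
  obtain ⟨s, hs, hsv⟩ : ∃ s > 0, s * ‖v‖ ≤ R / 4 := by
    refine ⟨R / (4 * (‖v‖ + 1)), by positivity, ?_⟩
    rw [div_mul_eq_mul_div, div_le_iff₀ (by positivity)]
    nlinarith [norm_nonneg v]
  have hdiff : ∀ w ∈ closedBall z₀ R, DifferentiableAt ℂ f w := fun w hw =>
    hf.differentiableAt (hU.mem_nhds (hRU hw))
  have hcm : ∀ θ, ‖circleMap 0 s θ‖ = s := fun θ => by simp [abs_of_pos hs]
  have hmem : ∀ z ∈ ball z₀ (R / 4), ∀ ζ : ℂ, ‖ζ‖ ≤ s → z + ζ • v ∈ closedBall z₀ (R / 2) := by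
    intro z hz ζ hζ
    rw [mem_ball, dist_eq_norm] at hz
    rw [mem_closedBall, dist_eq_norm]
    calc ‖z + ζ • v - z₀‖ = ‖(z - z₀) + ζ • v‖ := by congr 1; abel
      _ ≤ ‖z - z₀‖ + ‖ζ • v‖ := norm_add_le _ _
      _ ≤ R / 4 + R / 4 := by
        rw [norm_smul]
        exact add_le_add hz.le ((mul_le_mul_of_nonneg_right hζ (norm_nonneg _)).trans hsv)
      _ = R / 2 := by ring
  have hsub : closedBall z₀ (R / 2) ⊆ closedBall z₀ R := closedBall_subset_closedBall (by linarith)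
  have hrep : ∀ z ∈ ball z₀ (R / 4), fderiv ℂ f z v = (2 * Real.pi * Complex.I : ℂ)⁻¹ •
      ∫ θ in (0 : ℝ)..2 * Real.pi, (deriv (circleMap 0 s) θ * ((circleMap 0 s θ) ^ 2)⁻¹) •
        f (z + circleMap 0 s θ • v) := by
    intro z hz
    have hg : ∀ ζ ∈ closedBall (0 : ℂ) s, DifferentiableAt ℂ (fun η : ℂ => f (z + η • v)) ζ :=
      fun ζ hζ => (hasDerivAt_comp_line (hdiff _ (hsub (hmem z hz ζ (by simpa using hζ))))).differentiableAt
    have h := DiffContOnCl.deriv_eq_smul_circleIntegral (c := 0) (R := s)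
      (f := fun η : ℂ => f (z + η • v)) hs
      (DifferentiableOn.diffContOnCl fun ζ hζ =>
        (hg ζ (closure_ball_subset_closedBall hζ)).differentiableWithinAt)
    have h0 := (hasDerivAt_comp_line (f := f) (z := z) (v := v) (ζ := 0)
      (hdiff _ (hsub (hmem z hz 0 (by simpa using hs.le))))).deriv
    simp only [zero_smul, add_zero] at h0
    rw [← h0, eq_inv_smul_iff₀ Complex.two_pi_I_ne_zero, ← h]
    simp only [circleIntegral, smul_smul, sub_zero, one_div]
  have hder : DifferentiableAt ℂ (fun z => ∫ θ in (0 : ℝ)..2 * Real.pi,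
      (deriv (circleMap 0 s) θ * ((circleMap 0 s θ) ^ 2)⁻¹) • f (z + circleMap 0 s θ • v)) z₀ := by
    have hk : ∀ θ, circleMap 0 s θ ≠ 0 := fun θ => circleMap_ne_center hs.ne'
    have hkc : Continuous fun θ => deriv (circleMap 0 s) θ * ((circleMap 0 s θ) ^ 2)⁻¹ := by
      refine Continuous.mul ?_ (Continuous.inv₀ (by fun_prop) fun θ => pow_ne_zero _ (hk θ))
      have : deriv (circleMap 0 s) = fun θ => circleMap 0 s θ * Complex.I := by
        ext θ; simp
      rw [this]
      fun_prop
    have hcont : ∀ z ∈ ball z₀ (R / 4), Continuous fun θ : ℝ =>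
        (deriv (circleMap 0 s) θ * ((circleMap 0 s θ) ^ 2)⁻¹) • f (z + circleMap 0 s θ • v) := by
      intro z hz
      refine hkc.smul (hfc.comp_continuous (by fun_prop) fun θ => hsub (hmem z hz _ (hcm θ).le))
    obtain ⟨K, hK⟩ := (isCompact_Icc (a := (0 : ℝ)) (b := 2 * Real.pi)).exists_bound_of_continuousOn
      hkc.continuousOn
    have hz₀' : z₀ ∈ ball z₀ (R / 4) := mem_ball_self (by positivity)
    refine (intervalIntegral.hasFDerivAt_integral_of_dominated_of_fderiv_le
      (F' := fun z θ => (deriv (circleMap 0 s) θ * ((circleMap 0 s θ) ^ 2)⁻¹) •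
        fderiv ℂ f (z + circleMap 0 s θ • v)) (bound := fun _ => K * (C / (R / 2)))
      (ball_mem_nhds z₀ (show 0 < R / 4 by positivity)) ?_ ?_ ?_ ?_ ?_ ?_).differentiableAt
    · filter_upwards [ball_mem_nhds z₀ (show 0 < R / 4 by positivity)] with z hz
      exact (hcont z hz).aestronglyMeasurable
    · exact (hcont z₀ hz₀').intervalIntegrable _ _
    · refine hkc.aestronglyMeasurable.smul ?_
      have : MeasureTheory.StronglyMeasurable fun θ : ℝ => fderiv ℂ f (z₀ + circleMap 0 s θ • v) :=
        ((measurable_fderiv ℂ f).comp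
          (f := fun θ : ℝ => z₀ + circleMap 0 s θ • v) (Continuous.measurable (by fun_prop))).stronglyMeasurable
      exact this.aestronglyMeasurable
    · refine Filter.Eventually.of_forall fun θ hθ z hz => ?_
      rw [norm_smul]
      have hθ' : θ ∈ Icc 0 (2 * Real.pi) := by
        rw [uIoc_of_le (by positivity)] at hθ
        exact ⟨hθ.1.le, hθ.2⟩
      have hm := hmem z hz _ (hcm θ).le
      refine mul_le_mul (hK θ hθ') ?_ (norm_nonneg _) ((norm_nonneg _).trans (hK θ hθ'))
      have hb : closedBall (z + circleMap 0 s θ • v) (R / 2) ⊆ closedBall z₀ R := by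
        refine closedBall_subset_closedBall' ?_
        rw [mem_closedBall] at hm
        linarith
      exact norm_fderiv_le_of_bound (by positivity) (fun w hw => hdiff w (hb hw))
        fun w hw => hC w (hb hw)
    · exact intervalIntegrable_const
    · refine Filter.Eventually.of_forall fun θ _ z hz => ?_
      have h1 : HasFDerivAt (fun z => f (z + circleMap 0 s θ • v))
          (fderiv ℂ f (z + circleMap 0 s θ • v)) z := by
        have := (hdiff _ (hsub (hmem z hz _ (hcm θ).le))).hasFDerivAt.comp z
          ((hasFDerivAt_id z).add_const (circleMap 0 s θ • v))
        simpa using! this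
      exact h1.const_smul _
  have hev : (fun z => fderiv ℂ f z v) =ᶠ[𝓝 z₀] fun z => (2 * Real.pi * Complex.I : ℂ)⁻¹ •
      ∫ θ in (0 : ℝ)..2 * Real.pi, (deriv (circleMap 0 s) θ * ((circleMap 0 s θ) ^ 2)⁻¹) •
        f (z + circleMap 0 s θ • v) := by
    filter_upwards [ball_mem_nhds z₀ (show 0 < R / 4 by positivity)] with z hz using hrep z hz
  exact ((hder.const_smul _).congr_of_eventuallyEq hev).differentiableWithinAt

theorem contDiffOn_of_complex_differentiableOn [FiniteDimensional ℂ E] (n : ℕ) :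
    ∀ {F : Type} [NormedAddCommGroup F] [NormedSpace ℂ F] [FiniteDimensional ℂ F] {f : E → F}
      {U : Set E}, IsOpen U → DifferentiableOn ℂ f U → ContDiffOn ℂ n f U := by
  induction n with
  | zero =>
    intro F _ _ _ f U hU hf
    exact contDiffOn_zero.2 hf.continuousOn
  | succ n ih =>
    intro F _ _ _ f U hU hf
    rw [Nat.cast_succ, contDiffOn_succ_iff_fderiv_of_isOpen hU]
    exact ⟨hf, by simp, ih hU (differentiableOn_fderiv_of_isOpen hU hf)⟩

/-- Cauchy's estimate applied n times, each derivative using up a shell of width ρ; hence the total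
radius nρ and the factor ρ ^ n. -/
theorem norm_iteratedFDeriv_le_of_bound [FiniteDimensional ℂ E] (n : ℕ) :
    ∀ {F : Type} [NormedAddCommGroup F] [NormedSpace ℂ F] [FiniteDimensional ℂ F] {f : E → F}
      {U : Set E} {z : E} {ρ C : ℝ}, IsOpen U → DifferentiableOn ℂ f U → 0 < ρ →
      closedBall z (n * ρ) ⊆ U → (∀ w ∈ closedBall z (n * ρ), ‖f w‖ ≤ C) →
      ‖iteratedFDeriv ℂ n f z‖ ≤ C / ρ ^ n := by
  induction n with
  | zero =>
    intro F _ _ _ f U z ρ C hU hf hρ hz hC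
    simpa using hC z (by simp)
  | succ n ih =>
    intro F _ _ _ f U z ρ C hU hf hρ hz hC
    rw [← norm_iteratedFDeriv_fderiv]
    have hb : ∀ w ∈ closedBall z (n * ρ), closedBall w ρ ⊆ closedBall z ((n + 1 : ℕ) * ρ) := by
      intro w hw
      refine closedBall_subset_closedBall' ?_
      rw [mem_closedBall] at hw
      push_cast
      linarith
    have h := ih (z := z) (ρ := ρ) (C := C / ρ) hU (differentiableOn_fderiv_of_isOpen hU hf) hρ
      ((closedBall_subset_closedBall (by push_cast; nlinarith)).trans hz)
      (fun w hw => norm_fderiv_le_of_bound hρ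
        (fun x hx => hf.differentiableAt (hU.mem_nhds (hz (hb w hw hx))))
        (fun x hx => hC x (hb w hw hx)))
    rwa [div_div, ← pow_succ'] at h

/-- **Osgood's lemma**: a function of several complex variables that is complex differentiable on an
open set is analytic. -/
theorem DifferentiableOn.analyticAt_of_finiteDimensional [FiniteDimensional ℂ E] [FiniteDimensional ℂ F]
    {f : E → F} {U : Set E} {z : E} (hf : DifferentiableOn ℂ f U) (hU : U ∈ 𝓝 z) :
    AnalyticAt ℂ f z := by
  have : ProperSpace E := FiniteDimensional.proper ℂ E
  have : CompleteSpace F := FiniteDimensional.complete ℂ F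
  obtain ⟨V, hVU, hV, hzV⟩ := _root_.mem_nhds_iff.1 hU
  replace hf := hf.mono hVU
  obtain ⟨R, hR, hRV⟩ : ∃ R > 0, closedBall z R ⊆ V :=
    nhds_basis_closedBall.mem_iff.1 (hV.mem_nhds hzV)
  obtain ⟨C, hC⟩ := (isCompact_closedBall z R).exists_bound_of_continuousOn
    (hf.continuousOn.mono hRV)
  have hC0 : 0 ≤ C := (norm_nonneg _).trans (hC z (mem_closedBall_self hR.le))
  let p : FormalMultilinearSeries ℂ E F := fun n => ((n.factorial : ℂ)⁻¹) • iteratedFDeriv ℂ n f z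
  -- Taking ρ = R/n costs the factor n^n / n! ≤ e^n ≤ 3^n, so the Taylor series converges on the
  -- ball of radius R/3.
  have hp : ∀ n, ‖p n‖ * (R / 3) ^ n ≤ C := by
    intro n
    rcases Nat.eq_zero_or_pos n with rfl | hn
    · simpa [p] using hC z (mem_closedBall_self hR.le)
    have hn' : (0 : ℝ) < n := by exact_mod_cast hn
    have h := norm_iteratedFDeriv_le_of_bound n (ρ := R / n) (z := z) (C := C) hV hf (by positivity)
      (by rwa [mul_div_cancel₀ _ hn'.ne']) (by rwa [mul_div_cancel₀ _ hn'.ne'])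
    have h1 : ‖p n‖ = (n.factorial : ℝ)⁻¹ * ‖iteratedFDeriv ℂ n f z‖ := by
      simp [p, norm_smul]
    have h2 : (n : ℝ) ^ n / n.factorial ≤ 3 ^ n := by
      refine (Real.pow_div_factorial_le_exp (n : ℝ) hn'.le n).trans ?_
      rw [← Real.exp_one_pow]
      exact pow_le_pow_left₀ (Real.exp_pos _).le (Real.exp_one_lt_d9.le.trans (by norm_num)) n
    calc ‖p n‖ * (R / 3) ^ n ≤ ((n.factorial : ℝ)⁻¹ * (C / (R / n) ^ n)) * (R / 3) ^ n := by
          rw [h1]; gcongr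
      _ = C * ((n : ℝ) ^ n / n.factorial) / 3 ^ n := by
          rw [div_pow, div_pow]
          field_simp
      _ ≤ C * 3 ^ n / 3 ^ n := by gcongr
      _ = C := by field_simp
  have hrad : ENNReal.ofReal (R / 3) ≤ p.radius := by
    have := p.le_radius_of_bound C (r := ⟨R / 3, by positivity⟩) hp
    convert this using 1
    exact ENNReal.ofReal_eq_coe_nnreal (by positivity)
  refine ⟨p, ENNReal.ofReal (R / 3), hrad, by simpa using by positivity, ?_⟩
  intro v hv
  have hv' : ‖v‖ < R / 3 := by simpa [Metric.eball_ofReal] using hv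
  let L : ℂ →L[ℂ] E := ContinuousLinearMap.toSpanSingleton ℂ v
  -- The sum of the series is identified with f along lines: ζ ↦ f (z + ζv) is holomorphic on the
  -- disc of radius 2, as 2R/3 < R, and its one-variable Taylor series is evaluated at ζ = 1.
  have hmem : ∀ ζ : ℂ, ‖ζ‖ < 2 → z + ζ • v ∈ V := by
    intro ζ hζ
    refine hRV ?_
    rw [mem_closedBall, dist_self_add_left, norm_smul]
    nlinarith [norm_nonneg v, norm_nonneg ζ]
  have hg : DifferentiableOn ℂ (fun ζ : ℂ => f (z + ζ • v)) (ball 0 2) := fun ζ hζ =>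
    (hasDerivAt_comp_line (hf.differentiableAt
      (hV.mem_nhds (hmem ζ (by simpa using hζ))))).differentiableAt.differentiableWithinAt
  have hsum := Complex.hasSum_taylorSeries_on_ball hg (z := 1) (by simp)
  convert hsum using 1
  · ext n
    simp only [sub_zero, one_pow, one_smul, p, ContinuousMultilinearMap.smul_apply]
    congr 1
    rw [iteratedDeriv_eq_iteratedFDeriv]
    have hW : IsOpen ((fun x => z + x) ⁻¹' V) := hV.preimage (by fun_prop)
    have hcd : ContDiffOn ℂ n (fun x => f (z + x)) ((fun x => z + x) ⁻¹' V) :=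
      (contDiffOn_of_complex_differentiableOn n hV hf).comp (by fun_prop) (fun x hx => hx)
    have hx : L 0 ∈ (fun x => z + x) ⁻¹' V := by simpa using hzV
    have h := L.iteratedFDerivWithin_comp_right hcd hW.uniqueDiffOn
      (hW.preimage L.continuous).uniqueDiffOn hx (i := n) le_rfl
    rw [iteratedFDerivWithin_of_isOpen n (hW.preimage L.continuous) (by simpa using hzV),
      iteratedFDerivWithin_of_isOpen n hW hx, iteratedFDeriv_comp_add_left] at h
    have h' : iteratedFDeriv ℂ n (fun ζ : ℂ => f (z + ζ • v)) 0
        = iteratedFDeriv ℂ n ((fun x => f (z + x)) ∘ L) 0 := by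
      congr 1
    rw [h', h]
    simp [L]
  · simp

end Osgood

/-! ### Extension of holomorphic functions across a hypersurface. -/

section Hartogs

open Metric Set Filter

theorem isOpen_setOf_forall_sphere {E : Type} [NormedAddCommGroup E] [NormedSpace ℂ E]
    {A : Set E} (hA : IsOpen A) (v : E) (s : ℝ) :
    IsOpen {z : E | ∀ ζ : ℂ, ‖ζ‖ = s → z + ζ • v ∈ A} := by
  rw [isOpen_iff_mem_nhds]
  intro z hz
  have hc : IsCompact (sphere (0 : ℂ) s) := isCompact_sphere 0 s
  have : ∀ᶠ w in 𝓝 z, ∀ ζ ∈ sphere (0 : ℂ) s, w + ζ • v ∈ A := by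
    apply hc.eventually_forall_of_forall_eventually
    intro ζ hζ
    have hcont : ContinuousAt (fun p : E × ℂ => p.1 + p.2 • v) (z, ζ) := by fun_prop
    exact hcont.eventually (hA.mem_nhds (hz ζ (by simpa using hζ)))
  filter_upwards [this] with w hw ζ hζ using hw ζ (by simpa using hζ)

variable {E : Type} [NormedAddCommGroup E] [NormedSpace ℂ E] [FiniteDimensional ℂ E]

/-- Only analyticity on the circle is needed, not on the disc. The average is therefore available
when the singularities of f lie inside the circle, and it will be the extension of f. -/
theorem differentiableAt_circleAverage_comp_line {f : E → ℂ} {v z₀ : E} {s : ℝ} (hs : 0 ≤ s)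
    (hf : ∀ ζ : ℂ, ‖ζ‖ = s → AnalyticAt ℂ f (z₀ + ζ • v)) :
    DifferentiableAt ℂ (fun z => Real.circleAverage (fun ζ => f (z + ζ • v)) 0 s) z₀ := by
  have : ProperSpace E := FiniteDimensional.proper ℂ E
  set A := {w : E | AnalyticAt ℂ f w} with hAdef
  have hA : IsOpen A := isOpen_analyticAt ℂ f
  have hcomp : IsCompact ((fun ζ : ℂ => z₀ + ζ • v) '' sphere 0 s) :=
    (isCompact_sphere 0 s).image (by fun_prop)
  -- Compactness of the circle gives uniform room δ, half of it for moving z and half of it for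
  -- Cauchy's estimate.
  obtain ⟨δ, hδ, hδA⟩ := hcomp.exists_cthickening_subset_open hA (by
    rintro _ ⟨ζ, hζ, rfl⟩
    exact hf ζ (by simpa using hζ))
  have hfc : ContinuousOn f (cthickening δ ((fun ζ : ℂ => z₀ + ζ • v) '' sphere 0 s)) :=
    fun w hw => (show AnalyticAt ℂ f w from hδA hw).continuousAt.continuousWithinAt
  obtain ⟨C, hC⟩ := (hcomp.cthickening (r := δ)).exists_bound_of_continuousOn hfc
  have hcm : ∀ θ, ‖circleMap 0 s θ‖ = s := fun θ => by simp [abs_of_nonneg hs]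
  have hmem : ∀ θ, ∀ w, dist w (z₀ + circleMap 0 s θ • v) ≤ δ →
      w ∈ cthickening δ ((fun ζ : ℂ => z₀ + ζ • v) '' sphere 0 s) := by
    intro θ w hw
    exact mem_cthickening_of_dist_le _ (z₀ + circleMap 0 s θ • v) _ _
      ⟨circleMap 0 s θ, by simpa using hcm θ, rfl⟩ hw
  have hdist : ∀ z θ, dist (z + circleMap 0 s θ • v) (z₀ + circleMap 0 s θ • v) = dist z z₀ :=
    fun z θ => dist_add_right _ _ _
  have han : ∀ z ∈ ball z₀ (δ / 2), ∀ θ, AnalyticAt ℂ f (z + circleMap 0 s θ • v) := by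
    intro z hz θ
    refine hδA (hmem θ _ ?_)
    rw [hdist]
    rw [mem_ball] at hz
    linarith
  unfold Real.circleAverage
  refine DifferentiableAt.const_smul ?_ _
  have hz₀' : z₀ ∈ ball z₀ (δ / 2) := mem_ball_self (by positivity)
  have hcont : ∀ z ∈ ball z₀ (δ / 2), Continuous fun θ : ℝ => f (z + circleMap 0 s θ • v) := by
    intro z hz
    rw [continuous_iff_continuousAt]
    intro θ
    exact ContinuousAt.comp (f := fun θ : ℝ => z + circleMap 0 s θ • v)
      (han z hz θ).continuousAt (by fun_prop)
  refine (intervalIntegral.hasFDerivAt_integral_of_dominated_of_fderiv_le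
    (F' := fun z θ => fderiv ℂ f (z + circleMap 0 s θ • v)) (bound := fun _ => C / (δ / 2))
    (ball_mem_nhds z₀ (show 0 < δ / 2 by positivity)) ?_ ?_ ?_ ?_ ?_ ?_).differentiableAt
  · filter_upwards [ball_mem_nhds z₀ (show 0 < δ / 2 by positivity)] with z hz
    exact (hcont z hz).aestronglyMeasurable
  · exact (hcont z₀ hz₀').intervalIntegrable _ _
  · refine Continuous.aestronglyMeasurable ?_
    rw [continuous_iff_continuousAt]
    intro θ
    exact ContinuousAt.comp (f := fun θ : ℝ => z₀ + circleMap 0 s θ • v)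
      (han z₀ hz₀' θ).fderiv.continuousAt (by fun_prop)
  · refine Eventually.of_forall fun θ _ z hz => ?_
    have hb : ∀ w ∈ closedBall (z + circleMap 0 s θ • v) (δ / 2),
        w ∈ cthickening δ ((fun ζ : ℂ => z₀ + ζ • v) '' sphere 0 s) := by
      intro w hw
      refine hmem θ w ?_
      have := dist_triangle w (z + circleMap 0 s θ • v) (z₀ + circleMap 0 s θ • v)
      rw [hdist] at this
      rw [mem_closedBall] at hw
      rw [mem_ball] at hz
      linarith
    exact norm_fderiv_le_of_bound (by positivity)
      (fun w hw => (show AnalyticAt ℂ f w from hδA (hb w hw)).differentiableAt)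
      fun w hw => hC w (hb w hw)
  · exact intervalIntegrable_const
  · refine Eventually.of_forall fun θ _ z hz => ?_
    have := (han z hz θ).differentiableAt.hasFDerivAt.comp z
      ((hasFDerivAt_id z).add_const (circleMap 0 s θ • v))
    simpa using! this

/-- Averages over circles of an analytic function depend analytically on the centre. -/
theorem analyticAt_circleAverage_comp_line {f : E → ℂ} {v z₀ : E} {s : ℝ} (hs : 0 ≤ s)
    (hf : ∀ ζ : ℂ, ‖ζ‖ = s → AnalyticAt ℂ f (z₀ + ζ • v)) :
    AnalyticAt ℂ (fun z => Real.circleAverage (fun ζ => f (z + ζ • v)) 0 s) z₀ :=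
  DifferentiableOn.analyticAt_of_finiteDimensional
    (U := {z : E | ∀ ζ : ℂ, ‖ζ‖ = s → z + ζ • v ∈ {w | AnalyticAt ℂ f w}})
    (fun _ hz => (differentiableAt_circleAverage_comp_line hs hz).differentiableWithinAt)
    ((isOpen_setOf_forall_sphere (isOpen_analyticAt ℂ f) v s).mem_nhds hf)

omit [FiniteDimensional ℂ E] in
theorem AnalyticAt.comp_line {f : E → ℂ} {a v : E} {ζ : ℂ} (hf : AnalyticAt ℂ f (a + ζ • v)) :
    AnalyticAt ℂ (fun η : ℂ => f (a + η • v)) ζ :=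
  AnalyticAt.comp (g := f) (f := fun η : ℂ => a + η • v) hf
    (analyticAt_const.add (analyticAt_id.smul analyticAt_const))

theorem AnalyticOnNhd.discreteTopology_zeros {g : ℂ → ℂ} {C : Set ℂ} (hg : AnalyticOnNhd ℂ g C)
    (hC : IsPreconnected C) {a : ℂ} (ha : a ∈ C) (hga : g a ≠ 0) :
    DiscreteTopology {ζ | ζ ∈ C ∧ g ζ = 0} := by
  rw [discreteTopology_subtype_iff]
  intro ζ hζ
  rcases (hg ζ hζ.1).eventually_eq_zero_or_eventually_ne_zero with h | h
  · exact absurd (hg.eqOn_zero_of_preconnected_of_eventuallyEq_zero hC hζ.1 h ha) hga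
  · rw [← disjoint_iff, disjoint_principal_right]
    filter_upwards [h] with w hw hw'
    exact hw hw'.2

omit [FiniteDimensional ℂ E] in
/-- The complement of the zero set of an analytic function on a convex open set is connected. -/
theorem AnalyticOnNhd.isPreconnected_ne_zero {Δ : E → ℂ} {Ω : Set E} (hΔ : AnalyticOnNhd ℂ Δ Ω)
    (hΩ : IsOpen Ω) (hconv : Convex ℝ Ω) : IsPreconnected {z ∈ Ω | Δ z ≠ 0} := by
  refine isPreconnected_of_forall_pair fun a ha b hb => ?_
  let C : Set ℂ := {ζ | a + ζ • (b - a) ∈ Ω}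
  have hCo : IsOpen C := hΩ.preimage (by fun_prop)
  have hCc : Convex ℝ C := by
    intro x hx y hy s t hs ht hst
    have := hconv hx hy hs ht hst
    change a + ((s : ℂ) * x + (t : ℂ) * y) • (b - a) ∈ Ω
    convert this using 1
    simp only [← Complex.coe_smul]
    obtain rfl : s = 1 - t := by linarith
    push_cast
    module
  have h0 : (0 : ℂ) ∈ C := by simpa [C] using ha.1
  have h1 : (1 : ℂ) ∈ C := by simpa [C] using hb.1
  let g : ℂ → ℂ := fun ζ => Δ (a + ζ • (b - a))
  have hg : AnalyticOnNhd ℂ g C := fun ζ hζ => (hΔ _ hζ).comp_line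
  have hZ : {ζ ∈ C | g ζ = 0}.Countable := (HereditarilyLindelofSpace.isLindelof _).countable
    (hg.discreteTopology_zeros hCc.isPreconnected h0 (by simpa [g] using ha.2))
  -- Parabolic arcs from 0 to 1, disjoint for different ε except at their ends: ε is recovered from
  -- an inner point as im / (re (1 - re)). The zeros of Δ on the line are countable, so an
  -- uncountable interval of ε contains an arc that avoids them.
  let γ : ℝ → ℝ → ℂ := fun ε t => t + (ε * (t * (1 - t)) : ℝ) * Complex.I
  have hsmall : ∀ᶠ ε in 𝓝 (0 : ℝ), ∀ t ∈ Icc (0 : ℝ) 1, γ ε t ∈ C := by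
    apply isCompact_Icc.eventually_forall_of_forall_eventually
    intro t ht
    have hc : ContinuousAt (fun p : ℝ × ℝ => γ p.1 p.2) (0, t) := by
      simp only [γ]; fun_prop
    refine hc.eventually (hCo.mem_nhds ?_)
    have := hCc h0 h1 (sub_nonneg.2 ht.2) ht.1 (by ring)
    simpa [γ] using this
  obtain ⟨ε₀, hε₀, hε₀C⟩ := Metric.eventually_nhds_iff.1 hsmall
  have hbad : ((fun ζ : ℂ => ζ.im / (ζ.re * (1 - ζ.re))) '' {ζ ∈ C | g ζ = 0}).Countable :=
    hZ.image _
  have hunc : ¬ (Ioo 0 ε₀ : Set ℝ).Countable := by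
    intro h
    have h2 := Cardinal.mk_Ioo_real hε₀
    have h3 := (Cardinal.le_aleph0_iff_set_countable).2 h
    rw [h2] at h3
    exact absurd h3 (not_le.2 Cardinal.aleph0_lt_continuum)
  obtain ⟨ε, hε, hεbad⟩ : ∃ ε ∈ Ioo 0 ε₀,
      ε ∉ (fun ζ : ℂ => ζ.im / (ζ.re * (1 - ζ.re))) '' {ζ ∈ C | g ζ = 0} := by
    by_contra! hcon
    exact hunc (hbad.mono hcon)
  have hγC : ∀ t ∈ Icc (0 : ℝ) 1, γ ε t ∈ C := hε₀C (by
    rw [dist_zero_right, Real.norm_of_nonneg hε.1.le]; exact hε.2)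
  have hγne : ∀ t ∈ Icc (0 : ℝ) 1, g (γ ε t) ≠ 0 := by
    intro t ht h
    rcases eq_or_lt_of_le ht.1 with rfl | h0t
    · exact ha.2 (by simpa [g, γ] using h)
    rcases eq_or_lt_of_le ht.2 with rfl | ht1
    · exact hb.2 (by simpa [g, γ] using h)
    refine hεbad ⟨γ ε t, ⟨hγC t ht, h⟩, ?_⟩
    have : t * (1 - t) ≠ 0 := mul_ne_zero h0t.ne' (by linarith)
    have hre : (γ ε t).re = t := by simp [γ]
    have him : (γ ε t).im = ε * (t * (1 - t)) := by simp [γ]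
    simp only [hre, him]
    field_simp
  refine ⟨(fun t : ℝ => a + γ ε t • (b - a)) '' Icc 0 1, ?_, ⟨0, by simp, by simp [γ]⟩,
    ⟨1, by simp, by simp [γ]⟩, ?_⟩
  · rintro _ ⟨t, ht, rfl⟩
    exact ⟨hγC t ht, hγne t ht⟩
  · refine isPreconnected_Icc.image _ (Continuous.continuousOn ?_)
    simp only [γ]
    fun_prop

omit [FiniteDimensional ℂ E] in
/-- Zeros of an analytic function along a line persist under small translations. -/
theorem eventually_exists_zero_comp_line {Δ : E → ℂ} {z₀ v : E} {ζ₀ : ℂ} {r : ℝ} (hr : 0 < r)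
    (hΔ : ∀ ζ ∈ closedBall ζ₀ r, AnalyticAt ℂ Δ (z₀ + ζ • v))
    (h0 : Δ (z₀ + ζ₀ • v) = 0) (hne : ∀ ζ ∈ sphere ζ₀ r, Δ (z₀ + ζ • v) ≠ 0) :
    ∀ᶠ z in 𝓝 z₀, ∃ ζ ∈ closedBall ζ₀ r, Δ (z + ζ • v) = 0 := by
  have hcs : IsCompact (sphere ζ₀ r) := isCompact_sphere _ _
  have hc : ContinuousOn (fun ζ : ℂ => ‖Δ (z₀ + ζ • v)‖) (sphere ζ₀ r) := fun ζ hζ =>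
    (hΔ ζ (sphere_subset_closedBall hζ)).comp_line.continuousAt.norm.continuousWithinAt
  obtain ⟨ζ₁, hζ₁, hmin⟩ := hcs.exists_isMinOn (NormedSpace.sphere_nonempty.2 hr.le) hc
  set c := ‖Δ (z₀ + ζ₁ • v)‖ with hcdef
  have hcpos : 0 < c := norm_pos_iff.2 (hne ζ₁ hζ₁)
  have hcont : ∀ ζ ∈ closedBall ζ₀ r, ContinuousAt (fun p : E × ℂ => Δ (p.1 + p.2 • v)) (z₀, ζ) := by
    intro ζ hζ
    exact ContinuousAt.comp (f := fun p : E × ℂ => p.1 + p.2 • v) (hΔ ζ hζ).continuousAt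
      (by fun_prop)
  have e1 : ∀ᶠ z in 𝓝 z₀, ∀ ζ ∈ sphere ζ₀ r, c / 2 < ‖Δ (z + ζ • v)‖ := by
    apply hcs.eventually_forall_of_forall_eventually
    intro ζ hζ
    refine (hcont ζ (sphere_subset_closedBall hζ)).norm.eventually (lt_mem_nhds ?_)
    have : c ≤ ‖Δ (z₀ + ζ • v)‖ := hmin hζ
    change c / 2 < ‖Δ (z₀ + ζ • v)‖
    linarith
  have e2 : ∀ᶠ z in 𝓝 z₀, ‖Δ (z + ζ₀ • v)‖ < c / 2 := by
    have : ContinuousAt (fun z => ‖Δ (z + ζ₀ • v)‖) z₀ :=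
      (ContinuousAt.comp (f := fun z => z + ζ₀ • v)
        (hΔ ζ₀ (mem_closedBall_self hr.le)).continuousAt (by fun_prop)).norm
    refine this.eventually (gt_mem_nhds ?_)
    simp only [h0, norm_zero]
    positivity
  have e3 : ∀ᶠ z in 𝓝 z₀, ∀ ζ ∈ closedBall ζ₀ r, AnalyticAt ℂ Δ (z + ζ • v) := by
    apply (isCompact_closedBall ζ₀ r).eventually_forall_of_forall_eventually
    intro ζ hζ
    have : ContinuousAt (fun p : E × ℂ => p.1 + p.2 • v) (z₀, ζ) := by fun_prop
    exact this.eventually ((isOpen_analyticAt ℂ Δ).mem_nhds (hΔ ζ hζ))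
  filter_upwards [e1, e2, e3] with z h1 h2 h3
  by_contra! hcon
  -- If Δ had no zero on the disc, the maximum principle for 1/Δ would give |Δ| ≥ c/2 at the centre,
  -- against the bound `h2`.
  have hd : DiffContOnCl ℂ (fun ζ => (Δ (z + ζ • v))⁻¹) (ball ζ₀ r) :=
    DifferentiableOn.diffContOnCl fun ζ hζ =>
      ((h3 ζ (closure_ball_subset_closedBall hζ)).comp_line.differentiableAt.inv
        (hcon ζ (closure_ball_subset_closedBall hζ))).differentiableWithinAt
  have := Complex.norm_le_of_forall_mem_frontier_norm_le isBounded_ball hd (C := (c / 2)⁻¹)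
    (fun ζ hζ => by
      rw [frontier_ball _ hr.ne'] at hζ
      rw [norm_inv]
      exact inv_anti₀ (by positivity) (h1 ζ hζ).le)
    (subset_closure (mem_ball_self hr))
  rw [norm_inv] at this
  have hpos : 0 < ‖Δ (z + ζ₀ • v)‖ := norm_pos_iff.2 (hcon ζ₀ (mem_closedBall_self hr.le))
  have := (inv_le_inv₀ hpos (by positivity)).1 this
  linarith

/-- The function `f`, given where `Δ ≠ 0`, extends analytically to a neighbourhood of `z`. -/
def ExtendsAt (Δ f : E → ℂ) (z : E) : Prop :=
  ∃ F : E → ℂ, AnalyticAt ℂ F z ∧ ∀ᶠ w in 𝓝 z, Δ w ≠ 0 → F w = f w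

omit [FiniteDimensional ℂ E] in
theorem isOpen_extendsAt (Δ f : E → ℂ) : IsOpen {z | ExtendsAt Δ f z} := by
  rw [isOpen_iff_mem_nhds]
  rintro z ⟨F, hF, hFf⟩
  filter_upwards [hF.eventually_analyticAt, hFf.eventually_nhds] with w h1 h2 using ⟨F, h1, h2⟩

omit [FiniteDimensional ℂ E] in
theorem ExtendsAt.analyticAt {Δ f : E → ℂ} {z : E} (h : ExtendsAt Δ f z) (hΔ : ContinuousAt Δ z)
    (hz : Δ z ≠ 0) : AnalyticAt ℂ f z := by
  obtain ⟨F, hF, hFf⟩ := h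
  refine hF.congr ?_
  filter_upwards [hFf, hΔ.eventually_ne hz] with w h1 h2 using h1 h2

omit [FiniteDimensional ℂ E] in
/-- Local extensions of `f` glue. -/
theorem exists_glued_extension {Δ f : E → ℂ} {Ω : Set E} (hΩ : IsOpen Ω)
    (hdense : ∀ z ∈ Ω, ∃ᶠ w in 𝓝 z, Δ w ≠ 0) :
    ∃ F : E → ℂ, ∀ z ∈ Ω, ExtendsAt Δ f z → AnalyticAt ℂ F z ∧ (Δ z ≠ 0 → F z = f z) := by
  classical
  refine ⟨fun z => if h : ExtendsAt Δ f z then h.choose z else 0, fun z hz h => ?_⟩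
  obtain ⟨h1, h2⟩ := h.choose_spec
  refine ⟨h1.congr ?_, fun hz0 => ?_⟩
  · filter_upwards [(isOpen_extendsAt Δ f).mem_nhds h, h1.eventually_analyticAt,
      h2.eventually_nhds, hΩ.mem_nhds hz] with w hw ha hb hwΩ
    have hw' : ExtendsAt Δ f w := hw
    simp only [hw', dif_pos]
    -- The extensions chosen at z and at w agree where Δ ≠ 0; by density of that set and continuity
    -- they agree at w.
    obtain ⟨h3, h4⟩ := hw'.choose_spec
    by_contra hne
    have hev : ∀ᶠ x in 𝓝 w, h.choose x ≠ hw'.choose x :=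
      by
      filter_upwards [(ha.continuousAt.sub h3.continuousAt).eventually_ne (sub_ne_zero.2 hne)] with
        x hx using sub_ne_zero.1 hx
    obtain ⟨x, hx0, hx1, hx2, hx3⟩ := ((hdense w hwΩ).and_eventually (hev.and (hb.and h4))).exists
    exact hx1 ((hx2 hx0).trans (hx3 hx0).symm)
  · simp only [h, dif_pos]
    exact h2.self_of_nhds hz0

/-- A holomorphic function on the complement of a hypersurface that extends over a dense part of
the hypersurface extends over the whole hypersurface. -/
theorem extendsAt_of_subset_closure {Δ f : E → ℂ} {Ω : Set E} (hΩ : IsOpen Ω)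
    (hΔ : AnalyticOnNhd ℂ Δ Ω) (hdense : ∀ z ∈ Ω, ∃ᶠ w in 𝓝 z, Δ w ≠ 0)
    (hf : ∀ z ∈ Ω, Δ z ≠ 0 → ExtendsAt Δ f z)
    (hgood : ∀ z ∈ Ω, Δ z = 0 → z ∈ closure {w | Δ w = 0 ∧ ExtendsAt Δ f w}) {z₀ : E}
    (hz₀ : z₀ ∈ Ω) : ExtendsAt Δ f z₀ := by
  by_cases hΔ0 : Δ z₀ ≠ 0
  · exact hf z₀ hz₀ hΔ0
  have : ProperSpace E := FiniteDimensional.proper ℂ E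
  have : CompleteSpace E := FiniteDimensional.complete ℂ E
  push Not at hΔ0
  obtain ⟨r₀, hr₀, hrΩ⟩ := Metric.mem_nhds_iff.1 (hΩ.mem_nhds hz₀)
  -- The direction v points to a nearby z₁ with Δ z₁ ≠ 0, so Δ does not vanish identically on the
  -- line z₀ + ℂv and its zeros there are isolated.
  obtain ⟨z₁, hz₁, hz₁r⟩ := ((hdense z₀ hz₀).and_eventually (ball_mem_nhds z₀ hr₀)).exists
  set v := z₁ - z₀ with hv
  -- a radius `s` for which the circle of radius `s` in direction `v` avoids the zeros of `Δ`
  have hg0 : AnalyticAt ℂ (fun ζ : ℂ => Δ (z₀ + ζ • v)) 0 :=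
    AnalyticAt.comp_line (by simpa using hΔ z₀ hz₀)
  have hne0 : ∀ᶠ ζ in 𝓝[≠] (0 : ℂ), Δ (z₀ + ζ • v) ≠ 0 := by
    refine hg0.eventually_eq_zero_or_eventually_ne_zero.resolve_left fun h => hz₁ ?_
    have han : AnalyticOnNhd ℂ (fun ζ : ℂ => Δ (z₀ + ζ • v)) (closedBall 0 1) := by
      intro ζ hζ
      refine (hΔ _ (hrΩ ?_)).comp_line
      rw [mem_ball, dist_self_add_left, norm_smul]
      have h1 : ‖ζ‖ ≤ 1 := by simpa using hζ
      have h2 : ‖v‖ < r₀ := by rwa [hv, ← dist_eq_norm]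
      nlinarith [norm_nonneg v]
    have := han.eqOn_zero_of_preconnected_of_eventuallyEq_zero isPreconnected_closedBall
      (by simp) h (x := 1) (by simp)
    simpa [hv] using this
  have hmemΩ : ∀ᶠ ζ in 𝓝 (0 : ℂ), z₀ + ζ • v ∈ Ω := by
    have : ContinuousAt (fun ζ : ℂ => z₀ + ζ • v) 0 := by fun_prop
    exact this.eventually (hΩ.mem_nhds (by simpa using hz₀))
  obtain ⟨s', hs', hs'h⟩ := Metric.eventually_nhds_iff.1 ((eventually_nhdsWithin_iff.1 hne0).and hmemΩ)
  obtain ⟨s, hs, hss'⟩ : ∃ s, 0 < s ∧ s < s' := ⟨s' / 2, by positivity, by linarith⟩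
  -- the ball `B`
  have hB1 : ∀ᶠ z in 𝓝 z₀, ∀ ζ ∈ closedBall (0 : ℂ) s, z + ζ • v ∈ Ω := by
    apply (isCompact_closedBall (0 : ℂ) s).eventually_forall_of_forall_eventually
    intro ζ hζ
    have : ContinuousAt (fun p : E × ℂ => p.1 + p.2 • v) (z₀, ζ) := by fun_prop
    exact this.eventually (hΩ.mem_nhds (hs'h ((mem_closedBall.1 hζ).trans_lt hss')).2)
  have hB2 : ∀ᶠ z in 𝓝 z₀, ∀ ζ ∈ sphere (0 : ℂ) s, Δ (z + ζ • v) ≠ 0 := by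
    apply (isCompact_sphere (0 : ℂ) s).eventually_forall_of_forall_eventually
    intro ζ hζ
    have h2 := hs'h ((mem_sphere.1 hζ).trans_lt hss')
    have : ContinuousAt (fun p : E × ℂ => Δ (p.1 + p.2 • v)) (z₀, ζ) :=
      ContinuousAt.comp (f := fun p : E × ℂ => p.1 + p.2 • v) (hΔ _ h2.2).continuousAt
        (by fun_prop)
    exact this.eventually_ne (h2.1 (ne_of_mem_sphere hζ hs.ne'))
  obtain ⟨ρ, hρ, hB⟩ := Metric.mem_nhds_iff.1 (hB1.and hB2)
  set B := ball z₀ ρ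
  have hBΩ : B ⊆ Ω := fun z hz => by simpa using (hB hz).1 0 (by simpa using hs.le)
  set G := {z | ExtendsAt Δ f z}
  have hG : IsOpen G := isOpen_extendsAt Δ f
  -- along each line the zeros are isolated
  have hiso : ∀ z ∈ B, DiscreteTopology {ζ | ζ ∈ closedBall (0 : ℂ) s ∧ Δ (z + ζ • v) = 0} := by
    intro z hz
    have han : AnalyticOnNhd ℂ (fun ζ : ℂ => Δ (z + ζ • v)) (closedBall 0 s) := fun ζ hζ =>
      (hΔ _ ((hB hz).1 ζ hζ)).comp_line
    exact han.discreteTopology_zeros isPreconnected_closedBall (a := (s : ℂ))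
      (by simp [abs_of_pos hs]) ((hB hz).2 s (by simp [abs_of_pos hs]))
  -- It suffices to find an open set W of points z whose whole discs z + ζv consist of points where
  -- f extends: for these z the mean value property identifies the circle average of f with f, and
  -- the identity theorem on the connected set {Δ ≠ 0} of B carries this over to B. Suppose that
  -- there is no such W. Then every open subset of B contains points whose disc meets a bad zero of
  -- Δ. As good zeros are dense among the zeros and persist under small translations, a good zero
  -- can be added to those already found. So for every k the points with k distinct good zeros in
  -- their disc form an open dense subset U k of B. By Baire's theorem some disc contains infinitely
  -- many zeros, which contradicts their being isolated on a compact disc.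
  have key : ∃ W : Set E, IsOpen W ∧ W.Nonempty ∧ W ⊆ B ∧
      ∀ z ∈ W, ∀ ζ ∈ closedBall (0 : ℂ) s, z + ζ • v ∈ G := by
    by_contra! hcon
    -- persistence of good zeros
    have hpers : ∀ z ∈ B, ∀ ζ₀ : ℂ, ‖ζ₀‖ < s → Δ (z + ζ₀ • v) = 0 → z + ζ₀ • v ∈ G → ∀ ε > 0,
        ∀ᶠ z' in 𝓝 z, ∃ ζ, dist ζ ζ₀ < ε ∧ ‖ζ‖ < s ∧ Δ (z' + ζ • v) = 0 ∧ z' + ζ • v ∈ G := by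
      intro z hz ζ₀ hζ₀ hζ₀0 hζ₀G ε hε
      have h1 : ∀ᶠ ζ in 𝓝 ζ₀, z + ζ • v ∈ G ∧ ‖ζ‖ < s := by
        have c1 : ContinuousAt (fun ζ : ℂ => z + ζ • v) ζ₀ := by fun_prop
        exact (c1.eventually (hG.mem_nhds hζ₀G)).and
          (continuous_norm.continuousAt.eventually (gt_mem_nhds hζ₀))
      have h2 : ∀ᶠ ζ in 𝓝 ζ₀, ζ ≠ ζ₀ → Δ (z + ζ • v) ≠ 0 := by
        have hd := (hiso z hz)
        rw [discreteTopology_subtype_iff] at hd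
        have := hd ζ₀ ⟨by simpa using hζ₀.le, hζ₀0⟩
        rw [← disjoint_iff, disjoint_principal_right] at this
        filter_upwards [eventually_nhdsWithin_iff.1 this, h1] with ζ a1 a2 a3 a4
        exact a1 a3 ⟨by simpa using a2.2.le, a4⟩
      obtain ⟨r, hr, hrh⟩ := Metric.eventually_nhds_iff.1 (h1.and h2)
      obtain ⟨r', hr', hr'r, hr'ε⟩ : ∃ r', 0 < r' ∧ r' < r ∧ r' < ε :=
        ⟨min r ε / 2, by positivity, by
          have := min_le_left r ε; have : 0 < min r ε := by positivity
          linarith, by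
          have := min_le_right r ε; have : 0 < min r ε := by positivity
          linarith⟩
      have e1 := eventually_exists_zero_comp_line (Δ := Δ) (z₀ := z) (v := v) (ζ₀ := ζ₀) hr'
        (fun ζ hζ => hΔ _ ((hB hz).1 ζ (by
          simpa using (hrh ((mem_closedBall.1 hζ).trans_lt hr'r)).1.2.le))) hζ₀0
        (fun ζ hζ => (hrh ((mem_sphere.1 hζ).trans_lt hr'r)).2 (ne_of_mem_sphere hζ hr'.ne'))
      have e2 : ∀ᶠ z' in 𝓝 z, ∀ ζ ∈ closedBall ζ₀ r', z' + ζ • v ∈ G := by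
        apply (isCompact_closedBall ζ₀ r').eventually_forall_of_forall_eventually
        intro ζ hζ
        have : ContinuousAt (fun p : E × ℂ => p.1 + p.2 • v) (z, ζ) := by fun_prop
        exact this.eventually (hG.mem_nhds (hrh ((mem_closedBall.1 hζ).trans_lt hr'r)).1.1)
      filter_upwards [e1, e2] with z' ⟨ζ, hζ, hζ0⟩ a2
      exact ⟨ζ, (mem_closedBall.1 hζ).trans_lt hr'ε,
        (hrh ((mem_closedBall.1 hζ).trans_lt hr'r)).1.2, hζ0, a2 ζ hζ⟩
    let U : ℕ → Set E := fun k => {z | z ∈ B ∧ ∃ T : Finset ℂ, T.card = k ∧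
      ∀ ζ ∈ T, ‖ζ‖ < s ∧ Δ (z + ζ • v) = 0 ∧ z + ζ • v ∈ G}
    have hpersT : ∀ z ∈ B, ∀ T : Finset ℂ,
        (∀ ζ ∈ T, ‖ζ‖ < s ∧ Δ (z + ζ • v) = 0 ∧ z + ζ • v ∈ G) → ∀ ε > 0,
        ∀ᶠ z' in 𝓝 z, ∀ ζ₀ ∈ T, ∃ ζ, dist ζ ζ₀ < ε ∧ ‖ζ‖ < s ∧ Δ (z' + ζ • v) = 0 ∧
          z' + ζ • v ∈ G := by
      intro z hz T hT ε hε
      rw [Filter.eventually_all_finset]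
      exact fun ζ₀ h => hpers z hz ζ₀ (hT ζ₀ h).1 (hT ζ₀ h).2.1 (hT ζ₀ h).2.2 ε hε
    -- A separation 2ε of the zeros keeps them distinct when each of them moves by less than ε.
    have hsep : ∀ T : Finset ℂ, ∃ ε > 0, ∀ x ∈ T, ∀ y ∈ T, x ≠ y → 2 * ε ≤ dist x y := by
      intro T
      have : ∀ᶠ ε in 𝓝[>] (0 : ℝ), ∀ x ∈ T, ∀ y ∈ T, x ≠ y → 2 * ε ≤ dist x y := by
        rw [Filter.eventually_all_finset]
        intro x _
        rw [Filter.eventually_all_finset]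
        intro y _
        by_cases hxy : x = y
        · exact Eventually.of_forall fun _ h => absurd hxy h
        · have : Tendsto (fun ε : ℝ => 2 * ε) (𝓝[>] 0) (𝓝 0) :=
            tendsto_nhdsWithin_of_tendsto_nhds (by
              have : ContinuousAt (fun ε : ℝ => 2 * ε) 0 := by fun_prop
              simpa [ContinuousAt] using this)
          filter_upwards [this.eventually (gt_mem_nhds (dist_pos.2 hxy))] with ε h _ using h.le
      obtain ⟨ε, h1, h2⟩ := (this.and self_mem_nhdsWithin).exists
      exact ⟨ε, h2, h1⟩
    have hinj : ∀ (T : Finset ℂ) (τ : ℂ → ℂ) (ε : ℝ),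
        (∀ x ∈ T, ∀ y ∈ T, x ≠ y → 2 * ε ≤ dist x y) → (∀ x ∈ T, dist (τ x) x < ε) →
        ∀ x ∈ T, ∀ y ∈ T, τ x = τ y → x = y := by
      intro T τ ε h1 h2 x hx y hy hxy
      by_contra hne
      have a1 := h1 x hx y hy hne
      have a2 := h2 x hx
      have a3 := h2 y hy
      rw [← hxy] at a3
      have := dist_triangle_left x y (τ x)
      linarith
    have hUopen : ∀ k, IsOpen (U k) := by
      intro k
      rw [isOpen_iff_mem_nhds]
      rintro z ⟨hz, T, hTk, hT⟩
      obtain ⟨ε, hε, hεT⟩ := hsep T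
      filter_upwards [hpersT z hz T hT ε hε, isOpen_ball.mem_nhds hz] with z' h1 h2
      choose! τ hτ using h1
      refine ⟨h2, T.image τ, ?_, ?_⟩
      · rw [Finset.card_image_of_injOn fun x hx y hy hxy =>
          hinj T τ ε hεT (fun x hx => (hτ x hx).1) x hx y hy hxy, hTk]
      · simp only [Finset.mem_image]
        rintro _ ⟨ζ, hζ, rfl⟩
        exact (hτ ζ hζ).2
    have hUdense : ∀ k, ∀ O : Set E, IsOpen O → O.Nonempty → O ⊆ B → (O ∩ U k).Nonempty := by
      intro k
      induction k with
      | zero =>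
        rintro O hO ⟨z, hz⟩ hOB
        exact ⟨z, hz, hOB hz, ∅, rfl, by simp⟩
      | succ k ih =>
        intro O hO hOne hOB
        obtain ⟨z, ⟨hz, hzB, T, hTk, hT⟩, ζ₀, hζ₀, hζ₀G⟩ := hcon (O ∩ U k)
          (hO.inter (hUopen k)) (ih O hO hOne hOB) (fun z hz => hOB hz.1)
        have hζ₀0 : Δ (z + ζ₀ • v) = 0 := by
          by_contra h
          exact hζ₀G (hf _ ((hB hzB).1 ζ₀ hζ₀) h)
        have hζ₀s : ‖ζ₀‖ < s := by
          refine lt_of_le_of_ne (by simpa using hζ₀) fun h => (hB hzB).2 ζ₀ (by simpa using h) hζ₀0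
        have hζ₀T : ζ₀ ∉ T := fun h => hζ₀G (hT ζ₀ h).2.2
        obtain ⟨ε, hε, hεT⟩ := hsep (insert ζ₀ T)
        have hev := (hpersT z hzB T hT ε hε).and (hO.mem_nhds hz)
        have htend : Tendsto (fun w : E => w - ζ₀ • v) (𝓝 (z + ζ₀ • v)) (𝓝 z) := by
          have : ContinuousAt (fun w : E => w - ζ₀ • v) (z + ζ₀ • v) := by fun_prop
          simpa [ContinuousAt] using this
        obtain ⟨w, ⟨hw0, hwG⟩, hw1, hw2⟩ := ((mem_closure_iff_frequently.1
          (hgood _ ((hB hzB).1 ζ₀ hζ₀) hζ₀0)).and_eventually (htend.eventually hev)).exists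
        choose! τ hτ using hw1
        -- The bad zero z + ζ₀v is replaced by a good zero w close to it. Moving the base point to w
        -- - ζ₀v keeps the parameter ζ₀, while the old zeros move slightly by τ.
        let τ' : ℂ → ℂ := Function.update τ ζ₀ ζ₀
        have hτ'T : ∀ x ∈ T, τ' x = τ x := fun x hx => by
          have : x ≠ ζ₀ := fun h => hζ₀T (h ▸ hx)
          simp [τ', this]
        refine ⟨w - ζ₀ • v, hw2, hOB hw2, (insert ζ₀ T).image τ', ?_, ?_⟩
        · rw [Finset.card_image_of_injOn, Finset.card_insert_of_notMem hζ₀T, hTk]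
          refine fun x hx y hy hxy => hinj (insert ζ₀ T) τ' ε hεT ?_ x hx y hy hxy
          intro x hx
          rcases Finset.mem_insert.1 hx with rfl | hx
          · simpa [τ'] using hε
          · rw [hτ'T x hx]
            exact (hτ x hx).1
        · simp only [Finset.mem_image, Finset.mem_insert]
          rintro _ ⟨ζ, rfl | hζ, rfl⟩
          · simp only [τ', Function.update_self, sub_add_cancel]
            exact ⟨hζ₀s, hw0, hwG⟩
          · rw [hτ'T ζ hζ]
            exact (hτ ζ hζ).2
    -- Baire's theorem is applied in all of E, so the exterior of B is added to make the sets dense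
    -- there.
    have hD : ∀ k, Dense (U k ∪ (closure B)ᶜ) := by
      intro k
      rw [dense_iff_inter_open]
      rintro O hO ⟨z, hz⟩
      by_cases hzB : z ∈ closure B
      · have h1 : (O ∩ B).Nonempty := mem_closure_iff.1 hzB O hO hz
        obtain ⟨w, hw1, hw2⟩ := hUdense k (O ∩ B) (hO.inter isOpen_ball) h1 inter_subset_right
        exact ⟨w, hw1.1, Or.inl hw2⟩
      · exact ⟨z, hz, Or.inr hzB⟩
    have hbaire := dense_iInter_of_isOpen
      (fun k => (hUopen k).union isClosed_closure.isOpen_compl) hD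
    obtain ⟨z, hzB, hzU⟩ := dense_iff_inter_open.1 hbaire B isOpen_ball ⟨z₀, mem_ball_self hρ⟩
    have hfin : {ζ | ζ ∈ closedBall (0 : ℂ) s ∧ Δ (z + ζ • v) = 0}.Finite := by
      have hd := hiso z hzB
      refine IsCompact.finite ?_ ⟨hd⟩
      have hc : ContinuousOn (fun ζ : ℂ => Δ (z + ζ • v)) (closedBall 0 s) := fun ζ hζ =>
        (hΔ _ ((hB hzB).1 ζ hζ)).comp_line.continuousAt.continuousWithinAt
      exact (isCompact_closedBall (0 : ℂ) s).of_isClosed_subset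
        (hc.preimage_isClosed_of_isClosed isClosed_closedBall isClosed_singleton (t := {0}))
        (fun ζ hζ => hζ.1)
    have hzk := (mem_iInter.1 hzU (hfin.toFinset.card + 1)).resolve_right
      (fun h => h (subset_closure hzB))
    obtain ⟨-, T, hTk, hT⟩ := hzk
    have : T ⊆ hfin.toFinset := fun ζ hζ => by
      simpa using ⟨(hT ζ hζ).1.le, (hT ζ hζ).2.1⟩
    have := Finset.card_le_card this
    omega
  obtain ⟨W, hW, hWne, hWB, hWG⟩ := key
  obtain ⟨fe, hfe⟩ := exists_glued_extension (f := f) hΩ hdense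
  let F : E → ℂ := fun z => Real.circleAverage (fun ζ => f (z + ζ • v)) 0 s
  have hfan : ∀ z ∈ Ω, Δ z ≠ 0 → AnalyticAt ℂ f z := fun z hz h =>
    (hf z hz h).analyticAt (hΔ z hz).continuousAt h
  have hF : ∀ z ∈ B, AnalyticAt ℂ F z := fun z hz =>
    analyticAt_circleAverage_comp_line hs.le fun ζ hζ =>
      hfan _ ((hB hz).1 ζ (by simpa using hζ.le)) ((hB hz).2 ζ (by simpa using hζ))
  have hFW : ∀ z ∈ W, Δ z ≠ 0 → F z = f z := by
    intro z hz hz0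
    have h1 : F z = Real.circleAverage (fun ζ => fe (z + ζ • v)) 0 s := by
      refine Real.circleAverage_congr_sphere fun ζ hζ => ?_
      rw [abs_of_pos hs] at hζ
      have hc := sphere_subset_closedBall hζ
      exact ((hfe _ ((hB (hWB hz)).1 ζ hc) (hWG z hz ζ hc)).2 ((hB (hWB hz)).2 ζ hζ)).symm
    have h2 : Real.circleAverage (fun ζ => fe (z + ζ • v)) 0 s = fe (z + (0 : ℂ) • v) := by
      refine DiffContOnCl.circleAverage (DifferentiableOn.diffContOnCl fun ζ hζ => ?_)
      rw [abs_of_pos hs] at hζ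
      have hc := closure_ball_subset_closedBall hζ
      exact (hfe _ ((hB (hWB hz)).1 ζ hc)
        (hWG z hz ζ hc)).1.comp_line.differentiableAt.differentiableWithinAt
    have h0 : z ∈ G := by simpa using hWG z hz 0 (by simpa using hs.le)
    rw [h1, h2, zero_smul, add_zero]
    exact (hfe z (hBΩ (hWB hz)) h0).2 hz0
  have hpre := AnalyticOnNhd.isPreconnected_ne_zero (fun z hz => hΔ z (hBΩ hz)) isOpen_ball
    (convex_ball z₀ ρ)
  obtain ⟨a, haW⟩ := hWne
  obtain ⟨b, hb0, hbW⟩ := ((hdense a (hBΩ (hWB haW))).and_eventually (hW.mem_nhds haW)).exists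
  have hev : F =ᶠ[𝓝 b] f := by
    filter_upwards [hW.mem_nhds hbW,
      (hΔ b (hBΩ (hWB hbW))).continuousAt.eventually_ne hb0] with w h1 h2 using hFW w h1 h2
  have heq := AnalyticOnNhd.eqOn_of_preconnected_of_eventuallyEq
    (fun z hz => hF z hz.1) (fun z hz => hfan z (hBΩ hz.1) hz.2) hpre ⟨hWB hbW, hb0⟩ hev
  refine ⟨F, hF z₀ (mem_ball_self hρ), ?_⟩
  filter_upwards [ball_mem_nhds z₀ hρ] with z hz hz0 using heq ⟨hz, hz0⟩

end Hartogs

/-! ### Division by a linear form. -/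

section Division

open Metric Set Filter

variable {E : Type} [NormedAddCommGroup E] [NormedSpace ℂ E] [FiniteDimensional ℂ E]

/-- An analytic function that vanishes on a hyperplane is divisible by the linear equation of the
hyperplane. -/
theorem AnalyticAt.exists_eq_linear_mul {f : E → ℂ} {z₀ w : E} {ℓ : E →L[ℂ] ℂ}
    (hf : AnalyticAt ℂ f z₀) (hw : ℓ w = 1) (h0 : ℓ z₀ = 0)
    (hz : ∀ᶠ z in 𝓝 z₀, ℓ z = 0 → f z = 0) :
    ∃ v : E → ℂ, AnalyticAt ℂ v z₀ ∧ ∀ᶠ z in 𝓝 z₀, f z = ℓ z * v z := by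
  have hev : ∀ᶠ z in 𝓝 z₀, AnalyticAt ℂ f z ∧ (ℓ z = 0 → f z = 0) :=
    hf.eventually_analyticAt.and hz
  obtain ⟨ρ, hρ, hball⟩ := Metric.eventually_nhds_iff_ball.1 hev
  obtain ⟨s, hs, hsw⟩ : ∃ s : ℝ, 0 < s ∧ s * ‖w‖ < ρ / 2 := by
    refine ⟨ρ / 2 / (‖w‖ + 1), by positivity, ?_⟩
    rw [div_mul_eq_mul_div, div_lt_iff₀ (by positivity)]
    nlinarith [norm_nonneg w]
  have hline : ∀ z ∈ ball z₀ (ρ / 2), ∀ ζ : ℂ, ‖ζ‖ ≤ s → z + ζ • w ∈ ball z₀ ρ := by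
    intro z hz ζ hζ
    rw [mem_ball, dist_eq_norm] at *
    calc ‖z + ζ • w - z₀‖ = ‖(z - z₀) + ζ • w‖ := by congr 1; abel
      _ ≤ ‖z - z₀‖ + ‖ζ‖ * ‖w‖ := by rw [← norm_smul]; exact norm_add_le _ _
      _ ≤ ‖z - z₀‖ + s * ‖w‖ := by gcongr
      _ < ρ := by linarith
  have hquot : ∀ ζ : ℂ, ‖ζ‖ = s → AnalyticAt ℂ (fun y => f y / ℓ y) (z₀ + ζ • w) := by
    intro ζ hζ
    have h1 := (hball _ (hline z₀ (mem_ball_self (by positivity)) ζ hζ.le)).1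
    refine h1.div (ℓ.analyticAt _) ?_
    rw [map_add, map_smul, h0, hw, smul_eq_mul, mul_one, zero_add]
    rintro rfl
    rw [norm_zero] at hζ
    exact hs.ne hζ
  -- The quotient is the average of f / ℓ over circles in the transversal direction w, which avoid
  -- {ℓ = 0}. On each such line f / ℓ has a removable singularity, realized by `dslope`, so that the
  -- average is the value at the centre wherever ℓ z ≠ 0.
  refine ⟨_, analyticAt_circleAverage_comp_line hs.le hquot, ?_⟩
  have hsmall : ∀ᶠ z in 𝓝 z₀, ‖ℓ z‖ < s := by
    have : ContinuousAt (fun z => ‖ℓ z‖) z₀ := by fun_prop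
    exact this.eventually_lt_const (by simpa [h0] using hs)
  filter_upwards [hsmall, ball_mem_nhds z₀ (half_pos hρ)] with z hzs hzb
  by_cases hℓ : ℓ z = 0
  · rw [hℓ, zero_mul]
    exact (hball z (ball_subset_ball (by linarith) hzb)).2 hℓ
  set k : ℂ → ℂ := fun ζ => f (z + ζ • w) with hk
  have hkd : ∀ ζ : ℂ, ‖ζ‖ ≤ s → DifferentiableAt ℂ k ζ := fun ζ hζ =>
    ((hball _ (hline z hzb ζ hζ)).1.differentiableAt).comp ζ (by fun_prop)
  have hk0 : k (-ℓ z) = 0 := by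
    refine (hball _ (hline z hzb (-ℓ z) (by rw [norm_neg]; exact hzs.le))).2 ?_
    simp [hw]
  have hmem : ball (0 : ℂ) s ∈ 𝓝 (-ℓ z) := isOpen_ball.mem_nhds (by simpa using hzs)
  have hdsl : ∀ ζ : ℂ, ζ ≠ -ℓ z → dslope k (-ℓ z) ζ = f (z + ζ • w) / ℓ (z + ζ • w) := by
    intro ζ hζ
    rw [dslope_of_ne _ hζ, slope_def_field, hk0, sub_zero]
    simp only [hk, map_add, map_smul, hw, smul_eq_mul, mul_one]
    congr 1; ring
  have hd : DiffContOnCl ℂ (dslope k (-ℓ z)) (ball 0 s) := by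
    apply DifferentiableOn.diffContOnCl
    rw [closure_ball _ hs.ne']
    rw [Complex.differentiableOn_dslope (mem_of_superset hmem ball_subset_closedBall)]
    intro ζ hζ
    exact (hkd ζ (by simpa using hζ)).differentiableWithinAt
  have havg := DiffContOnCl.circleAverage (R := s) (c := 0) (by rwa [abs_of_pos hs])
  have : Real.circleAverage (fun ζ => f (z + ζ • w) / ℓ (z + ζ • w)) 0 s
      = Real.circleAverage (dslope k (-ℓ z)) 0 s := by
    apply Real.circleAverage_congr_sphere
    intro ζ hζ
    rw [abs_of_pos hs] at hζ
    refine (hdsl ζ ?_).symm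
    rintro rfl
    simp at hζ
    linarith
  rw [this, havg, hdsl 0 (by simpa [eq_comm] using hℓ)]
  simp only [zero_smul, add_zero]
  field_simp

end Division

/-! ### Holomorphic functions on M and their derivatives. -/

noncomputable section

section HolFunction

variable {m : ℕ} {M : Type*} [TopologicalSpace M] [ChartedSpace (Fin m → ℂ) M]
  {f g : M → ℂ} {p : M}

theorem HolFunctionAt.const (c : ℂ) (p : M) : HolFunctionAt (m := m) (fun _ => c) p :=
  contMDiffAt_const

theorem HolFunctionAt.congr (hf : HolFunctionAt (m := m) f p) (h : ∀ᶠ q in 𝓝 p, g q = f q) :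
    HolFunctionAt (m := m) g p :=
  ContMDiffAt.congr_of_eventuallyEq hf h

theorem HolFunctionAt.add (hf : HolFunctionAt (m := m) f p) (hg : HolFunctionAt (m := m) g p) :
    HolFunctionAt (m := m) (fun q => f q + g q) p :=
  ContMDiffAt.add hf hg

theorem HolFunctionAt.neg (hf : HolFunctionAt (m := m) f p) :
    HolFunctionAt (m := m) (fun q => -f q) p :=
  ContMDiffAt.neg hf

theorem HolFunctionAt.sub (hf : HolFunctionAt (m := m) f p) (hg : HolFunctionAt (m := m) g p) :
    HolFunctionAt (m := m) (fun q => f q - g q) p :=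
  ContMDiffAt.sub hf hg

theorem HolFunctionAt.comp_analyticAt {G : ℂ → ℂ} (hG : AnalyticAt ℂ G (f p))
    (hf : HolFunctionAt (m := m) f p) : HolFunctionAt (m := m) (fun q => G (f q)) p :=
  ContMDiffAt.comp p (g := G) (I' := 𝓘(ℂ, ℂ)) (contMDiffAt_iff_contDiffAt.2 hG.contDiffAt) hf

theorem HolFunctionAt.mul (hf : HolFunctionAt (m := m) f p) (hg : HolFunctionAt (m := m) g p) :
    HolFunctionAt (m := m) (fun q => f q * g q) p :=
  ContMDiffAt.smul hf hg

theorem HolFunctionAt.inv (hf : HolFunctionAt (m := m) f p) (h0 : f p ≠ 0) :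
    HolFunctionAt (m := m) (fun q => (f q)⁻¹) p :=
  HolFunctionAt.comp_analyticAt (G := fun z => z⁻¹) (analyticAt_id.inv h0) hf

theorem HolFunctionAt.div (hf : HolFunctionAt (m := m) f p) (hg : HolFunctionAt (m := m) g p)
    (h0 : g p ≠ 0) : HolFunctionAt (m := m) (fun q => f q / g q) p := by
  simpa only [div_eq_mul_inv] using hf.mul (hg.inv h0)

theorem HolFunctionAt.pow (hf : HolFunctionAt (m := m) f p) (k : ℕ) :
    HolFunctionAt (m := m) (fun q => f q ^ k) p :=
  HolFunctionAt.comp_analyticAt (G := fun z => z ^ k) (analyticAt_id.pow k) hf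

theorem HolFunctionAt.sum {ι : Type*} {s : Finset ι} {f : ι → M → ℂ}
    (hf : ∀ i ∈ s, HolFunctionAt (m := m) (f i) p) :
    HolFunctionAt (m := m) (fun q => ∑ i ∈ s, f i q) p := by
  classical
  induction s using Finset.induction_on with
  | empty => simpa using HolFunctionAt.const 0 p
  | insert a s ha ih =>
    simp only [Finset.sum_insert ha]
    exact (hf a (by simp)).add (ih fun i hi => hf i (by simp [hi]))

theorem HolFunctionAt.prod {ι : Type*} {s : Finset ι} {f : ι → M → ℂ}
    (hf : ∀ i ∈ s, HolFunctionAt (m := m) (f i) p) :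
    HolFunctionAt (m := m) (fun q => ∏ i ∈ s, f i q) p := by
  classical
  induction s using Finset.induction_on with
  | empty => simpa using HolFunctionAt.const 1 p
  | insert a s ha ih =>
    simp only [Finset.prod_insert ha]
    exact (hf a (by simp)).mul (ih fun i hi => hf i (by simp [hi]))

theorem HolFunctionAt.continuousAt (hf : HolFunctionAt (m := m) f p) : ContinuousAt f p :=
  ContMDiffAt.continuousAt hf

theorem HolFunctionAt.eventually_ne (hf : HolFunctionAt (m := m) f p) (h : f p ≠ 0) :
    ∀ᶠ q in 𝓝 p, f q ≠ 0 :=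
  hf.continuousAt.eventually_ne h

theorem HolFunctionAt.mdiff (hf : HolFunctionAt (m := m) f p) :
    MDifferentiableAt (CModel m) 𝓘(ℂ, ℂ) f p :=
  ContMDiffAt.mdifferentiableAt hf (by simp)

end HolFunction

section Derivation

variable {m : ℕ} {M : Type*} [TopologicalSpace M] [ChartedSpace (Fin m → ℂ) M]
  {f g : M → ℂ} {p : M} {v : TangentSpace (CModel m) p}

theorem mvfderiv_congr_eventually (h : ∀ᶠ q in 𝓝 p, f q = g q) :
    mvfderiv (CModel m) f p = mvfderiv (CModel m) g p := by
  have : mfderiv (CModel m) 𝓘(ℂ, ℂ) f p = mfderiv (CModel m) 𝓘(ℂ, ℂ) g p :=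
    Filter.EventuallyEq.mfderiv_eq h
  unfold mvfderiv
  rw [this, h.self_of_nhds]

theorem mvfderiv_const_apply (c : ℂ) : mvfderiv (CModel m) (fun _ : M => c) p v = 0 := by
  rw [mvfderiv_const]; rfl

theorem mvfderiv_add_apply (hf : HolFunctionAt (m := m) f p) (hg : HolFunctionAt (m := m) g p) :
    mvfderiv (CModel m) (fun q => f q + g q) p v
      = mvfderiv (CModel m) f p v + mvfderiv (CModel m) g p v := by
  rw [show (fun q => f q + g q) = f + g from rfl, mvfderiv_add hf.mdiff hg.mdiff]; rfl

theorem mvfderiv_sub_apply (hf : HolFunctionAt (m := m) f p) (hg : HolFunctionAt (m := m) g p) :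
    mvfderiv (CModel m) (fun q => f q - g q) p v
      = mvfderiv (CModel m) f p v - mvfderiv (CModel m) g p v := by
  rw [show (fun q => f q - g q) = f - g from rfl, mvfderiv_sub hf.mdiff hg.mdiff]; rfl

theorem mvfderiv_mul_apply (hf : HolFunctionAt (m := m) f p) (hg : HolFunctionAt (m := m) g p) :
    mvfderiv (CModel m) (fun q => f q * g q) p v
      = f p * mvfderiv (CModel m) g p v + g p * mvfderiv (CModel m) f p v := by
  rw [show (fun q => f q * g q) = f * g from rfl, mvfderiv_mul hf.mdiff hg.mdiff]; rfl

theorem mvfderiv_inv_apply (hf : HolFunctionAt (m := m) f p) (h0 : f p ≠ 0) :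
    mvfderiv (CModel m) (fun q => (f q)⁻¹) p v = - mvfderiv (CModel m) f p v / f p ^ 2 := by
  have h1 : mvfderiv (CModel m) (fun q => f q * (f q)⁻¹) p v = 0 := by
    rw [mvfderiv_congr_eventually (g := fun _ => 1), mvfderiv_const_apply]
    filter_upwards [hf.eventually_ne h0] with q hq using mul_inv_cancel₀ hq
  rw [mvfderiv_mul_apply hf (hf.inv h0)] at h1
  field_simp at h1 ⊢
  linear_combination h1

theorem mvfderiv_div_apply (hf : HolFunctionAt (m := m) f p) (hg : HolFunctionAt (m := m) g p)
    (h0 : g p ≠ 0) :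
    mvfderiv (CModel m) (fun q => f q / g q) p v
      = (g p * mvfderiv (CModel m) f p v - f p * mvfderiv (CModel m) g p v) / g p ^ 2 := by
  simp only [div_eq_mul_inv (f _)]
  rw [mvfderiv_mul_apply hf (hg.inv h0), mvfderiv_inv_apply hg h0]
  field_simp
  ring

theorem mvfderiv_const_mul_apply (c : ℂ) (hf : HolFunctionAt (m := m) f p) :
    mvfderiv (CModel m) (fun q => c * f q) p v = c * mvfderiv (CModel m) f p v := by
  rw [mvfderiv_mul_apply (HolFunctionAt.const c p) hf, mvfderiv_const_apply]; ring

theorem mvfderiv_sum_apply {ι : Type*} {s : Finset ι} {f : ι → M → ℂ}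
    (hf : ∀ i ∈ s, HolFunctionAt (m := m) (f i) p) :
    mvfderiv (CModel m) (fun q => ∑ i ∈ s, f i q) p v
      = ∑ i ∈ s, mvfderiv (CModel m) (f i) p v := by
  classical
  induction s using Finset.induction_on with
  | empty => simpa using mvfderiv_const_apply 0
  | insert a s ha ih =>
    simp only [Finset.sum_insert ha]
    rw [mvfderiv_add_apply (hf a (by simp))
      (HolFunctionAt.sum fun i hi => hf i (by simp [hi])), ih fun i hi => hf i (by simp [hi])]

theorem mvfderiv_pow_apply (hf : HolFunctionAt (m := m) f p) (k : ℕ) :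
    mvfderiv (CModel m) (fun q => f q ^ k) p v
      = k * f p ^ (k - 1) * mvfderiv (CModel m) f p v := by
  induction k with
  | zero => simpa using mvfderiv_const_apply 1
  | succ k ih =>
    simp only [pow_succ]
    rw [mvfderiv_mul_apply (hf.pow k) hf, ih]
    rcases k with _ | k
    · simp
    · simp only [Nat.add_sub_cancel, Nat.cast_add, Nat.cast_one]; ring


end Derivation

/-! ### Charts, coordinate fields and coefficients of vector fields. -/

section Chart

open VectorField

variable {m : ℕ} {M : Type*} [TopologicalSpace M] [ChartedSpace (Fin m → ℂ) M]
  [IsManifold (CModel m) ω M] {φ : OpenPartialHomeomorph M (Fin m → ℂ)}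
  {f : M → ℂ} {p : M}

theorem holFunctionAt_iff (hφ : φ ∈ IsManifold.maximalAtlas (CModel m) ω M) (hp : p ∈ φ.source) :
    HolFunctionAt (m := m) f p ↔ AnalyticAt ℂ (f ∘ φ.symm) (φ p) := by
  have key : AnalyticAt ℂ (f ∘ φ.symm) (φ p) ↔
      ContMDiffAt (CModel m) 𝓘(ℂ, ℂ) ω (f ∘ φ.symm) (φ p) :=
    ⟨fun h => contMDiffAt_iff_contDiffAt.2 h.contDiffAt,
      fun h => (contMDiffAt_iff_contDiffAt.1 h).analyticAt⟩
  rw [key]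
  constructor
  · intro h
    refine ContMDiffAt.comp (φ p) (I' := CModel m) (g := f) ?_
      (contMDiffAt_symm_of_mem_maximalAtlas hφ (φ.map_source hp))
    rwa [φ.left_inv hp]
  · intro h
    have h1 : ContMDiffAt (CModel m) 𝓘(ℂ, ℂ) ω ((f ∘ φ.symm) ∘ φ) p :=
      ContMDiffAt.comp p h (contMDiffAt_of_mem_maximalAtlas hφ hp)
    refine ContMDiffAt.congr_of_eventuallyEq h1 ?_
    filter_upwards [φ.open_source.mem_nhds hp] with q hq
    simp [φ.left_inv hq]

theorem HolFunctionAt.eventually (hf : HolFunctionAt (m := m) f p) :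
    ∀ᶠ q in 𝓝 p, HolFunctionAt (m := m) f q := by
  have hφ := IsManifold.chart_mem_maximalAtlas (I := CModel m) (n := ω) p
  have hp := mem_chart_source (Fin m → ℂ) p
  have h1 := ((holFunctionAt_iff hφ hp).1 hf).eventually_analyticAt
  filter_upwards [((chartAt (Fin m → ℂ) p).continuousAt hp).eventually h1,
    (chartAt (Fin m → ℂ) p).open_source.mem_nhds hp] with q hq hqs
  exact (holFunctionAt_iff hφ hqs).2 hq

theorem mdifferentiable_of_mem_maximalAtlas (hφ : φ ∈ IsManifold.maximalAtlas (CModel m) ω M) :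
    φ.MDifferentiable (CModel m) (CModel m) :=
  ⟨fun _ hq => ((contMDiffAt_of_mem_maximalAtlas hφ hq).mdifferentiableAt
      (by simp)).mdifferentiableWithinAt,
    fun _ hq => ((contMDiffAt_symm_of_mem_maximalAtlas hφ hq).mdifferentiableAt
      (by simp)).mdifferentiableWithinAt⟩

theorem mvfderiv_chart_bijective (hφ : φ ∈ IsManifold.maximalAtlas (CModel m) ω M)
    (hp : p ∈ φ.source) : Function.Bijective (mvfderiv (CModel m) φ p) :=
  (mdifferentiable_of_mem_maximalAtlas hφ).mfderiv_bijective hp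

theorem holFunctionAt_chart (hφ : φ ∈ IsManifold.maximalAtlas (CModel m) ω M)
    (hp : p ∈ φ.source) (k : Fin m) : HolFunctionAt (m := m) (fun q => φ q k) p := by
  rw [holFunctionAt_iff hφ hp]
  have h1 : AnalyticAt ℂ (fun z : Fin m → ℂ => z k) (φ p) :=
    (ContinuousLinearMap.proj (R := ℂ) (φ := fun _ : Fin m => ℂ) k).analyticAt _
  refine h1.congr ?_
  filter_upwards [φ.open_target.mem_nhds (φ.map_source hp)] with z hz
  simp [φ.right_inv hz]

theorem mvfderiv_eq_fderiv (hφ : φ ∈ IsManifold.maximalAtlas (CModel m) ω M)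
    (hp : p ∈ φ.source) (hf : HolFunctionAt (m := m) f p) (v : TangentSpace (CModel m) p) :
    mvfderiv (CModel m) f p v = fderiv ℂ (f ∘ φ.symm) (φ p) (mvfderiv (CModel m) φ p v) := by
  have h1 := (holFunctionAt_iff hφ hp).1 hf
  have h2 : mfderiv (CModel m) 𝓘(ℂ, ℂ) ((f ∘ φ.symm) ∘ φ) p
      = (mfderiv (CModel m) 𝓘(ℂ, ℂ) (f ∘ φ.symm) (φ p)).comp (mfderiv (CModel m) (CModel m) φ p) :=
    mfderiv_comp p h1.differentiableAt.mdifferentiableAt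
      ((contMDiffAt_of_mem_maximalAtlas hφ hp).mdifferentiableAt (by simp))
  have h3 : mvfderiv (CModel m) f p = mvfderiv (CModel m) ((f ∘ φ.symm) ∘ φ) p := by
    apply mvfderiv_congr_eventually
    filter_upwards [φ.open_source.mem_nhds hp] with q hq
    simp [φ.left_inv hq]
  rw [h3]
  change mfderiv (CModel m) 𝓘(ℂ, ℂ) ((f ∘ φ.symm) ∘ φ) p v = _
  rw [h2, mfderiv_eq_fderiv]
  rfl

theorem mvfderiv_chart_apply (hφ : φ ∈ IsManifold.maximalAtlas (CModel m) ω M)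
    (hp : p ∈ φ.source) (v : TangentSpace (CModel m) p) (k : Fin m) :
    mvfderiv (CModel m) (fun q => φ q k) p v = mvfderiv (CModel m) φ p v k := by
  rw [mvfderiv_eq_fderiv hφ hp (holFunctionAt_chart hφ hp k)]
  have : ((fun q => φ q k) ∘ φ.symm) =ᶠ[𝓝 (φ p)]
      (ContinuousLinearMap.proj (R := ℂ) (φ := fun _ : Fin m => ℂ) k) := by
    filter_upwards [φ.open_target.mem_nhds (φ.map_source hp)] with z hz
    simp [φ.right_inv hz]
  rw [this.fderiv_eq, ContinuousLinearMap.fderiv]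
  rfl

/-- The coordinate fields of a chart. -/
def chartField (φ : OpenPartialHomeomorph M (Fin m → ℂ)) (k : Fin m) :
    ∀ q : M, TangentSpace (CModel m) q :=
  mpullback (CModel m) (CModel m) φ fun _ => (Pi.single k 1 : Fin m → ℂ)

theorem isInvertible_mfderiv_chart (hφ : φ ∈ IsManifold.maximalAtlas (CModel m) ω M)
    (hp : p ∈ φ.source) : (mfderiv (CModel m) (CModel m) φ p).IsInvertible :=
  ⟨(mdifferentiable_of_mem_maximalAtlas hφ).mfderiv hp, rfl⟩

theorem mvfderiv_chartField (hφ : φ ∈ IsManifold.maximalAtlas (CModel m) ω M)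
    (hp : p ∈ φ.source) (k : Fin m) :
    mvfderiv (CModel m) φ p (chartField φ k p) = Pi.single k 1 := by
  have h := (isInvertible_mfderiv_chart hφ hp).self_comp_inverse
  exact DFunLike.congr_fun h (Pi.single k 1 : Fin m → ℂ)

theorem holFieldAt_mpullback (hφ : φ ∈ IsManifold.maximalAtlas (CModel m) ω M)
    (hp : p ∈ φ.source) {W : (Fin m → ℂ) → (Fin m → ℂ)} (hW : AnalyticAt ℂ W (φ p)) :
    HolFieldAt (mpullback (CModel m) (CModel m) φ W) p := by
  refine ContMDiffAt.mpullback_vectorField_preimage (n := ω)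
    (contMDiffAt_vectorSpace_iff_contDiffAt.2 hW.contDiffAt)
    (contMDiffAt_of_mem_maximalAtlas hφ hp) (isInvertible_mfderiv_chart hφ hp) ?_
  simp

theorem holFieldAt_chartField (hφ : φ ∈ IsManifold.maximalAtlas (CModel m) ω M)
    (hp : p ∈ φ.source) (k : Fin m) : HolFieldAt (chartField φ k) p :=
  holFieldAt_mpullback hφ hp analyticAt_const

/-- The coefficients of a holomorphic vector field in a chart are analytic. -/
theorem HolFieldAt.analyticAt_coeff (hφ : φ ∈ IsManifold.maximalAtlas (CModel m) ω M)
    (hp : p ∈ φ.source) {X : ∀ q : M, TangentSpace (CModel m) q} (hX : HolFieldAt X p) :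
    AnalyticAt ℂ (fun z => mvfderiv (CModel m) φ (φ.symm z) (X (φ.symm z))) (φ p) := by
  have hd := mdifferentiable_of_mem_maximalAtlas hφ
  have h1 : ContMDiffAt (CModel m) (CModel m).tangent ω
      (fun z => (⟨z, mpullback (CModel m) (CModel m) φ.symm X z⟩ :
        TangentBundle (CModel m) (Fin m → ℂ))) (φ p) := by
    refine ContMDiffAt.mpullback_vectorField_preimage (n := ω) ?_
      (contMDiffAt_symm_of_mem_maximalAtlas hφ (φ.map_source hp))
      ⟨hd.symm.mfderiv (φ.map_source hp), rfl⟩ (by simp)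
    rw [φ.left_inv hp]
    exact hX
  have h2 := (contMDiffAt_vectorSpace_iff_contDiffAt.1 h1).analyticAt
  refine h2.congr ?_
  filter_upwards [φ.open_target.mem_nhds (φ.map_source hp)] with z hz
  have h3 : (mfderiv (CModel m) (CModel m) φ (φ.symm z)).comp
      (mfderiv (CModel m) (CModel m) φ.symm z) = ContinuousLinearMap.id ℂ _ :=
    hd.comp_symm_deriv hz
  have h4 : (mfderiv (CModel m) (CModel m) φ.symm z).IsInvertible := ⟨hd.symm.mfderiv hz, rfl⟩
  have h5 := DFunLike.congr_fun h4.self_comp_inverse (X (φ.symm z))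
  have h6 := DFunLike.congr_fun h3
    ((mfderiv (CModel m) (CModel m) φ.symm z).inverse (X (φ.symm z)))
  rw [ContinuousLinearMap.comp_apply] at h5 h6
  rw [h5] at h6
  exact h6.symm

theorem HolFunctionAt.mvfderiv {X : ∀ q : M, TangentSpace (CModel m) q}
    (hf : HolFunctionAt (m := m) f p) (hX : HolFieldAt X p) :
    HolFunctionAt (m := m) (fun q => mvfderiv (CModel m) f q (X q)) p := by
  have hφ := IsManifold.chart_mem_maximalAtlas (I := CModel m) (n := ω) p
  have hp := mem_chart_source (Fin m → ℂ) p
  set φ := chartAt (Fin m → ℂ) p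
  rw [holFunctionAt_iff hφ hp]
  have h1 := (((holFunctionAt_iff hφ hp).1 hf).fderiv.contDiffAt (n := ω)).clm_apply
    (hX.analyticAt_coeff hφ hp).contDiffAt |>.analyticAt
  refine h1.congr ?_
  have h2 := ((φ.continuousAt_symm (φ.map_source hp)).eventually
    (by rw [φ.left_inv hp]; exact hf.eventually))
  filter_upwards [φ.open_target.mem_nhds (φ.map_source hp), h2] with z hz hfz
  rw [Function.comp_apply, mvfderiv_eq_fderiv hφ (φ.map_target hz) hfz, φ.right_inv hz]

end Chart
end

/-! ### Holomorphic vector fields, Lie brackets and 1-forms. -/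

noncomputable section

section Field

open VectorField

variable {m : ℕ} {M : Type*} [TopologicalSpace M] [ChartedSpace (Fin m → ℂ) M]
  [IsManifold (CModel m) ω M] {φ : OpenPartialHomeomorph M (Fin m → ℂ)}
  {f g : M → ℂ} {p : M} {X Y Z : ∀ q : M, TangentSpace (CModel m) q}

theorem HolFieldAt.congr (hX : HolFieldAt X p) (h : ∀ᶠ q in 𝓝 p, Y q = X q) :
    HolFieldAt Y p := by
  refine ContMDiffAt.congr_of_eventuallyEq hX ?_
  filter_upwards [h] with q hq
  rw [hq]

theorem HolFieldAt.add (hX : HolFieldAt X p) (hY : HolFieldAt Y p) :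
    HolFieldAt (fun q => X q + Y q) p :=
  ContMDiffAt.add_section hX hY

theorem HolFieldAt.neg (hX : HolFieldAt X p) : HolFieldAt (fun q => -X q) p :=
  ContMDiffAt.neg_section hX

theorem HolFieldAt.sub (hX : HolFieldAt X p) (hY : HolFieldAt Y p) :
    HolFieldAt (fun q => X q - Y q) p :=
  ContMDiffAt.sub_section hX hY

theorem HolFieldAt.smul (hf : HolFunctionAt (m := m) f p) (hX : HolFieldAt X p) :
    HolFieldAt (fun q => f q • X q) p :=
  ContMDiffAt.smul_section hf hX

theorem HolFieldAt.zero (p : M) : HolFieldAt (m := m) (fun _ : M => 0) p :=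
  (Bundle.contMDiff_zeroSection ℂ (TangentSpace (CModel m) : M → Type _)).contMDiffAt

theorem HolFieldAt.sum {ι : Type*} {s : Finset ι} {X : ι → ∀ q : M, TangentSpace (CModel m) q}
    (hX : ∀ i ∈ s, HolFieldAt (X i) p) : HolFieldAt (fun q => ∑ i ∈ s, X i q) p := by
  classical
  induction s using Finset.induction_on with
  | empty => simpa using HolFieldAt.zero p
  | insert a s ha ih =>
    simp only [Finset.sum_insert ha]
    exact (hX a (by simp)).add (ih fun i hi => hX i (by simp [hi]))

theorem eq_sum_chartField (hφ : φ ∈ IsManifold.maximalAtlas (CModel m) ω M)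
    (hp : p ∈ φ.source) (v : TangentSpace (CModel m) p) :
    v = ∑ k, mvfderiv (CModel m) φ p v k • chartField φ k p := by
  apply (mvfderiv_chart_bijective hφ hp).1
  rw [map_sum]
  simp only [map_smul, mvfderiv_chartField hφ hp]
  exact pi_eq_sum_univ' _

theorem HolFieldAt.coeff (hφ : φ ∈ IsManifold.maximalAtlas (CModel m) ω M)
    (hp : p ∈ φ.source) (hX : HolFieldAt X p) (k : Fin m) :
    HolFunctionAt (m := m) (fun q => mvfderiv (CModel m) φ q (X q) k) p := by
  refine ((holFunctionAt_chart hφ hp k).mvfderiv hX).congr ?_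
  filter_upwards [φ.open_source.mem_nhds hp] with q hq
  exact (mvfderiv_chart_apply hφ hq (X q) k).symm

theorem holFieldAt_iff_coeff (hφ : φ ∈ IsManifold.maximalAtlas (CModel m) ω M)
    (hp : p ∈ φ.source) :
    HolFieldAt X p ↔
      ∀ k, HolFunctionAt (m := m) (fun q => mvfderiv (CModel m) φ q (X q) k) p := by
  refine ⟨fun hX k => hX.coeff hφ hp k, fun h => ?_⟩
  refine (HolFieldAt.sum (s := Finset.univ) fun k _ =>
    (holFieldAt_chartField hφ hp k).smul (h k)).congr ?_
  filter_upwards [φ.open_source.mem_nhds hp] with q hq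
  exact eq_sum_chartField hφ hq (X q)

theorem HolFieldAt.eventually (hX : HolFieldAt X p) : ∀ᶠ q in 𝓝 p, HolFieldAt X q := by
  have hφ := IsManifold.chart_mem_maximalAtlas (I := CModel m) (n := ω) p
  have hp := mem_chart_source (Fin m → ℂ) p
  have h : ∀ k, ∀ᶠ q in 𝓝 p, HolFunctionAt (m := m)
      (fun q => mvfderiv (CModel m) (chartAt (Fin m → ℂ) p) q (X q) k) q :=
    fun k => (hX.coeff hφ hp k).eventually
  filter_upwards [Filter.eventually_all.2 h,
    (chartAt (Fin m → ℂ) p).open_source.mem_nhds hp] with q hq hqs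
  exact (holFieldAt_iff_coeff hφ hqs).2 hq

theorem HolFieldAt.mdiff (hX : HolFieldAt X p) : MDifferentiableAt (CModel m) (CModel m).tangent
    (fun q => (⟨q, X q⟩ : TangentBundle (CModel m) M)) p :=
  ContMDiffAt.mdifferentiableAt hX (by simp)

/-- A tangent vector that kills all holomorphic functions vanishes. -/
theorem tangent_ext {v w : TangentSpace (CModel m) p}
    (h : ∀ f : M → ℂ, HolFunctionAt (m := m) f p →
      mvfderiv (CModel m) f p v = mvfderiv (CModel m) f p w) : v = w := by
  have hφ := IsManifold.chart_mem_maximalAtlas (I := CModel m) (n := ω) p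
  have hp := mem_chart_source (Fin m → ℂ) p
  apply (mvfderiv_chart_bijective hφ hp).1
  funext k
  rw [← mvfderiv_chart_apply hφ hp, ← mvfderiv_chart_apply hφ hp]
  exact h _ (holFunctionAt_chart hφ hp k)

theorem mlieBracket_congr {X' Y' : ∀ q : M, TangentSpace (CModel m) q}
    (hX : ∀ᶠ q in 𝓝 p, X q = X' q) (hY : ∀ᶠ q in 𝓝 p, Y q = Y' q) :
    mlieBracket (CModel m) X Y p = mlieBracket (CModel m) X' Y' p :=
  Filter.EventuallyEq.mlieBracket_vectorField_eq hX hY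

theorem mlieBracket_eq_lieBracket (A B : ∀ z : Fin m → ℂ, TangentSpace (CModel m) z) :
    mlieBracket (CModel m) A B = lieBracket ℂ A B := by
  rw [← mlieBracketWithin_univ, mlieBracketWithin_eq_lieBracketWithin]
  exact lieBracketWithin_univ

/-- In a chart both sides involve the directional derivatives of the coefficients, and the second
derivatives of f cancel by symmetry. In this form, as a commutator of derivations, the bracket
enters all later computations. -/
theorem mvfderiv_mlieBracket (hf : HolFunctionAt (m := m) f p) (hX : HolFieldAt X p)
    (hY : HolFieldAt Y p) :
    mvfderiv (CModel m) f p (mlieBracket (CModel m) X Y p)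
      = mvfderiv (CModel m) (fun q => mvfderiv (CModel m) f q (Y q)) p (X p)
        - mvfderiv (CModel m) (fun q => mvfderiv (CModel m) f q (X q)) p (Y p) := by
  have hφ := IsManifold.chart_mem_maximalAtlas (I := CModel m) (n := ω) p
  have hp := mem_chart_source (Fin m → ℂ) p
  set φ := chartAt (Fin m → ℂ) p
  set A : (Fin m → ℂ) → (Fin m → ℂ) :=
    fun z => mvfderiv (CModel m) φ (φ.symm z) (X (φ.symm z)) with hA
  set B : (Fin m → ℂ) → (Fin m → ℂ) :=
    fun z => mvfderiv (CModel m) φ (φ.symm z) (Y (φ.symm z)) with hB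
  have hAa : AnalyticAt ℂ A (φ p) := hX.analyticAt_coeff hφ hp
  have hBa : AnalyticAt ℂ B (φ p) := hY.analyticAt_coeff hφ hp
  have hpull : ∀ (W : ∀ q : M, TangentSpace (CModel m) q), ∀ᶠ q in 𝓝 p,
      W q = mpullback (CModel m) (CModel m) φ
        (fun z => mvfderiv (CModel m) φ (φ.symm z) (W (φ.symm z))) q := by
    intro W
    filter_upwards [φ.open_source.mem_nhds hp] with q hq
    have h := DFunLike.congr_fun (isInvertible_mfderiv_chart hφ hq).inverse_comp_self (W q)
    have h2 : mvfderiv (CModel m) φ (φ.symm (φ q)) (W (φ.symm (φ q)))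
        = mvfderiv (CModel m) φ q (W q) :=
      congrArg (fun q' => (mvfderiv (CModel m) φ q' (W q') : Fin m → ℂ)) (φ.left_inv hq)
    refine h.symm.trans ?_
    exact congrArg (mfderiv (CModel m) (CModel m) φ q).inverse h2.symm
  have hbr : mvfderiv (CModel m) φ p (mlieBracket (CModel m) X Y p)
      = lieBracket ℂ A B (φ p) := by
    rw [mlieBracket_congr (hpull X) (hpull Y), ← mpullback_mlieBracket (n := ω)
      (contMDiffAt_vectorSpace_iff_contDiffAt.2 (hAa.contDiffAt (n := ω)) |>.mdifferentiableAt
        (by simp))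
      (contMDiffAt_vectorSpace_iff_contDiffAt.2 (hBa.contDiffAt (n := ω)) |>.mdifferentiableAt
        (by simp)) (contMDiffAt_of_mem_maximalAtlas hφ hp) (by simp)]
    have h := DFunLike.congr_fun (isInvertible_mfderiv_chart hφ hp).self_comp_inverse
      (mlieBracket (CModel m) A B (φ p))
    rw [mpullback_apply]
    refine Eq.trans h ?_
    exact congrFun (mlieBracket_eq_lieBracket A B) (φ p)
  have hfa := (holFunctionAt_iff hφ hp).1 hf
  have hfev := ((φ.continuousAt_symm (φ.map_source hp)).eventually
    (by rw [φ.left_inv hp]; exact hf.eventually))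
  have hpush : ∀ {W : ∀ q : M, TangentSpace (CModel m) q}, HolFieldAt W p →
      ((fun q => mvfderiv (CModel m) f q (W q)) ∘ φ.symm) =ᶠ[𝓝 (φ p)]
      fun z => fderiv ℂ (f ∘ φ.symm) z (mvfderiv (CModel m) φ (φ.symm z) (W (φ.symm z))) := by
    intro W hW
    filter_upwards [φ.open_target.mem_nhds (φ.map_source hp), hfev] with z hz hfz
    rw [Function.comp_apply, mvfderiv_eq_fderiv hφ (φ.map_target hz) hfz, φ.right_inv hz]
  rw [mvfderiv_eq_fderiv hφ hp hf, hbr, mvfderiv_eq_fderiv hφ hp (hf.mvfderiv hY),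
    mvfderiv_eq_fderiv hφ hp (hf.mvfderiv hX), (hpush hX).fderiv_eq, (hpush hY).fderiv_eq]
  have hfd := hfa.fderiv.differentiableAt
  rw [show (fun z => fderiv ℂ (f ∘ φ.symm) z (mvfderiv (CModel m) φ (φ.symm z) (X (φ.symm z))))
      = fun z => fderiv ℂ (f ∘ φ.symm) z (A z) from rfl,
    show (fun z => fderiv ℂ (f ∘ φ.symm) z (mvfderiv (CModel m) φ (φ.symm z) (Y (φ.symm z))))
      = fun z => fderiv ℂ (f ∘ φ.symm) z (B z) from rfl,
    fderiv_clm_apply hfd hAa.differentiableAt, fderiv_clm_apply hfd hBa.differentiableAt]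
  have hsymm : IsSymmSndFDerivAt ℂ (f ∘ φ.symm) (φ p) :=
    (hfa.contDiffAt (n := ω)).isSymmSndFDerivAt (by simp)
  have hXA : mvfderiv (CModel m) φ p (X p) = A (φ p) :=
    congrArg (fun q' => (mvfderiv (CModel m) φ q' (X q') : Fin m → ℂ)) (φ.left_inv hp).symm
  have hYB : mvfderiv (CModel m) φ p (Y p) = B (φ p) :=
    congrArg (fun q' => (mvfderiv (CModel m) φ q' (Y q') : Fin m → ℂ)) (φ.left_inv hp).symm
  rw [hXA, hYB]
  have hs := hsymm (A (φ p)) (B (φ p))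
  simp only [lieBracket, map_sub, add_apply, ContinuousLinearMap.comp_apply,
    ContinuousLinearMap.flip_apply, hs]
  ring

theorem HolFieldAt.mlieBracket (hX : HolFieldAt X p) (hY : HolFieldAt Y p) :
    HolFieldAt (mlieBracket (CModel m) X Y) p := by
  have hφ := IsManifold.chart_mem_maximalAtlas (I := CModel m) (n := ω) p
  have hp := mem_chart_source (Fin m → ℂ) p
  set φ := chartAt (Fin m → ℂ) p
  rw [holFieldAt_iff_coeff hφ hp]
  intro k
  have hk := holFunctionAt_chart hφ hp k
  refine (((hk.mvfderiv hY).mvfderiv hX).sub ((hk.mvfderiv hX).mvfderiv hY)).congr ?_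
  filter_upwards [hX.eventually, hY.eventually, hk.eventually,
    φ.open_source.mem_nhds hp] with q hXq hYq hkq hq
  rw [← mvfderiv_mlieBracket hkq hXq hYq, mvfderiv_chart_apply hφ hq]

theorem HolFormAt.congr {α β : ∀ q : M, TangentSpace (CModel m) q →L[ℂ] ℂ}
    (hα : HolFormAt α p) (h : ∀ᶠ q in 𝓝 p, β q = α q) : HolFormAt β p := by
  intro X hX
  refine (hα X hX).congr ?_
  filter_upwards [h] with q hq
  rw [hq]

theorem holFormAt_iff_frame {α : ∀ q : M, TangentSpace (CModel m) q →L[ℂ] ℂ} {ι : Type*} [Fintype ι]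
    {e : ι → ∀ q : M, TangentSpace (CModel m) q} (he : ∀ i, HolFieldAt (e i) p)
    (hspan : ∀ X : ∀ q : M, TangentSpace (CModel m) q, HolFieldAt X p →
      ∃ c : ι → M → ℂ, (∀ i, HolFunctionAt (m := m) (c i) p) ∧
        ∀ᶠ q in 𝓝 p, X q = ∑ i, c i q • e i q) :
    HolFormAt α p ↔ ∀ i, HolFunctionAt (m := m) (fun q => α q (e i q)) p := by
  refine ⟨fun h i => h _ (he i), fun h X hX => ?_⟩
  obtain ⟨c, hc, hX⟩ := hspan X hX
  refine (HolFunctionAt.sum (s := Finset.univ) fun i _ => (hc i).mul (h i)).congr ?_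
  filter_upwards [hX] with q hq
  simp [hq]

theorem holFormAt_iff_chart {α : ∀ q : M, TangentSpace (CModel m) q →L[ℂ] ℂ}
    (hφ : φ ∈ IsManifold.maximalAtlas (CModel m) ω M) (hp : p ∈ φ.source) :
    HolFormAt α p ↔ ∀ k, HolFunctionAt (m := m) (fun q => α q (chartField φ k q)) p := by
  refine holFormAt_iff_frame (holFieldAt_chartField hφ hp) fun X hX =>
    ⟨fun k q => mvfderiv (CModel m) φ q (X q) k, hX.coeff hφ hp, ?_⟩
  filter_upwards [φ.open_source.mem_nhds hp] with q hq
  exact eq_sum_chartField hφ hq (X q)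

theorem mlieBracket_chartField (hφ : φ ∈ IsManifold.maximalAtlas (CModel m) ω M)
    (hp : p ∈ φ.source) (i j : Fin m) :
    mlieBracket (CModel m) (chartField φ i) (chartField φ j) p = 0 := by
  apply (mvfderiv_chart_bijective hφ hp).1
  funext k
  rw [← mvfderiv_chart_apply hφ hp, mvfderiv_mlieBracket (holFunctionAt_chart hφ hp k)
    (holFieldAt_chartField hφ hp i) (holFieldAt_chartField hφ hp j), map_zero]
  have hc : ∀ l : Fin m, ∀ v, mvfderiv (CModel m)
      (fun q => mvfderiv (CModel m) (fun q => φ q k) q (chartField φ l q)) p v = 0 := by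
    intro l v
    rw [mvfderiv_congr_eventually (g := fun _ => (Pi.single l 1 : Fin m → ℂ) k),
      mvfderiv_const_apply]
    filter_upwards [φ.open_source.mem_nhds hp] with q hq
    rw [mvfderiv_chart_apply hφ hq, mvfderiv_chartField hφ hq]
  rw [hc, hc, sub_zero]
  rfl

end Field
end

/-! ### The implicit function theorem and the lifting of idempotents. -/

noncomputable section

section ImplicitFunction

open Filter

/-- The analytic implicit function theorem, with uniqueness, in finite dimensions. -/
theorem AnalyticAt.exists_implicit_function {E V : Type} [NormedAddCommGroup E] [NormedSpace ℂ E]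
    [FiniteDimensional ℂ E] [NormedAddCommGroup V] [NormedSpace ℂ V] [FiniteDimensional ℂ V]
    {Ψ : E × V → V} {z₀ : E} {b : V}
    (hΨ : AnalyticAt ℂ Ψ (z₀, b)) (h0 : Ψ (z₀, b) = 0)
    (hinj : ∀ v, fderiv ℂ Ψ (z₀, b) (0, v) = 0 → v = 0) :
    ∃ x : E → V, AnalyticAt ℂ x z₀ ∧ x z₀ = b ∧ (∀ᶠ z in 𝓝 z₀, Ψ (z, x z) = 0) ∧
      ∀ᶠ w in 𝓝 (z₀, b), Ψ w = 0 → w.2 = x w.1 := by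
  set Φ : E × V → E × V := fun w => (w.1, Ψ w) with hΦ
  have hΦa : AnalyticAt ℂ Φ (z₀, b) := analyticAt_fst.prod hΨ
  set L : E × V →L[ℂ] E × V := (ContinuousLinearMap.fst ℂ E V).prod (fderiv ℂ Ψ (z₀, b)) with hL
  have hΦd : HasFDerivAt Φ L (z₀, b) :=
    hasFDerivAt_fst.prodMk hΨ.differentiableAt.hasFDerivAt
  have hLinj : Function.Injective L := by
    rw [injective_iff_map_eq_zero]
    rintro ⟨z, v⟩ h
    have h1 : z = 0 := congrArg Prod.fst h
    subst h1
    have h2 : fderiv ℂ Ψ (z₀, b) (0, v) = 0 := congrArg Prod.snd h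
    rw [hinj v h2]; rfl
  set L' : (E × V) ≃L[ℂ] (E × V) :=
    (LinearEquiv.ofInjectiveEndo L.toLinearMap hLinj).toContinuousLinearEquiv with hL'
  have hLL : (L' : E × V →L[ℂ] E × V) = L := by ext w <;> rfl
  rw [← hLL] at hΦd
  have hc : ContDiffAt ℂ ω Φ (z₀, b) := hΦa.contDiffAt
  have hs := hc.hasStrictFDerivAt' hΦd (by simp)
  set J := hs.localInverse Φ L' (z₀, b)
  have hJa : AnalyticAt ℂ J (z₀, 0) := by
    have := (hc.to_localInverse hΦd (by simp)).analyticAt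
    rwa [show Φ (z₀, b) = (z₀, 0) by simp [hΦ, h0]] at this
  have hJ0 : J (z₀, 0) = (z₀, b) := by
    have := hs.localInverse_apply_image
    rwa [show Φ (z₀, b) = (z₀, 0) by simp [hΦ, h0]] at this
  have hι : AnalyticAt ℂ (fun z : E => (z, (0 : V))) z₀ := analyticAt_id.prod analyticAt_const
  have hι' : Tendsto (fun z : E => (z, (0 : V))) (𝓝 z₀) (𝓝 (z₀, 0)) := hι.continuousAt
  have hright := hs.eventually_right_inverse
  rw [show Φ (z₀, b) = (z₀, 0) by simp [hΦ, h0]] at hright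
  refine ⟨fun z => (J (z, 0)).2, ?_, by simp [hJ0], ?_, ?_⟩
  · have h1 : AnalyticAt ℂ (fun z : E => J (z, 0)) z₀ :=
      AnalyticAt.fun_comp (g := J) (f := fun z : E => (z, (0 : V))) hJa hι
    exact analyticAt_snd.fun_comp h1
  · filter_upwards [hι'.eventually hright] with z hz
    have h1 : (J (z, 0)).1 = z := congrArg Prod.fst hz
    have h2 : Ψ (J (z, 0)) = 0 := congrArg Prod.snd hz
    have h3 : (z, (J (z, 0)).2) = J (z, 0) := Prod.ext h1.symm rfl
    rw [h3, h2]
  · filter_upwards [hs.eventually_left_inverse] with w hw h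
    have : J (w.1, 0) = w := by
      rw [← hw]; simp only [hΦ, h, J]
      congr 1
      rw [← h, hw]
    rw [this]

end ImplicitFunction

section IdempotentLift

open Filter

variable {m : ℕ}

/-- The bilinear multiplication with structure functions `c`. -/
def structMul {E : Type} (c : Fin m → Fin m → E → (Fin m → ℂ)) (z : E)
    (x y : Fin m → ℂ) : Fin m → ℂ :=
  ∑ k, ∑ l, (x k * y l) • c k l z

theorem structMul_add_left {E : Type} (c : Fin m → Fin m → E → (Fin m → ℂ)) (z : E)
    (x x' y : Fin m → ℂ) : structMul c z (x + x') y = structMul c z x y + structMul c z x' y := by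
  simp only [structMul, ← Finset.sum_add_distrib]
  refine Finset.sum_congr rfl fun k _ => Finset.sum_congr rfl fun l _ => ?_
  simp only [Pi.add_apply]; module

theorem structMul_add_right {E : Type} (c : Fin m → Fin m → E → (Fin m → ℂ)) (z : E)
    (x y y' : Fin m → ℂ) : structMul c z x (y + y') = structMul c z x y + structMul c z x y' := by
  simp only [structMul, ← Finset.sum_add_distrib]
  refine Finset.sum_congr rfl fun k _ => Finset.sum_congr rfl fun l _ => ?_
  simp only [Pi.add_apply]; module

theorem structMul_smul_left {E : Type} (c : Fin m → Fin m → E → (Fin m → ℂ)) (z : E) (a : ℂ)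
    (x y : Fin m → ℂ) : structMul c z (a • x) y = a • structMul c z x y := by
  simp only [structMul, Finset.smul_sum]
  refine Finset.sum_congr rfl fun k _ => Finset.sum_congr rfl fun l _ => ?_
  simp only [Pi.smul_apply, smul_eq_mul]; module

theorem structMul_smul_right {E : Type} (c : Fin m → Fin m → E → (Fin m → ℂ)) (z : E) (a : ℂ)
    (x y : Fin m → ℂ) : structMul c z x (a • y) = a • structMul c z x y := by
  simp only [structMul, Finset.smul_sum]
  refine Finset.sum_congr rfl fun k _ => Finset.sum_congr rfl fun l _ => ?_
  simp only [Pi.smul_apply, smul_eq_mul]; module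

theorem AnalyticAt.structMul {E : Type} [NormedAddCommGroup E] [NormedSpace ℂ E]
    {D : Type} [NormedAddCommGroup D] [NormedSpace ℂ D]
    {c : Fin m → Fin m → E → (Fin m → ℂ)} {π : D → E} {x y : D → Fin m → ℂ} {w : D}
    (hc : ∀ k l, AnalyticAt ℂ (c k l) (π w)) (hπ : AnalyticAt ℂ π w)
    (hx : AnalyticAt ℂ x w) (hy : AnalyticAt ℂ y w) :
    AnalyticAt ℂ (fun w => structMul c (π w) (x w) (y w)) w := by
  unfold _root_.structMul
  refine Finset.analyticAt_fun_sum _ fun k _ => Finset.analyticAt_fun_sum _ fun l _ => ?_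
  have hxk : AnalyticAt ℂ (fun w => x w k) w := (analyticAt_pi_iff.1 hx) k
  have hyl : AnalyticAt ℂ (fun w => y w l) w := (analyticAt_pi_iff.1 hy) l
  exact (hxk.mul hyl).smul ((hc k l).fun_comp hπ)

/-- An idempotent of a commutative, associative algebra extends uniquely to nearby algebras. -/
theorem exists_idempotent_lift {E : Type} [NormedAddCommGroup E] [NormedSpace ℂ E]
    [FiniteDimensional ℂ E] {c : Fin m → Fin m → E → (Fin m → ℂ)} {z₀ : E} {b : Fin m → ℂ}
    (hc : ∀ k l, AnalyticAt ℂ (c k l) z₀)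
    (hcomm : ∀ x y, structMul c z₀ x y = structMul c z₀ y x)
    (hassoc : ∀ x y z, structMul c z₀ (structMul c z₀ x y) z
      = structMul c z₀ x (structMul c z₀ y z))
    (hb : structMul c z₀ b b = b) :
    ∃ x : E → (Fin m → ℂ), AnalyticAt ℂ x z₀ ∧ x z₀ = b ∧
      (∀ᶠ z in 𝓝 z₀, structMul c z (x z) (x z) = x z) ∧
      ∀ᶠ w in 𝓝 (z₀, b), structMul c w.1 w.2 w.2 = w.2 → w.2 = x w.1 := by
  set Ψ : E × (Fin m → ℂ) → (Fin m → ℂ) := fun w => structMul c w.1 w.2 w.2 - w.2 with hΨ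
  have hΨa : AnalyticAt ℂ Ψ (z₀, b) :=
    (AnalyticAt.structMul hc analyticAt_fst analyticAt_snd analyticAt_snd).sub analyticAt_snd
  have hder : ∀ v, fderiv ℂ Ψ (z₀, b) (0, v) = (2 : ℂ) • structMul c z₀ b v - v := by
    intro v
    have hline : HasDerivAt (fun t : ℂ => ((z₀, b) : E × (Fin m → ℂ)) + t • (0, v)) (0, v) 0 := by
      simpa using ((hasDerivAt_id (0 : ℂ)).smul_const ((0 : E), v)).const_add (z₀, b)
    have h1 : HasDerivAt (fun t : ℂ => Ψ ((z₀, b) + t • (0, v)))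
        (fderiv ℂ Ψ (z₀, b) (0, v)) 0 := by
      have h4 : HasFDerivAt Ψ (fderiv ℂ Ψ (z₀, b))
          (((z₀, b) : E × (Fin m → ℂ)) + (0 : ℂ) • ((0 : E), v)) := by
        simpa using hΨa.differentiableAt.hasFDerivAt
      exact h4.comp_hasDerivAt (0 : ℂ) hline
    have h2 : (fun t : ℂ => Ψ ((z₀, b) + t • (0, v)))
        = fun t : ℂ => t • ((2 : ℂ) • structMul c z₀ b v - v) + t ^ 2 • structMul c z₀ v v := by
      funext t
      simp only [hΨ, Prod.smul_mk, smul_zero, Prod.mk_add_mk, add_zero, structMul_add_left,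
        structMul_add_right, structMul_smul_left, structMul_smul_right, hb, hcomm v b]
      module
    have h3 : HasDerivAt (fun t : ℂ => t • ((2 : ℂ) • structMul c z₀ b v - v)
        + t ^ 2 • structMul c z₀ v v) ((2 : ℂ) • structMul c z₀ b v - v) 0 := by
      have := ((hasDerivAt_id (0 : ℂ)).smul_const ((2 : ℂ) • structMul c z₀ b v - v)).fun_add
        (((hasDerivAt_id (0 : ℂ)).pow 2).smul_const (structMul c z₀ v v))
      refine this.congr_deriv ?_
      simp
    rw [h2] at h1
    exact h1.unique h3
  -- At the idempotent b the derivative of x ↦ x∘x - x is 2b∘ - 1. It is injective, because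
  -- multiplication by b is a projection and 2·0 - 1, 2·1 - 1 are both nonzero.
  have hinj : ∀ v, fderiv ℂ Ψ (z₀, b) (0, v) = 0 → v = 0 := by
    intro v hv
    rw [hder, sub_eq_zero] at hv
    have h1 : structMul c z₀ b (structMul c z₀ b v) = structMul c z₀ b v := by
      rw [← hassoc, hb]
    have h2 : (2 : ℂ) • structMul c z₀ b v = structMul c z₀ b v := by
      conv_rhs => rw [← hv]
      rw [structMul_smul_right, h1]
    have h3 : structMul c z₀ b v = 0 := by
      have : (2 : ℂ) • structMul c z₀ b v - structMul c z₀ b v = 0 := sub_eq_zero.2 h2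
      rw [two_smul, add_sub_cancel_right] at this
      exact this
    rw [← hv, h3, smul_zero]
  obtain ⟨x, hxa, hx0, hx1, hx2⟩ :=
    hΨa.exists_implicit_function (by simp [hΨ, hb]) hinj
  refine ⟨x, hxa, hx0, ?_, ?_⟩
  · filter_upwards [hx1] with z hz using sub_eq_zero.1 hz
  · filter_upwards [hx2] with w hw h using hw (sub_eq_zero.2 h)

end IdempotentLift
end

/-! ### Bases and local frames of orthogonal idempotents. -/

noncomputable section

namespace FrobeniusManifold

variable {m : ℕ} {M : Type*} [TopologicalSpace M] [ChartedSpace (Fin m → ℂ) M]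
  [IsManifold (CModel m) ω M] (F : FrobeniusManifold m M)

/-- A system of `m` nonzero orthogonal idempotents of `T_q M`. -/
structure IsIdemBasis (q : M) (b : Fin m → TangentSpace (CModel m) q) : Prop where
  mul : ∀ i j, F.mul q (b i) (b j) = if i = j then b i else 0
  ne_zero : ∀ i, b i ≠ 0

variable {F} {q p : M} {b b' : Fin m → TangentSpace (CModel m) q}

theorem IsIdemBasis.mul_self (hb : F.IsIdemBasis q b) (i : Fin m) :
    F.mul q (b i) (b i) = b i := by rw [hb.mul, if_pos rfl]

theorem IsIdemBasis.mul_ne (hb : F.IsIdemBasis q b) {i j : Fin m} (h : i ≠ j) :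
    F.mul q (b i) (b j) = 0 := by rw [hb.mul, if_neg h]

theorem IsIdemBasis.mul_sum (hb : F.IsIdemBasis q b) (c : Fin m → ℂ) (j : Fin m) :
    F.mul q (b j) (∑ i, c i • b i) = c j • b j := by
  rw [map_sum, Finset.sum_eq_single j]
  · rw [map_smul, hb.mul_self]
  · intro i _ hij
    rw [map_smul, hb.mul_ne hij.symm, smul_zero]
  · simp

theorem IsIdemBasis.linearIndependent (hb : F.IsIdemBasis q b) : LinearIndependent ℂ b := by
  rw [Fintype.linearIndependent_iff]
  intro c hc j
  have h := hb.mul_sum c j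
  rw [hc, map_zero] at h
  exact (smul_eq_zero.1 h.symm).resolve_right (hb.ne_zero j)

theorem finrank_tangentSpace (q : M) : Module.finrank ℂ (TangentSpace (CModel m) q) = m := by
  change Module.finrank ℂ (Fin m → ℂ) = m
  simp

instance (q : M) : Module.Finite ℂ (TangentSpace (CModel m) q) :=
  inferInstanceAs (Module.Finite ℂ (Fin m → ℂ))

theorem IsIdemBasis.exists_eq_sum (hb : F.IsIdemBasis q b) (v : TangentSpace (CModel m) q) :
    ∃ c : Fin m → ℂ, v = ∑ i, c i • b i := by
  have h := hb.linearIndependent.span_eq_top_of_card_eq_finrank'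
    (by rw [Fintype.card_fin, finrank_tangentSpace])
  have hv : v ∈ Submodule.span ℂ (Set.range b) := by rw [h]; trivial
  obtain ⟨c, hc⟩ := (Submodule.mem_span_range_iff_exists_fun ℂ).1 hv
  exact ⟨c, hc.symm⟩

theorem IsIdemBasis.semisimpleAt (hb : F.IsIdemBasis q b) : F.SemisimpleAt q := by
  refine ⟨Module.Basis.mk hb.linearIndependent ?_, fun i j => ?_⟩
  · rw [hb.linearIndependent.span_eq_top_of_card_eq_finrank'
      (by rw [Fintype.card_fin, finrank_tangentSpace])]
  · simp only [Module.Basis.mk_apply]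
    exact hb.mul i j

/-- Invariance of g gives g(b_i, b_j) = g(b_i, b_i ∘ b_j). Together with nondegeneracy this makes g
diagonal with nonzero entries in the basis, so that coefficients are quotients of metric values,
which are visibly holomorphic. -/
theorem IsIdemBasis.metric_ne (hb : F.IsIdemBasis q b) {i j : Fin m} (h : i ≠ j) :
    F.metric q (b i) (b j) = 0 := by
  rw [← hb.mul_self i, F.metric_mul, hb.mul_ne h, map_zero]

theorem IsIdemBasis.metric_sum (hb : F.IsIdemBasis q b) (c : Fin m → ℂ) (j : Fin m) :
    F.metric q (∑ i, c i • b i) (b j) = c j * F.metric q (b j) (b j) := by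
  rw [map_sum, LinearMap.sum_apply, Finset.sum_eq_single j]
  · rw [map_smul, LinearMap.smul_apply, smul_eq_mul]
  · intro i _ hij
    rw [map_smul, LinearMap.smul_apply, hb.metric_ne hij, smul_zero]
  · simp

theorem IsIdemBasis.metric_self_ne_zero (hb : F.IsIdemBasis q b) (i : Fin m) :
    F.metric q (b i) (b i) ≠ 0 := by
  intro h
  apply hb.ne_zero i
  apply F.metric_nondeg q
  intro w
  obtain ⟨c, rfl⟩ := hb.exists_eq_sum w
  rw [F.metric_symm, hb.metric_sum, h, mul_zero]

theorem IsIdemBasis.eq_sum (hb : F.IsIdemBasis q b) (v : TangentSpace (CModel m) q) :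
    v = ∑ i, (F.metric q v (b i) / F.metric q (b i) (b i)) • b i := by
  obtain ⟨c, rfl⟩ := hb.exists_eq_sum v
  refine Finset.sum_congr rfl fun i _ => ?_
  rw [hb.metric_sum, mul_div_cancel_right₀ _ (hb.metric_self_ne_zero i)]

theorem IsIdemBasis.ext (hb : F.IsIdemBasis q b) {v w : TangentSpace (CModel m) q}
    (h : ∀ i, F.metric q v (b i) = F.metric q w (b i)) : v = w := by
  rw [hb.eq_sum v, hb.eq_sum w]
  simp only [h]

theorem IsIdemBasis.mul_eq (hb : F.IsIdemBasis q b) (v : TangentSpace (CModel m) q) (i : Fin m) :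
    F.mul q (b i) v = (F.metric q v (b i) / F.metric q (b i) (b i)) • b i := by
  conv_lhs => rw [hb.eq_sum v]
  exact hb.mul_sum _ i

theorem IsIdemBasis.metric_mul_self (hb : F.IsIdemBasis q b) (v : TangentSpace (CModel m) q)
    (i : Fin m) : F.metric q (F.mul q v (b i)) (b i) = F.metric q v (b i) := by
  rw [F.metric_mul, hb.mul_self]

theorem IsIdemBasis.metric_mul_ne (hb : F.IsIdemBasis q b) (v : TangentSpace (CModel m) q)
    {i j : Fin m} (h : i ≠ j) : F.metric q (F.mul q v (b i)) (b j) = 0 := by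
  rw [F.metric_mul, hb.mul_ne h, map_zero]

theorem IsIdemBasis.sum_eq_unit (hb : F.IsIdemBasis q b) : ∑ i, b i = F.unit q := by
  have h := hb.eq_sum (F.unit q)
  rw [h]
  refine Finset.sum_congr rfl fun i _ => ?_
  rw [← hb.mul_eq, F.mul_comm, F.unit_mul]

/-- Two systems of orthogonal idempotents agree up to renumbering. -/
theorem IsIdemBasis.exists_perm (hb : F.IsIdemBasis q b) (hb' : F.IsIdemBasis q b') :
    ∃ σ : Equiv.Perm (Fin m), ∀ i, b' i = b (σ i) := by
  have hc := fun i => hb.exists_eq_sum (b' i)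
  choose c hc using hc
  -- The coefficients of b' i satisfy c² = c, hence are 0 or 1, and the supports for different i are
  -- disjoint and nonempty. Among m indices, m such supports are single points.
  have hmul : ∀ i j k, c i k * c j k = if i = j then c i k else 0 := by
    intro i j k
    have h1 : F.mul q (b k) (F.mul q (b' i) (b' j)) = (c i k * c j k) • b k := by
      rw [← F.mul_assoc, hc i, hb.mul_sum, map_smul, LinearMap.smul_apply, hc j, hb.mul_sum,
        smul_smul]
    have h2 : F.mul q (b k) (F.mul q (b' i) (b' j)) = (if i = j then c i k else 0) • b k := by
      rw [hb'.mul]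
      split_ifs
      · conv_lhs => rw [hc i]
        exact hb.mul_sum _ _
      · rw [map_zero, zero_smul]
    have h3 : (c i k * c j k - if i = j then c i k else 0) • b k = 0 := by
      rw [sub_smul, ← h1, ← h2, sub_self]
    exact sub_eq_zero.1 ((smul_eq_zero.1 h3).resolve_right (hb.ne_zero k))
  have h01 : ∀ i k, c i k = 0 ∨ c i k = 1 := by
    intro i k
    have := hmul i i k
    rw [if_pos rfl] at this
    by_cases h : c i k = 0
    · exact Or.inl h
    · exact Or.inr (mul_left_cancel₀ h (by rw [this, mul_one]))
  have hex : ∀ i, ∃ k, c i k = 1 := by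
    intro i
    by_contra! hcon
    apply hb'.ne_zero i
    rw [hc i]
    refine Finset.sum_eq_zero fun k _ => ?_
    rw [(h01 i k).resolve_right (hcon k), zero_smul]
  choose s hs using hex
  have hinj : Function.Injective s := by
    intro i j hij
    by_contra hne
    have := hmul i j (s i)
    rw [if_neg hne, hs i, hij, hs j] at this
    simp at this
  have hbij : Function.Bijective s := Finite.injective_iff_bijective.1 hinj
  refine ⟨Equiv.ofBijective s hbij, fun i => ?_⟩
  rw [Equiv.ofBijective_apply, hc i, Finset.sum_eq_single (s i)]
  · rw [hs, one_smul]
  · intro k _ hk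
    obtain ⟨j, rfl⟩ := hbij.2 k
    have hne : i ≠ j := fun h => hk (by rw [h])
    have := hmul i j (s j)
    rw [if_neg hne, hs j, mul_one] at this
    rw [this, zero_smul]
  · simp

/-- A local frame of orthogonal idempotent holomorphic vector fields near `p`. -/
structure IsIdemFrame (F : FrobeniusManifold m M) (p : M)
    (e : Fin m → ∀ q : M, TangentSpace (CModel m) q) : Prop where
  field_hol : ∀ i, HolFieldAt (e i) p
  idem : ∀ᶠ q in 𝓝 p, F.IsIdemBasis q fun i => e i q

variable {e e' : Fin m → ∀ q : M, TangentSpace (CModel m) q}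

theorem IsIdemFrame.eventually (he : F.IsIdemFrame p e) : ∀ᶠ q in 𝓝 p, F.IsIdemFrame q e := by
  filter_upwards [Filter.eventually_all.2 fun i => (he.field_hol i).eventually,
    he.idem.eventually_nhds] with q h1 h2 using ⟨h1, h2⟩

theorem IsIdemFrame.self (he : F.IsIdemFrame p e) : F.IsIdemBasis p fun i => e i p :=
  he.idem.self_of_nhds

theorem IsIdemFrame.metric_hol (he : F.IsIdemFrame p e)
    {X : ∀ q : M, TangentSpace (CModel m) q} (hX : HolFieldAt X p) (i : Fin m) :
    HolFunctionAt (m := m) (fun q => F.metric q (X q) (e i q)) p :=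
  F.metric_hol p X (e i) hX (he.field_hol i)

theorem IsIdemFrame.eta_hol (he : F.IsIdemFrame p e) (i : Fin m) :
    HolFunctionAt (m := m) (F.eta e i) p :=
  he.metric_hol (he.field_hol i) i

theorem IsIdemFrame.eta_ne_zero (he : F.IsIdemFrame p e) (i : Fin m) : F.eta e i p ≠ 0 :=
  he.self.metric_self_ne_zero i

theorem IsIdemFrame.eta₂_hol (he : F.IsIdemFrame p e) (i j : Fin m) :
    HolFunctionAt (m := m) (F.eta₂ e i j) p :=
  (he.eta_hol j).mvfderiv (he.field_hol i)

theorem IsIdemFrame.holFormAt_iff (he : F.IsIdemFrame p e)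
    {α : ∀ q : M, TangentSpace (CModel m) q →L[ℂ] ℂ} :
    HolFormAt α p ↔ ∀ i, HolFunctionAt (m := m) (fun q => α q (e i q)) p := by
  refine holFormAt_iff_frame he.field_hol fun X hX =>
    ⟨fun i q => F.metric q (X q) (e i q) / F.eta e i q,
      fun i => (he.metric_hol hX i).div (he.eta_hol i) (he.eta_ne_zero i), ?_⟩
  filter_upwards [he.idem] with q hq using hq.eq_sum (X q)

/-- The renumbering at p persists nearby: the coefficient of e' i along e (σ i) is continuous and
nonzero at p, while for any other pairing it would vanish. -/
theorem IsIdemFrame.exists_perm (he : F.IsIdemFrame p e) (he' : F.IsIdemFrame p e') :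
    ∃ σ : Equiv.Perm (Fin m), ∀ᶠ q in 𝓝 p, ∀ i, e' i q = e (σ i) q := by
  obtain ⟨σ, hσ⟩ := he.self.exists_perm he'.self
  refine ⟨σ, ?_⟩
  have hcont : ∀ i, ContinuousAt
      (fun q => F.metric q (e' i q) (e (σ i) q) / F.eta e (σ i) q) p := fun i =>
    ((he.metric_hol (he'.field_hol i) (σ i)).div (he.eta_hol _) (he.eta_ne_zero _)).continuousAt
  have hne : ∀ i, ∀ᶠ q in 𝓝 p, F.metric q (e' i q) (e (σ i) q) / F.eta e (σ i) q ≠ 0 := by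
    intro i
    refine (hcont i).eventually_ne ?_
    rw [hσ i]
    exact div_ne_zero (he.eta_ne_zero _) (he.eta_ne_zero _)
  filter_upwards [Filter.eventually_all.2 hne, he.idem, he'.idem] with q hq h1 h2 i
  obtain ⟨τ, hτ⟩ := h1.exists_perm h2
  have h3 : τ i = σ i := by
    by_contra hcon
    apply hq i
    rw [hτ i, h1.metric_ne hcon, zero_div]
  rw [hτ i, h3]

/-- Near a semisimple point there is a holomorphic frame of orthogonal idempotents. -/
theorem SemisimpleAt.exists_isIdemFrame (hp : F.SemisimpleAt p) : ∃ e, F.IsIdemFrame p e := by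
  obtain ⟨B, hB⟩ := hp
  have hφ := IsManifold.chart_mem_maximalAtlas (I := CModel m) (n := ω) p
  have hps := mem_chart_source (Fin m → ℂ) p
  set φ := chartAt (Fin m → ℂ) p
  set c : Fin m → Fin m → (Fin m → ℂ) → (Fin m → ℂ) := fun k l z =>
    mvfderiv (CModel m) φ (φ.symm z)
      (F.mul (φ.symm z) (chartField φ k (φ.symm z)) (chartField φ l (φ.symm z))) with hc
  have hca : ∀ k l, AnalyticAt ℂ (c k l) (φ p) := fun k l =>
    (F.mul_hol p _ _ (holFieldAt_chartField hφ hps k)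
      (holFieldAt_chartField hφ hps l)).analyticAt_coeff hφ hps
  set vec : (Fin m → ℂ) → ∀ q : M, TangentSpace (CModel m) q :=
    fun x q => ∑ k, x k • chartField φ k q with hvec
  have hvecinv : ∀ q ∈ φ.source, ∀ v : TangentSpace (CModel m) q,
      vec (mvfderiv (CModel m) φ q v) q = v := fun q hq v =>
    (eq_sum_chartField hφ hq v).symm
  have hmul : ∀ q ∈ φ.source, ∀ x y,
      structMul c (φ q) x y = mvfderiv (CModel m) φ q (F.mul q (vec x q) (vec y q)) := by
    intro q hq x y
    have hcq : ∀ k l, c k l (φ q)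
        = mvfderiv (CModel m) φ q (F.mul q (chartField φ k q) (chartField φ l q)) := fun k l =>
      congrArg (fun q' => (mvfderiv (CModel m) φ q' (F.mul q' (chartField φ k q')
        (chartField φ l q')) : Fin m → ℂ)) (φ.left_inv hq)
    simp only [structMul, hcq, hvec, map_sum, LinearMap.sum_apply, map_smul, LinearMap.smul_apply]
    rw [Finset.sum_comm]
    refine Finset.sum_congr rfl fun l _ => ?_
    rw [Finset.smul_sum]
    refine Finset.sum_congr rfl fun k _ => ?_
    rw [smul_smul, _root_.mul_comm]
  have hcoord : ∀ q ∈ φ.source, ∀ x, mvfderiv (CModel m) φ q (vec x q) = x := by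
    intro q hq x
    simp only [hvec, map_sum, map_smul, mvfderiv_chartField hφ hq]
    exact (pi_eq_sum_univ' x).symm
  have hcomm : ∀ q ∈ φ.source, ∀ x y, structMul c (φ q) x y = structMul c (φ q) y x := by
    intro q hq x y
    rw [hmul q hq, hmul q hq, F.mul_comm]
  have hassoc : ∀ q ∈ φ.source, ∀ x y z, structMul c (φ q) (structMul c (φ q) x y) z
      = structMul c (φ q) x (structMul c (φ q) y z) := by
    intro q hq x y z
    rw [hmul q hq (structMul c (φ q) x y), hmul q hq x (structMul c (φ q) y z), hmul q hq x y,
      hmul q hq y z, hvecinv q hq, hvecinv q hq, F.mul_assoc]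
  set b : Fin m → (Fin m → ℂ) := fun i => mvfderiv (CModel m) φ p (B i) with hbdef
  have hbmul : ∀ i j, structMul c (φ p) (b i) (b j) = if i = j then b i else 0 := by
    intro i j
    rw [hmul p hps, hvecinv p hps, hvecinv p hps, hB]
    split_ifs
    · rfl
    · exact map_zero _
  have hlift := fun i => exists_idempotent_lift hca (hcomm p hps) (hassoc p hps)
    (by rw [hbmul, if_pos rfl] : structMul c (φ p) (b i) (b i) = b i)
  choose x hxa hx0 hxidem _ using hlift
  -- The idempotent 0 has a unique lift, namely 0. The product of two different lifted idempotents
  -- is an idempotent close to 0 and therefore vanishes.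
  obtain ⟨x₀, hx₀a, hx₀0, hx₀idem, hx₀uniq⟩ := exists_idempotent_lift hca (hcomm p hps)
    (hassoc p hps) (b := 0) (by simp [structMul])
  have hzero : ∀ᶠ z in 𝓝 (φ p), x₀ z = 0 := by
    have ht : Filter.Tendsto (fun z : Fin m → ℂ => (z, (0 : Fin m → ℂ))) (𝓝 (φ p))
        (𝓝 (φ p, 0)) := by
      have : ContinuousAt (fun z : Fin m → ℂ => (z, (0 : Fin m → ℂ))) (φ p) := by fun_prop
      exact this
    filter_upwards [ht.eventually hx₀uniq] with z hz
    exact (hz (by simp [structMul])).symm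
  have horth : ∀ i j, i ≠ j → ∀ᶠ q in 𝓝 p,
      structMul c (φ q) (x i (φ q)) (x j (φ q)) = 0 := by
    intro i j hij
    have hya : AnalyticAt ℂ (fun z => structMul c z (x i z) (x j z)) (φ p) :=
      AnalyticAt.structMul hca analyticAt_id (hxa i) (hxa j)
    have ht : Filter.Tendsto (fun z => (z, structMul c z (x i z) (x j z))) (𝓝 (φ p))
        (𝓝 (φ p, 0)) := by
      have h1 : ContinuousAt (fun z => (z, structMul c z (x i z) (x j z))) (φ p) :=
        continuousAt_id.prodMk hya.continuousAt
      have h2 : structMul c (φ p) (x i (φ p)) (x j (φ p)) = 0 := by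
        rw [hx0, hx0, hbmul, if_neg hij]
      have h3 : Filter.Tendsto (fun z => (z, structMul c z (x i z) (x j z))) (𝓝 (φ p))
        (𝓝 (φ p, structMul c (φ p) (x i (φ p)) (x j (φ p)))) := h1
      rwa [h2] at h3
    have hcφ : ContinuousAt φ p := φ.continuousAt hps
    filter_upwards [hcφ.eventually (ht.eventually hx₀uniq), hcφ.eventually hzero,
      hcφ.eventually (hxidem i), hcφ.eventually (hxidem j), φ.open_source.mem_nhds hps]
      with q h1 h2 h3 h4 hq
    rw [h1 ?_, h2]
    set A := x i (φ q)
    set C := x j (φ q)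
    calc structMul c (φ q) (structMul c (φ q) A C) (structMul c (φ q) A C)
        = structMul c (φ q) A (structMul c (φ q) C (structMul c (φ q) C A)) := by
          rw [hassoc q hq, hcomm q hq A C]
      _ = structMul c (φ q) A (structMul c (φ q) A C) := by
          rw [← hassoc q hq C C A, h4, hcomm q hq C A]
      _ = structMul c (φ q) A C := by rw [← hassoc q hq A A C, h3]
  refine ⟨fun i q => vec (x i (φ q)) q, fun i => ?_, ?_⟩
  · refine HolFieldAt.sum fun k _ => HolFieldAt.smul ?_ (holFieldAt_chartField hφ hps k)
    rw [holFunctionAt_iff hφ hps]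
    refine ((analyticAt_pi_iff.1 (hxa i)) k).congr ?_
    filter_upwards [φ.open_target.mem_nhds (φ.map_source hps)] with z hz
    rw [Function.comp_apply, φ.right_inv hz]
  · have hcφ : ContinuousAt φ p := φ.continuousAt hps
    have hne : ∀ i, ∀ᶠ q in 𝓝 p, x i (φ q) ≠ 0 := by
      intro i
      refine hcφ.eventually ((hxa i).continuousAt.eventually_ne ?_)
      rw [hx0]
      intro h0
      apply B.ne_zero i
      apply (mvfderiv_chart_bijective hφ hps).1
      rw [map_zero]
      exact h0
    have horth' : ∀ᶠ q in 𝓝 p, ∀ i j, i ≠ j →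
        structMul c (φ q) (x i (φ q)) (x j (φ q)) = 0 := by
      simp only [Filter.eventually_all]
      exact horth
    filter_upwards [horth', Filter.eventually_all.2 hne,
      Filter.eventually_all.2 fun i => hcφ.eventually (hxidem i),
      φ.open_source.mem_nhds hps] with q h1 h2 h3 hq
    refine ⟨fun i j => ?_, fun i h0 => ?_⟩
    · apply (mvfderiv_chart_bijective hφ hq).1
      rw [← hmul q hq]
      split_ifs with hij
      · subst hij
        rw [h3, hcoord q hq]
      · rw [h1 i j hij, map_zero]
    · apply h2 i
      rw [← hcoord q hq (x i (φ q)), h0, map_zero]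

end FrobeniusManifold
end

/-! ### The Levi-Civita connection in the idempotent frame and canonical coordinates. -/

noncomputable section

namespace FrobeniusManifold

open VectorField

variable {m : ℕ} {M : Type*} [TopologicalSpace M] [ChartedSpace (Fin m → ℂ) M]
  [IsManifold (CModel m) ω M] {F : FrobeniusManifold m M} {p : M}
  {e e' : Fin m → ∀ q : M, TangentSpace (CModel m) q}

theorem nabla_congr {X Y : ∀ q : M, TangentSpace (CModel m) q} (hX : HolFieldAt X p)
    (h : ∀ᶠ q in 𝓝 p, X q = Y q) : F.nabla X p = F.nabla Y p :=
  F.nabla.isCovariantDerivativeOn.congr_of_eventuallyEq hX.mdiff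
    (hX.congr (h.mono fun _ hq => hq.symm)).mdiff Filter.univ_mem h

theorem nabla_add {X Y : ∀ q : M, TangentSpace (CModel m) q} (hX : HolFieldAt X p)
    (hY : HolFieldAt Y p) :
    F.nabla (fun q => X q + Y q) p = F.nabla X p + F.nabla Y p :=
  F.nabla.isCovariantDerivativeOn.add hX.mdiff hY.mdiff

theorem nabla_zero : F.nabla (fun _ => 0) p = 0 :=
  F.nabla.isCovariantDerivativeOn.zero

theorem nabla_sum {ι : Type*} {s : Finset ι} {X : ι → ∀ q : M, TangentSpace (CModel m) q}
    (hX : ∀ i ∈ s, HolFieldAt (X i) p) :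
    F.nabla (fun q => ∑ i ∈ s, X i q) p = ∑ i ∈ s, F.nabla (X i) p := by
  classical
  induction s using Finset.induction_on with
  | empty => simpa using nabla_zero
  | insert a s ha ih =>
    simp only [Finset.sum_insert ha]
    rw [nabla_add (hX a (by simp)) (HolFieldAt.sum fun i hi => hX i (by simp [hi])),
      ih fun i hi => hX i (by simp [hi])]

theorem IsIdemFrame.eta₂_eq (he : F.IsIdemFrame p e) (i j : Fin m) :
    F.eta₂ e i j p = 2 * F.metric p (F.nabla (e j) p (e i p)) (e j p) := by
  have h := F.nabla_metric p _ _ _ (he.field_hol i) (he.field_hol j) (he.field_hol j)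
  rw [F.metric_symm p (e j p)] at h
  exact h.trans (two_mul _).symm

theorem IsIdemFrame.christoffel_antisymm (he : F.IsIdemFrame p e) (i : Fin m) {j k : Fin m}
    (hjk : j ≠ k) :
    F.metric p (F.nabla (e j) p (e i p)) (e k p)
      = - F.metric p (F.nabla (e k) p (e i p)) (e j p) := by
  have h := F.nabla_metric p _ _ _ (he.field_hol i) (he.field_hol j) (he.field_hol k)
  rw [F.metric_symm p (e j p), mvfderiv_congr_eventually (g := fun _ => 0),
    mvfderiv_const_apply] at h
  · exact eq_neg_of_add_eq_zero_left h.symm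
  · filter_upwards [he.idem] with q hq using hq.metric_ne hjk

/-- Potentiality for the triple (e_i, e_j, e_j), where e_j ∘ e_j = e_j and e_i ∘ e_j = 0. Pairing
this one identity with e_l, e_j and e_i yields the vanishing of the Christoffel terms with three
distinct indices, their symmetry, and η_ij = η_ji. -/
theorem IsIdemFrame.potentiality_idem (he : F.IsIdemFrame p e) {i j : Fin m} (hij : i ≠ j) :
    F.nabla (e j) p (e i p) - F.mul p (F.nabla (e j) p (e i p)) (e j p)
        - F.mul p (F.nabla (e j) p (e i p)) (e j p)
      = - F.mul p (F.nabla (e i) p (e j p)) (e j p)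
        - F.mul p (F.nabla (e j) p (e j p)) (e i p) := by
  have h := F.potentiality p _ _ _ (he.field_hol i) (he.field_hol j) (he.field_hol j)
  rw [nabla_congr (Y := e j), nabla_congr (X := fun q => F.mul q (e i q) (e j q))
    (Y := fun _ => 0), nabla_zero, F.mul_comm p (e j p), F.mul_comm p (e i p)] at h
  · rw [h]
    simp
  · exact F.mul_hol p _ _ (he.field_hol i) (he.field_hol j)
  · filter_upwards [he.idem] with q hq using hq.mul_ne hij
  · exact F.mul_hol p _ _ (he.field_hol j) (he.field_hol j)
  · filter_upwards [he.idem] with q hq using hq.mul_self j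

theorem IsIdemFrame.christoffel_eq_zero (he : F.IsIdemFrame p e) {i j l : Fin m} (hij : i ≠ j)
    (hil : i ≠ l) (hjl : j ≠ l) : F.metric p (F.nabla (e j) p (e i p)) (e l p) = 0 := by
  have h := congrArg (fun v => F.metric p v (e l p)) (he.potentiality_idem hij)
  simpa [he.self.metric_mul_ne _ hil, he.self.metric_mul_ne _ hjl] using h

theorem IsIdemFrame.christoffel_symm (he : F.IsIdemFrame p e) {i j : Fin m} (hij : i ≠ j) :
    F.metric p (F.nabla (e j) p (e i p)) (e j p)
      = F.metric p (F.nabla (e i) p (e j p)) (e j p) := by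
  have h := congrArg (fun v => F.metric p v (e j p)) (he.potentiality_idem hij)
  simp only [map_sub, map_neg, LinearMap.sub_apply, LinearMap.neg_apply,
    he.self.metric_mul_self, he.self.metric_mul_ne _ hij] at h
  linear_combination -h

theorem IsIdemFrame.eta₂_symm (he : F.IsIdemFrame p e) (i j : Fin m) :
    F.eta₂ e i j p = F.eta₂ e j i p := by
  rcases eq_or_ne i j with rfl | hij
  · rfl
  have h := congrArg (fun v => F.metric p v (e i p)) (he.potentiality_idem hij)
  simp only [map_sub, map_neg, LinearMap.sub_apply, LinearMap.neg_apply,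
    he.self.metric_mul_self, he.self.metric_mul_ne _ hij.symm, sub_zero, neg_zero, zero_sub] at h
  rw [he.eta₂_eq, he.eta₂_eq]
  linear_combination 2 * he.christoffel_symm hij + (-2) * he.christoffel_symm hij.symm
    + 2 * he.christoffel_antisymm j hij - 2 * h

/-- By the preceding symmetries only the components along e_i and e_j survive, and both are
determined by η_ij. -/
theorem IsIdemFrame.nabla_eq (he : F.IsIdemFrame p e) {i j : Fin m} (hij : i ≠ j) :
    F.nabla (e j) p (e i p) = (F.eta₂ e i j p / (2 * F.eta e i p)) • e i p
      + (F.eta₂ e i j p / (2 * F.eta e j p)) • e j p := by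
  apply he.self.ext
  intro l
  have hi := he.eta_ne_zero i
  have hj := he.eta_ne_zero j
  simp only [map_add, map_smul, LinearMap.add_apply, LinearMap.smul_apply, smul_eq_mul]
  by_cases hil : i = l
  · subst hil
    rw [he.self.metric_ne hij.symm, ← he.christoffel_symm hij.symm, he.eta₂_symm i j,
      he.eta₂_eq j i]
    unfold eta at *
    field_simp
    ring
  by_cases hjl : j = l
  · subst hjl
    rw [he.self.metric_ne hij, he.eta₂_eq i j]
    unfold eta at *
    field_simp
    ring
  rw [he.christoffel_eq_zero hij hil hjl, he.self.metric_ne hil, he.self.metric_ne hjl]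
  ring

/-- The formula for ∇_{e_i} e_j is symmetric in i and j, and ∇ is torsion free. -/
theorem IsIdemFrame.mlieBracket_eq_zero (he : F.IsIdemFrame p e) (i j : Fin m) :
    mlieBracket (CModel m) (e i) (e j) p = 0 := by
  rcases eq_or_ne i j with rfl | hij
  · simp
  rw [← F.nabla_torsion p _ _ (he.field_hol i) (he.field_hol j), he.nabla_eq hij,
    he.nabla_eq hij.symm, he.eta₂_symm i j, add_comm, sub_self]

theorem IsIdemFrame.deriv_comm (he : F.IsIdemFrame p e) {f : M → ℂ}
    (hf : HolFunctionAt (m := m) f p) (i j : Fin m) :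
    mvfderiv (CModel m) (fun q => mvfderiv (CModel m) f q (e j q)) p (e i p)
      = mvfderiv (CModel m) (fun q => mvfderiv (CModel m) f q (e i q)) p (e j p) := by
  have h := mvfderiv_mlieBracket hf (he.field_hol i) (he.field_hol j)
  rw [he.mlieBracket_eq_zero, map_zero] at h
  exact (sub_eq_zero.1 h.symm)

/-- The unit field is Σ e_j and is parallel; its derivative along e_i is paired with e_i. -/
theorem IsIdemFrame.sum_eta₂ (he : F.IsIdemFrame p e) (i : Fin m) :
    ∑ j, F.eta₂ e i j p = 0 := by
  have h1 : F.nabla (fun q => ∑ j, e j q) p = 0 := by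
    rw [nabla_congr (Y := F.unit), F.unit_flat]
    · exact HolFieldAt.sum fun j _ => he.field_hol j
    · filter_upwards [he.idem] with q hq using hq.sum_eq_unit
  rw [nabla_sum fun j _ => he.field_hol j] at h1
  have h2 := congrArg (fun L : TangentSpace (CModel m) p →L[ℂ] TangentSpace (CModel m) p =>
    F.metric p (L (e i p)) (e i p)) h1
  simp only [sum_apply, map_sum, LinearMap.sum_apply, zero_apply, map_zero,
    LinearMap.zero_apply] at h2
  calc ∑ j, F.eta₂ e i j p = 2 * ∑ j, F.metric p (F.nabla (e j) p (e i p)) (e i p) := by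
        rw [Finset.mul_sum]
        refine Finset.sum_congr rfl fun j _ => ?_
        rcases eq_or_ne i j with rfl | hij
        · exact he.eta₂_eq i i
        · rw [← he.christoffel_symm hij.symm, he.eta₂_symm, he.eta₂_eq]
    _ = 0 := by rw [h2, mul_zero]

/-- With X = [E, e_j], the condition Lie_E(∘) = ∘ on e_j ∘ e_j = e_j reads X - 2 X∘e_j = e_j. The
component of X along e_j is then -1, and all other components vanish. -/
theorem IsIdemFrame.mlieBracket_euler (he : F.IsIdemFrame p e) (j : Fin m) :
    mlieBracket (CModel m) F.euler (e j) p = - e j p := by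
  have hself := F.euler_mul p _ _ (he.field_hol j) (he.field_hol j)
  rw [mlieBracket_congr (Y' := e j) (Filter.Eventually.of_forall fun _ => rfl)
    (by filter_upwards [he.idem] with q hq using hq.mul_self j), he.self.mul_self,
    F.mul_comm p (e j p)] at hself
  apply he.self.ext
  intro l
  have h := congrArg (fun v => F.metric p v (e l p)) hself
  rcases eq_or_ne j l with rfl | hjl
  · simp only [map_sub, LinearMap.sub_apply, he.self.metric_mul_self] at h
    simp only [map_neg, LinearMap.neg_apply]
    linear_combination -h
  · simp only [map_sub, LinearMap.sub_apply, he.self.metric_mul_ne _ hjl, he.self.metric_ne hjl] at h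
    simp only [map_neg, LinearMap.neg_apply, he.self.metric_ne hjl]
    linear_combination h

/-- The eigenvalues of `E ∘`, which are the canonical coordinates. -/
def canonicalCoord (F : FrobeniusManifold m M) (e : Fin m → ∀ q : M, TangentSpace (CModel m) q)
    (i : Fin m) (q : M) : ℂ :=
  F.metric q (F.euler q) (e i q) / F.eta e i q

theorem IsIdemFrame.canonicalCoord_hol (he : F.IsIdemFrame p e) (i : Fin m) :
    HolFunctionAt (m := m) (F.canonicalCoord e i) p :=
  (he.metric_hol (F.euler_hol p) i).div (he.eta_hol i) (he.eta_ne_zero i)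

theorem IsIdemFrame.euler_eq (he : F.IsIdemFrame p e) :
    F.euler p = ∑ i, F.canonicalCoord e i p • e i p :=
  he.self.eq_sum _

/-- As E = Σ u_i e_i and the e_i commute, [E, e_j] = -Σ e_j(u_i) e_i. Comparison with -e_j shows
that the eigenvalues of E∘ are coordinates dual to the e_j. -/
theorem IsIdemFrame.mvfderiv_canonicalCoord (he : F.IsIdemFrame p e) (i j : Fin m) :
    mvfderiv (CModel m) (F.canonicalCoord e i) p (e j p) = if i = j then 1 else 0 := by
  have hbr : mlieBracket (CModel m) F.euler (e j) p
      = ∑ i, (- mvfderiv (CModel m) (F.canonicalCoord e i) p (e j p)) • e i p := by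
    apply tangent_ext
    intro f hf
    rw [mvfderiv_mlieBracket hf (F.euler_hol p) (he.field_hol j)]
    have h1 : ∀ᶠ q in 𝓝 p, mvfderiv (CModel m) f q (F.euler q)
        = ∑ i, F.canonicalCoord e i q * mvfderiv (CModel m) f q (e i q) := by
      filter_upwards [he.eventually] with q hq
      conv_lhs => rw [hq.euler_eq]
      simp
    rw [mvfderiv_congr_eventually h1, mvfderiv_sum_apply fun i _ =>
      (he.canonicalCoord_hol i).mul (hf.mvfderiv (he.field_hol i))]
    conv_lhs => rw [he.euler_eq]
    rw [map_sum, ← Finset.sum_sub_distrib, map_sum]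
    refine Finset.sum_congr rfl fun i _ => ?_
    rw [mvfderiv_mul_apply (he.canonicalCoord_hol i) (hf.mvfderiv (he.field_hol i)),
      map_smul, map_smul, he.deriv_comm hf]
    simp only [smul_eq_mul]
    ring
  rw [he.mlieBracket_euler] at hbr
  have h := congrArg (fun v => F.metric p v (e i p)) hbr
  simp only [he.self.metric_sum, map_neg, LinearMap.neg_apply] at h
  have hi : F.metric p (e i p) (e i p) ≠ 0 := he.eta_ne_zero i
  split_ifs with hij
  · subst hij
    apply mul_right_cancel₀ hi
    linear_combination h
  · rw [he.self.metric_ne (Ne.symm hij)] at h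
    apply mul_right_cancel₀ hi
    linear_combination h

theorem IsIdemFrame.isCanonicalAt (he : F.IsIdemFrame p e) :
    F.IsCanonicalAt p (F.canonicalCoord e) e where
  coord_hol := he.canonicalCoord_hol
  field_hol := he.field_hol
  dual := by filter_upwards [he.eventually] with q hq using hq.mvfderiv_canonicalCoord
  idempotent := by filter_upwards [he.idem] with q hq using hq.mul
  euler_eq := by filter_upwards [he.eventually] with q hq using hq.euler_eq

theorem IsCanonicalAt.isIdemFrame {u : Fin m → M → ℂ} (h : F.IsCanonicalAt p u e) :
    F.IsIdemFrame p e where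
  field_hol := h.field_hol
  idem := by
    filter_upwards [h.idempotent, h.dual] with q h1 h2
    refine ⟨h1, fun i h0 => ?_⟩
    have := h2 i i
    rw [h0, map_zero, if_pos rfl] at this
    exact zero_ne_one this

theorem IsCanonicalAt.coord_eq {u : Fin m → M → ℂ} (h : F.IsCanonicalAt p u e) :
    ∀ᶠ q in 𝓝 p, ∀ i, u i q = F.canonicalCoord e i q := by
  filter_upwards [h.euler_eq, h.isIdemFrame.idem] with q h1 h2 i
  unfold canonicalCoord
  rw [h1, h2.metric_sum]
  exact (mul_div_cancel_right₀ _ (h2.metric_self_ne_zero i)).symm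

/-- The form `d log τ_I` in terms of a frame of idempotents. -/
def idemTauForm (F : FrobeniusManifold m M) (e : Fin m → ∀ q : M, TangentSpace (CModel m) q)
    (q : M) : TangentSpace (CModel m) q →L[ℂ] ℂ :=
  F.tauForm (F.canonicalCoord e) e q

theorem tauForm_congr {u u' : Fin m → M → ℂ} (hu : ∀ᶠ q in 𝓝 p, ∀ i, u i q = u' i q)
    (he : ∀ᶠ q in 𝓝 p, ∀ i, e i q = e' i q) : F.tauForm u e p = F.tauForm u' e' p := by
  have h1 : ∀ i, ∀ᶠ q in 𝓝 p, F.eta e i q = F.eta e' i q := fun i => by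
    filter_upwards [he] with q hq
    simp only [eta, hq]
  have h2 : ∀ i j, F.eta₂ e i j p = F.eta₂ e' i j p := fun i j => by
    unfold eta₂
    rw [mvfderiv_congr_eventually (h1 j), he.self_of_nhds]
  unfold tauForm
  congr 1
  refine Finset.sum_congr rfl fun i _ => Finset.sum_congr rfl fun j _ => ?_
  rw [h2, (h1 i).self_of_nhds, (h1 j).self_of_nhds, hu.self_of_nhds, hu.self_of_nhds,
    mvfderiv_congr_eventually (hu.mono fun q hq => hq i)]

theorem tauForm_perm (u : Fin m → M → ℂ) (e : Fin m → ∀ q : M, TangentSpace (CModel m) q)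
    (σ : Equiv.Perm (Fin m)) (q : M) :
    F.tauForm (fun i => u (σ i)) (fun i => e (σ i)) q = F.tauForm u e q := by
  unfold tauForm
  congr 1
  refine Fintype.sum_equiv σ _ _ fun i => ?_
  refine Finset.sum_equiv σ (fun j => ?_) fun j _ => rfl
  simp

/-- Two idempotent frames differ by a renumbering near p, under which the double sum is invariant.
Hence the choice in `dLogTau` is harmless. -/
theorem IsIdemFrame.idemTauForm_eq (he : F.IsIdemFrame p e) (he' : F.IsIdemFrame p e') :
    F.idemTauForm e' p = F.idemTauForm e p := by
  obtain ⟨σ, hσ⟩ := he.exists_perm he'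
  unfold idemTauForm
  rw [← tauForm_perm _ e σ]
  refine tauForm_congr ?_ hσ
  filter_upwards [hσ] with q hq i
  simp only [canonicalCoord, eta, hq]

theorem IsIdemFrame.dLogTau_eq (he : F.IsIdemFrame p e) : F.dLogTau p = F.idemTauForm e p := by
  have hex : ∃ ue : (Fin m → M → ℂ) × (Fin m → ∀ r : M, TangentSpace (CModel m) r),
      F.IsCanonicalAt p ue.1 ue.2 := ⟨(_, e), he.isCanonicalAt⟩
  unfold dLogTau
  rw [dif_pos hex]
  have hc := hex.choose_spec
  rw [tauForm_congr hc.coord_eq (Filter.Eventually.of_forall fun _ _ => rfl)]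
  exact he.idemTauForm_eq hc.isIdemFrame

/-- The coefficients `H_i` of `d log τ_I = ∑ H_i du_i`. -/
def tauCoeff (F : FrobeniusManifold m M) (e : Fin m → ∀ q : M, TangentSpace (CModel m) q)
    (i : Fin m) (q : M) : ℂ :=
  1 / 8 * ∑ j ∈ Finset.univ.erase i, (F.canonicalCoord e i q - F.canonicalCoord e j q) *
    (F.eta₂ e i j q ^ 2 / (F.eta e i q * F.eta e j q))

theorem IsIdemFrame.dLogTau_apply (he : F.IsIdemFrame p e) (k : Fin m) :
    F.dLogTau p (e k p) = F.tauCoeff e k p := by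
  rw [he.dLogTau_eq]
  unfold idemTauForm tauForm tauCoeff
  simp only [smul_apply, sum_apply, smul_eq_mul,
    he.mvfderiv_canonicalCoord]
  congr 1
  rw [Finset.sum_eq_single k]
  · simp
  · intro i _ hik
    simp [hik]
  · simp

theorem IsIdemFrame.tauCoeff_hol (he : F.IsIdemFrame p e) (k : Fin m) :
    HolFunctionAt (m := m) (F.tauCoeff e k) p := by
  refine (HolFunctionAt.const _ p).mul (HolFunctionAt.sum fun j _ => ?_)
  exact ((he.canonicalCoord_hol k).sub (he.canonicalCoord_hol j)).mul
    (((he.eta₂_hol k j).pow 2).div ((he.eta_hol k).mul (he.eta_hol j))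
      (mul_ne_zero (he.eta_ne_zero k) (he.eta_ne_zero j)))

theorem IsIdemFrame.holFormAt_dLogTau (he : F.IsIdemFrame p e) : HolFormAt F.dLogTau p := by
  rw [he.holFormAt_iff]
  intro i
  refine (he.tauCoeff_hol i).congr ?_
  filter_upwards [he.eventually] with q hq using hq.dLogTau_apply i

end FrobeniusManifold
end

/-! ### The Darboux-Egoroff equations and closedness of d log τ_I. -/

noncomputable section

namespace FrobeniusManifold

open VectorField

variable {m : ℕ} {M : Type*} [TopologicalSpace M] [ChartedSpace (Fin m → ℂ) M]
  [IsManifold (CModel m) ω M] {F : FrobeniusManifold m M} {p : M}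
  {e e' : Fin m → ∀ q : M, TangentSpace (CModel m) q}
  {φ : OpenPartialHomeomorph M (Fin m → ℂ)}

/-- The coordinate fields of flat coordinates are parallel. -/
theorem nabla_flat_chartField (hφ : IsFlatChart F.metric φ) (hp : p ∈ φ.source) (b : Fin m) :
    F.nabla (chartField φ b) p = 0 := by
  obtain ⟨hmax, B, hB⟩ := hφ
  have hol := holFieldAt_chartField hmax hp
  set N : Fin m → Fin m → Fin m → ℂ := fun a b c =>
    F.metric p (F.nabla (chartField φ b) p (chartField φ a p)) (chartField φ c p) with hN
  have hanti : ∀ a b c, N a b c = - N a c b := by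
    intro a b c
    have h := F.nabla_metric p _ _ _ (hol a) (hol b) (hol c)
    rw [F.metric_symm p (chartField φ b p), mvfderiv_congr_eventually
      (g := fun _ => B (Pi.single b 1) (Pi.single c 1)), mvfderiv_const_apply] at h
    · exact eq_neg_of_add_eq_zero_left h.symm
    · filter_upwards [φ.open_source.mem_nhds hp] with q hq
      rw [hB q hq, mvfderiv_chartField hmax hq, mvfderiv_chartField hmax hq]
  have hsymm : ∀ a b c, N a b c = N b a c := by
    intro a b c
    have h := F.nabla_torsion p _ _ (hol a) (hol b)
    rw [mlieBracket_chartField hmax hp] at h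
    simp only [hN, sub_eq_zero.1 h]
  -- An array N a b c which is symmetric in a, b and antisymmetric in b, c vanishes, as in the
  -- uniqueness of the Levi-Civita connection.
  have hzero : ∀ a c, N a b c = 0 := by
    intro a c
    linear_combination (1 / 2 : ℂ) * (hanti a b c - hsymm a c b - hanti c a b + hsymm c b a
      + hanti b c a - hsymm b a c)
  have hvec : ∀ a, F.nabla (chartField φ b) p (chartField φ a p) = 0 := by
    intro a
    apply F.metric_nondeg p
    intro w
    rw [eq_sum_chartField hmax hp w, map_sum]
    refine Finset.sum_eq_zero fun c _ => ?_
    rw [map_smul]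
    have := hzero a c
    simp only [hN] at this
    rw [this, smul_zero]
  ext1 v
  rw [eq_sum_chartField hmax hp v, map_sum]
  simp only [map_smul, hvec, smul_zero, Finset.sum_const_zero]
  rfl

theorem IsIdemFrame.deriv_metric_flat (he : F.IsIdemFrame p e) (hφ : IsFlatChart F.metric φ)
    (hp : p ∈ φ.source) (a : Fin m) {i j : Fin m} (hij : i ≠ j) :
    mvfderiv (CModel m) (fun q => F.metric q (chartField φ a q) (e j q)) p (e i p)
      = F.eta₂ e i j p / (2 * F.eta e i p) * F.metric p (chartField φ a p) (e i p)
        + F.eta₂ e i j p / (2 * F.eta e j p) * F.metric p (chartField φ a p) (e j p) := by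
  have h := F.nabla_metric p _ _ _ (he.field_hol i) (holFieldAt_chartField hφ.1 hp a)
    (he.field_hol j)
  rw [nabla_flat_chartField hφ hp, he.nabla_eq hij] at h
  rw [h]
  simp

/-- The Darboux-Egoroff equations in terms of the functions `η_ij`. -/
theorem IsIdemFrame.deriv_eta₂ (he : F.IsIdemFrame p e) {i j k : Fin m} (hij : i ≠ j)
    (hik : i ≠ k) (hjk : j ≠ k) :
    mvfderiv (CModel m) (F.eta₂ e i j) p (e k p)
      = 1 / 2 * (F.eta₂ e i j p * F.eta₂ e i k p / F.eta e i p
        + F.eta₂ e i j p * F.eta₂ e j k p / F.eta e j p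
        + F.eta₂ e i k p * F.eta₂ e j k p / F.eta e k p) := by
  obtain ⟨φ, hp, hφ⟩ := F.metric_flat p
  have hi := he.eta_ne_zero i
  have hj := he.eta_ne_zero j
  have hk := he.eta_ne_zero k
  set A : Fin m → Fin m → M → ℂ := fun i j q => F.eta₂ e i j q / (2 * F.eta e i q) with hA
  have hAhol : ∀ i j, HolFunctionAt (m := m) (A i j) p := fun i j =>
    (he.eta₂_hol i j).div ((HolFunctionAt.const 2 p).mul (he.eta_hol i))
      (mul_ne_zero two_ne_zero (he.eta_ne_zero i))
  -- For parallel fields ∂_a the functions w_aj = g(∂_a, e_j) satisfy a linear first order system.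
  -- Its compatibility e_k e_i w_aj = e_i e_k w_aj says that the vector C e_i + C' e_j + C'' e_k is
  -- orthogonal to every ∂_a. So it is zero, and C = 0 is the claim.
  set w : Fin m → Fin m → M → ℂ := fun a j q => F.metric q (chartField φ a q) (e j q) with hw
  have hwhol : ∀ a j, HolFunctionAt (m := m) (w a j) p := fun a j =>
    he.metric_hol (holFieldAt_chartField hφ.1 hp a) j
  have hdw : ∀ a, ∀ᶠ q in 𝓝 p, ∀ i j, i ≠ j →
      mvfderiv (CModel m) (w a j) q (e i q) = A i j q * w a i q + A j i q * w a j q := by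
    intro a
    filter_upwards [he.eventually, φ.open_source.mem_nhds hp] with q hq hqs i j hij
    rw [hq.deriv_metric_flat hφ hqs a hij]
    simp only [hA, hw, hq.eta₂_symm j i]
  have hdd : ∀ a, ∀ i j k : Fin m, i ≠ j → k ≠ i → k ≠ j →
      mvfderiv (CModel m) (fun q => mvfderiv (CModel m) (w a j) q (e i q)) p (e k p)
        = mvfderiv (CModel m) (A i j) p (e k p) * w a i p
          + A i j p * (A k i p * w a k p + A i k p * w a i p)
          + mvfderiv (CModel m) (A j i) p (e k p) * w a j p
          + A j i p * (A k j p * w a k p + A j k p * w a j p) := by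
    intro a i j k hij hki hkj
    rw [mvfderiv_congr_eventually ((hdw a).mono fun q hq => hq i j hij),
      mvfderiv_add_apply ((hAhol i j).mul (hwhol a i)) ((hAhol j i).mul (hwhol a j)),
      mvfderiv_mul_apply (hAhol i j) (hwhol a i), mvfderiv_mul_apply (hAhol j i) (hwhol a j),
      (hdw a).self_of_nhds k i hki, (hdw a).self_of_nhds k j hkj]
    ring
  set C : ℂ := mvfderiv (CModel m) (A i j) p (e k p) + A i j p * A i k p - A k j p * A i k p
    - A j k p * A i j p with hC
  set C' : ℂ := mvfderiv (CModel m) (A j i) p (e k p) + A j i p * A j k p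
    - mvfderiv (CModel m) (A j k) p (e i p) - A j k p * A j i p with hC'
  set C'' : ℂ := A i j p * A k i p + A j i p * A k j p
    - mvfderiv (CModel m) (A k j) p (e i p) - A k j p * A k i p with hC''
  have hlin : ∀ a, C * w a i p + C' * w a j p + C'' * w a k p = 0 := by
    intro a
    have h1 := hdd a i j k hij hik.symm hjk.symm
    have h2 := hdd a k j i hjk.symm hik hij
    have h3 := he.deriv_comm (hwhol a j) k i
    rw [h1, h2] at h3
    simp only [hC, hC', hC'']
    linear_combination h3
  have hvec : C • e i p + C' • e j p + C'' • e k p = 0 := by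
    apply F.metric_nondeg p
    intro v
    rw [eq_sum_chartField hφ.1 hp v, map_sum]
    refine Finset.sum_eq_zero fun a _ => ?_
    rw [map_smul, F.metric_symm]
    have := hlin a
    simp only [hw] at this
    simp only [map_add, map_smul, smul_eq_mul]
    rw [this, mul_zero]
  have hC0 : C = 0 := by
    have h := congrArg (fun v => F.metric p v (e i p)) hvec
    simp only [map_add, map_smul, LinearMap.add_apply, LinearMap.smul_apply, smul_eq_mul,
      he.self.metric_ne hij.symm, he.self.metric_ne hik.symm, map_zero, LinearMap.zero_apply,
      mul_zero, add_zero] at h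
    exact (mul_eq_zero.1 h).resolve_right hi
  have hdA : mvfderiv (CModel m) (A i j) p (e k p)
      = (2 * F.eta e i p * mvfderiv (CModel m) (F.eta₂ e i j) p (e k p)
        - F.eta₂ e i j p * (2 * F.eta₂ e i k p)) / (2 * F.eta e i p) ^ 2 := by
    simp only [hA]
    rw [mvfderiv_div_apply (he.eta₂_hol i j) ((HolFunctionAt.const 2 p).mul (he.eta_hol i))
      (mul_ne_zero two_ne_zero hi), mvfderiv_const_mul_apply _ (he.eta_hol i), he.eta₂_symm i k]
    rfl
  rw [hC, hdA] at hC0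
  simp only [hA, he.eta₂_symm k j] at hC0
  field_simp at hC0 ⊢
  linear_combination hC0

theorem IsIdemFrame.mvfderiv_eta_unit (he : F.IsIdemFrame p e) (i : Fin m) :
    mvfderiv (CModel m) (F.eta e i) p (F.unit p) = 0 := by
  rw [← he.self.sum_eq_unit, map_sum, ← he.sum_eta₂ i]
  exact Finset.sum_congr rfl fun j _ => he.eta₂_symm j i

/-- Differentiate Σ_l η_lj = 0 along e_i and commute the derivatives. -/
theorem IsIdemFrame.mvfderiv_eta₂_unit (he : F.IsIdemFrame p e) (i j : Fin m) :
    mvfderiv (CModel m) (F.eta₂ e i j) p (F.unit p) = 0 := by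
  have h1 : mvfderiv (CModel m) (fun q => ∑ l, F.eta₂ e l j q) p (e i p) = 0 := by
    rw [mvfderiv_congr_eventually (g := fun _ => 0), mvfderiv_const_apply]
    filter_upwards [he.eventually] with q hq
    rw [← hq.sum_eta₂ j]
    exact Finset.sum_congr rfl fun l _ => hq.eta₂_symm l j
  rw [mvfderiv_sum_apply fun l _ => he.eta₂_hol l j] at h1
  rw [← he.self.sum_eq_unit, map_sum, ← h1]
  exact Finset.sum_congr rfl fun l _ => he.deriv_comm (he.eta_hol j) l i

/-- `η_ij² / (η_i η_j)` -/
def etaQuot (F : FrobeniusManifold m M) (e : Fin m → ∀ q : M, TangentSpace (CModel m) q)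
    (i j : Fin m) (q : M) : ℂ :=
  F.eta₂ e i j q ^ 2 / (F.eta e i q * F.eta e j q)

theorem IsIdemFrame.etaQuot_hol (he : F.IsIdemFrame p e) (i j : Fin m) :
    HolFunctionAt (m := m) (F.etaQuot e i j) p :=
  ((he.eta₂_hol i j).pow 2).div ((he.eta_hol i).mul (he.eta_hol j))
    (mul_ne_zero (he.eta_ne_zero i) (he.eta_ne_zero j))

theorem IsIdemFrame.etaQuot_symm (he : F.IsIdemFrame p e) (i j : Fin m) :
    F.etaQuot e i j p = F.etaQuot e j i p := by
  unfold etaQuot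
  rw [he.eta₂_symm, _root_.mul_comm]

theorem IsIdemFrame.mvfderiv_etaQuot (he : F.IsIdemFrame p e) (i j : Fin m)
    (v : TangentSpace (CModel m) p) :
    mvfderiv (CModel m) (F.etaQuot e i j) p v
      = (F.eta e i p * F.eta e j p * (2 * F.eta₂ e i j p * mvfderiv (CModel m) (F.eta₂ e i j) p v)
        - F.eta₂ e i j p ^ 2 * (F.eta e i p * mvfderiv (CModel m) (F.eta e j) p v
          + F.eta e j p * mvfderiv (CModel m) (F.eta e i) p v))
        / (F.eta e i p * F.eta e j p) ^ 2 := by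
  unfold etaQuot
  rw [mvfderiv_div_apply ((he.eta₂_hol i j).pow 2) ((he.eta_hol i).mul (he.eta_hol j))
    (mul_ne_zero (he.eta_ne_zero i) (he.eta_ne_zero j)), mvfderiv_pow_apply (he.eta₂_hol i j),
    mvfderiv_mul_apply (he.eta_hol i) (he.eta_hol j)]
  simp

/-- The right hand side is symmetric in i, j, k. This symmetry is how the Darboux-Egoroff equations
enter the closedness of d log τ_I. -/
theorem IsIdemFrame.deriv_etaQuot (he : F.IsIdemFrame p e) {i j k : Fin m} (hij : i ≠ j)
    (hik : i ≠ k) (hjk : j ≠ k) :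
    mvfderiv (CModel m) (F.etaQuot e i j) p (e k p)
      = F.eta₂ e i j p * F.eta₂ e i k p * F.eta₂ e j k p
        / (F.eta e i p * F.eta e j p * F.eta e k p) := by
  have hi := he.eta_ne_zero i
  have hj := he.eta_ne_zero j
  have hk := he.eta_ne_zero k
  rw [he.mvfderiv_etaQuot, he.deriv_eta₂ hij hik hjk,
    show mvfderiv (CModel m) (F.eta e j) p (e k p) = F.eta₂ e j k p from he.eta₂_symm k j,
    show mvfderiv (CModel m) (F.eta e i) p (e k p) = F.eta₂ e i k p from he.eta₂_symm k i]
  field_simp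
  ring

theorem IsIdemFrame.mvfderiv_etaQuot_unit (he : F.IsIdemFrame p e) (i j : Fin m) :
    mvfderiv (CModel m) (F.etaQuot e i j) p (F.unit p) = 0 := by
  rw [he.mvfderiv_etaQuot, he.mvfderiv_eta₂_unit, he.mvfderiv_eta_unit, he.mvfderiv_eta_unit]
  simp

/-- In e_k H_i - e_i H_k a third index j contributes (u_i - u_j) - (u_k - u_j) = u_i - u_k times the
common derivative of `etaQuot`. Together with the terms for j = i, k the difference is (u_i - u_k)/8
times the derivative of η_ik²/(η_i η_k) along the unit field, which vanishes. -/
theorem IsIdemFrame.tauCoeff_closed (he : F.IsIdemFrame p e) (i k : Fin m) :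
    mvfderiv (CModel m) (F.tauCoeff e i) p (e k p)
      = mvfderiv (CModel m) (F.tauCoeff e k) p (e i p) := by
  rcases eq_or_ne i k with rfl | hik
  · rfl
  have hu := he.canonicalCoord_hol
  have hQ := he.etaQuot_hol
  have hd : ∀ i k : Fin m, i ≠ k → mvfderiv (CModel m) (F.tauCoeff e i) p (e k p)
      = 1 / 8 * (-F.etaQuot e i k p + (F.canonicalCoord e i p - F.canonicalCoord e k p)
          * mvfderiv (CModel m) (F.etaQuot e i k) p (e k p)
        + ∑ j ∈ (Finset.univ.erase i).erase k, (F.canonicalCoord e i p - F.canonicalCoord e j p)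
          * mvfderiv (CModel m) (F.etaQuot e i j) p (e k p)) := by
    intro i k hik
    change mvfderiv (CModel m) (fun q => 1 / 8 * ∑ j ∈ Finset.univ.erase i,
      (F.canonicalCoord e i q - F.canonicalCoord e j q) * F.etaQuot e i j q) p (e k p) = _
    rw [mvfderiv_const_mul_apply _ (HolFunctionAt.sum fun j _ => ((hu i).sub (hu j)).mul (hQ i j)),
      mvfderiv_sum_apply fun j _ => ((hu i).sub (hu j)).mul (hQ i j),
      ← Finset.add_sum_erase _ _ (Finset.mem_erase.2 ⟨hik.symm, Finset.mem_univ k⟩)]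
    congr 2
    · rw [mvfderiv_mul_apply ((hu i).sub (hu k)) (hQ i k), mvfderiv_sub_apply (hu i) (hu k),
        he.mvfderiv_canonicalCoord, he.mvfderiv_canonicalCoord, if_neg hik, if_pos rfl]
      ring
    · refine Finset.sum_congr rfl fun j hj => ?_
      have hjk : j ≠ k := (Finset.mem_erase.1 hj).1
      rw [mvfderiv_mul_apply ((hu i).sub (hu j)) (hQ i j), mvfderiv_sub_apply (hu i) (hu j),
        he.mvfderiv_canonicalCoord, he.mvfderiv_canonicalCoord, if_neg hik, if_neg hjk]
      ring
  have hki : mvfderiv (CModel m) (F.etaQuot e k i) p = mvfderiv (CModel m) (F.etaQuot e i k) p := by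
    apply mvfderiv_congr_eventually
    filter_upwards [he.eventually] with q hq using hq.etaQuot_symm k i
  rw [hd i k hik, hd k i hik.symm, he.etaQuot_symm k i, hki, Finset.erase_right_comm]
  have hunit := he.mvfderiv_etaQuot_unit i k
  rw [← he.self.sum_eq_unit, map_sum, ← Finset.add_sum_erase _ _ (Finset.mem_univ k),
    ← Finset.add_sum_erase _ _ (Finset.mem_erase.2 ⟨hik, Finset.mem_univ i⟩)] at hunit
  have hsum : ∑ j ∈ (Finset.univ.erase k).erase i,
      ((F.canonicalCoord e i p - F.canonicalCoord e j p)
          * mvfderiv (CModel m) (F.etaQuot e i j) p (e k p)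
        - (F.canonicalCoord e k p - F.canonicalCoord e j p)
          * mvfderiv (CModel m) (F.etaQuot e k j) p (e i p)
        - (F.canonicalCoord e i p - F.canonicalCoord e k p)
          * mvfderiv (CModel m) (F.etaQuot e i k) p (e j p)) = 0 := by
    refine Finset.sum_eq_zero fun j hj => ?_
    have hji : j ≠ i := (Finset.mem_erase.1 hj).1
    have hjk : j ≠ k := (Finset.mem_erase.1 (Finset.mem_erase.1 hj).2).1
    rw [he.deriv_etaQuot hji.symm hik hjk, he.deriv_etaQuot hjk.symm hik.symm hji,
      he.deriv_etaQuot hik hji.symm hjk.symm, he.eta₂_symm k j, he.eta₂_symm k i,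
      he.eta₂_symm j i]
    ring
  rw [Finset.sum_sub_distrib, Finset.sum_sub_distrib, ← Finset.mul_sum] at hsum
  linear_combination (1 / 8 : ℂ) * hsum
    + (1 / 8 : ℂ) * (F.canonicalCoord e i p - F.canonicalCoord e k p) * hunit

/-- The form `d log τ_I` is closed. -/
theorem IsIdemFrame.formExtDeriv_dLogTau (he : F.IsIdemFrame p e)
    {X Y : ∀ q : M, TangentSpace (CModel m) q} (hX : HolFieldAt X p) (hY : HolFieldAt Y p) :
    formExtDeriv F.dLogTau X Y p = 0 := by
  have hu := he.canonicalCoord_hol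
  have hH := he.tauCoeff_hol
  set u := F.canonicalCoord e
  set H := F.tauCoeff e
  have hvec : ∀ {q : M}, F.IsIdemFrame q e → ∀ v : TangentSpace (CModel m) q,
      v = ∑ i, mvfderiv (CModel m) (u i) q v • e i q := by
    intro q hq v
    obtain ⟨c, hc⟩ := hq.self.exists_eq_sum v
    have : ∀ i, mvfderiv (CModel m) (u i) q v = c i := by
      intro i
      rw [hc, map_sum]
      simp only [map_smul, u, hq.mvfderiv_canonicalCoord, smul_eq_mul, mul_ite, mul_one, mul_zero]
      simp
    simp only [this]
    exact hc
  have hα : ∀ {q : M}, F.IsIdemFrame q e → ∀ v : TangentSpace (CModel m) q,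
      F.dLogTau q v = ∑ i, H i q * mvfderiv (CModel m) (u i) q v := by
    intro q hq v
    conv_lhs => rw [hvec hq v, map_sum]
    simp only [map_smul, hq.dLogTau_apply, smul_eq_mul, H, _root_.mul_comm]
  have hderiv : ∀ {Z : ∀ q : M, TangentSpace (CModel m) q}, HolFieldAt Z p → ∀ v,
      mvfderiv (CModel m) (fun q => F.dLogTau q (Z q)) p v
        = ∑ i, (H i p * mvfderiv (CModel m) (fun q => mvfderiv (CModel m) (u i) q (Z q)) p v
          + mvfderiv (CModel m) (u i) p (Z p) * mvfderiv (CModel m) (H i) p v) := by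
    intro Z hZ v
    rw [mvfderiv_congr_eventually (he.eventually.mono fun q hq => hα hq (Z q)),
      mvfderiv_sum_apply fun i _ => (hH i).mul ((hu i).mvfderiv hZ)]
    exact Finset.sum_congr rfl fun i _ => mvfderiv_mul_apply (hH i) ((hu i).mvfderiv hZ)
  unfold formExtDeriv
  rw [hderiv hY, hderiv hX, hα he]
  simp only [mvfderiv_mlieBracket (hu _) hX hY]
  rw [← Finset.sum_sub_distrib, ← Finset.sum_sub_distrib]
  have hexp : ∀ i, ∀ v, mvfderiv (CModel m) (H i) p v
      = ∑ k, mvfderiv (CModel m) (u k) p v * mvfderiv (CModel m) (H i) p (e k p) := by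
    intro i v
    conv_lhs => rw [hvec he v, map_sum]
    simp only [map_smul, smul_eq_mul]
  calc _ = ∑ i, ∑ k, (mvfderiv (CModel m) (u i) p (Y p) * mvfderiv (CModel m) (u k) p (X p)
            * mvfderiv (CModel m) (H i) p (e k p))
        - ∑ i, ∑ k, (mvfderiv (CModel m) (u i) p (X p) * mvfderiv (CModel m) (u k) p (Y p)
            * mvfderiv (CModel m) (H i) p (e k p)) := by
        rw [← Finset.sum_sub_distrib]
        refine Finset.sum_congr rfl fun i _ => ?_
        rw [hexp i (X p), hexp i (Y p), Finset.mul_sum, Finset.mul_sum]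
        simp only [← _root_.mul_assoc]
        ring
    _ = 0 := by
        rw [sub_eq_zero, Finset.sum_comm]
        refine Finset.sum_congr rfl fun i _ => Finset.sum_congr rfl fun k _ => ?_
        rw [he.tauCoeff_closed k i]
        ring

end FrobeniusManifold
end

/-! ### The differential of the G-function. -/

noncomputable section

namespace FrobeniusManifold

open VectorField

variable {m : ℕ} {M : Type*} [TopologicalSpace M] [ChartedSpace (Fin m → ℂ) M]
  [IsManifold (CModel m) ω M] {F : FrobeniusManifold m M} {p : M}
  {e e' : Fin m → ∀ q : M, TangentSpace (CModel m) q}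
  {φ : OpenPartialHomeomorph M (Fin m → ℂ)} {G : M → ℂ}

open Classical in
/-- The product `∏ η_i` over the idempotents of `T_q M`. -/
def vol (F : FrobeniusManifold m M) (q : M) : ℂ :=
  if h : ∃ b, F.IsIdemBasis q b then ∏ i, F.metric q (h.choose i) (h.choose i) else 0

theorem IsIdemBasis.vol_eq {q : M} {b : Fin m → TangentSpace (CModel m) q}
    (hb : F.IsIdemBasis q b) : F.vol q = ∏ i, F.metric q (b i) (b i) := by
  have h : ∃ b, F.IsIdemBasis q b := ⟨b, hb⟩
  unfold vol
  rw [dif_pos h]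
  obtain ⟨σ, hσ⟩ := hb.exists_perm h.choose_spec
  exact Fintype.prod_equiv σ _ _ fun i => by rw [hσ]

theorem IsIdemFrame.vol_ne_zero (he : F.IsIdemFrame p e) : F.vol p ≠ 0 := by
  rw [he.self.vol_eq]
  exact Finset.prod_ne_zero_iff.2 fun i _ => he.eta_ne_zero i

theorem IsIdemFrame.vol_hol (he : F.IsIdemFrame p e) : HolFunctionAt (m := m) F.vol p := by
  refine (HolFunctionAt.prod (s := Finset.univ) fun i _ => he.eta_hol i).congr ?_
  filter_upwards [he.idem] with q hq using hq.vol_eq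

/-- The differential of the G-function. -/
def gForm (F : FrobeniusManifold m M) (q : M) : TangentSpace (CModel m) q →L[ℂ] ℂ :=
  F.dLogTau q - (1 / 48 * (F.vol q)⁻¹) • mvfderiv (CModel m) F.vol q

theorem IsIdemFrame.gForm_hol (he : F.IsIdemFrame p e) : HolFormAt F.gForm p := by
  intro X hX
  exact (he.holFormAt_dLogTau X hX).sub (((HolFunctionAt.const _ p).mul
    (he.vol_hol.inv he.vol_ne_zero)).mul (he.vol_hol.mvfderiv hX))

/-- The determinant `J` of the base change between flat and canonical coordinates. -/
def jacobian (φ : OpenPartialHomeomorph M (Fin m → ℂ))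
    (e : Fin m → ∀ q : M, TangentSpace (CModel m) q) (q : M) : ℂ :=
  Matrix.det (Matrix.of fun i j => mvfderiv (CModel m) φ q (e j q) i)

theorem HolFunctionAt.det {k : ℕ} {A : M → Matrix (Fin k) (Fin k) ℂ}
    (hA : ∀ i j, HolFunctionAt (m := m) (fun q => A q i j) p) :
    HolFunctionAt (m := m) (fun q => (A q).det) p := by
  simp only [Matrix.det_apply']
  exact HolFunctionAt.sum fun σ _ =>
    (HolFunctionAt.const _ p).mul (HolFunctionAt.prod fun i _ => hA _ _)

/-- For the Jacobian matrix A and the constant Gram matrix B of g in flat coordinates, AᵀBA is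
diagonal with entries η_i; take determinants. Hence d log J is half of d log ∏ η_i, which turns 1/24
into 1/48. -/
theorem IsIdemFrame.exists_vol_eq (he : F.IsIdemFrame p e) (hφ : IsFlatChart F.metric φ)
    (hp : p ∈ φ.source) :
    HolFunctionAt (m := m) (jacobian φ e) p ∧ jacobian φ e p ≠ 0 ∧
      ∃ d : ℂ, ∀ᶠ q in 𝓝 p, F.vol q = d * jacobian φ e q ^ 2 := by
  obtain ⟨hmax, B, hB⟩ := hφ
  set Bm : Matrix (Fin m) (Fin m) ℂ := LinearMap.toMatrix₂' ℂ B with hBm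
  have hvol : ∀ᶠ q in 𝓝 p, F.vol q = Bm.det * jacobian φ e q ^ 2 := by
    filter_upwards [he.idem, φ.open_source.mem_nhds hp] with q hq hqs
    set J : Matrix (Fin m) (Fin m) ℂ := Matrix.of fun i j => mvfderiv (CModel m) φ q (e j q) i
    have hmat : J.transpose * Bm * J = Matrix.diagonal fun i => F.metric q (e i q) (e i q) := by
      ext i j
      have h1 : (J.transpose * Bm * J) i j
          = B (mvfderiv (CModel m) φ q (e i q)) (mvfderiv (CModel m) φ q (e j q)) := by
        have h2 : B = Matrix.toLinearMap₂' ℂ Bm := by simp [hBm]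
        rw [h2, Matrix.toLinearMap₂'_apply', Matrix.mul_assoc, Matrix.mul_apply, dotProduct]
        rfl
      rw [h1, ← hB q hqs, Matrix.diagonal_apply]
      split_ifs with hij
      · rw [hij]
      · exact hq.metric_ne hij
    have hdet := congrArg Matrix.det hmat
    rw [Matrix.det_mul, Matrix.det_mul, Matrix.det_transpose, Matrix.det_diagonal] at hdet
    rw [hq.vol_eq, ← hdet]
    change J.det * Bm.det * J.det = Bm.det * J.det ^ 2
    ring
  refine ⟨HolFunctionAt.det fun i j => (he.field_hol j).coeff hmax hp i, fun h0 => ?_, _, hvol⟩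
  have := hvol.self_of_nhds
  rw [h0] at this
  exact he.vol_ne_zero (by simpa using this)

/-- Near a semisimple point, the G-functions are the primitives of the form `F.gForm`. -/
theorem isGFunctionAt_iff (hp : p ∉ F.caustic) (hG : HolFunctionAt (m := m) G p) :
    F.IsGFunctionAt G p ↔ ∀ᶠ q in 𝓝 p, mvfderiv (CModel m) G q = F.gForm q := by
  have key : ∀ {e : Fin m → ∀ q : M, TangentSpace (CModel m) q}
      {φ : OpenPartialHomeomorph M (Fin m → ℂ)} {logJ : M → ℂ}, F.IsIdemFrame p e →
      IsFlatChart F.metric φ → p ∈ φ.source → HolFunctionAt (m := m) logJ p →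
      (∀ᶠ q in 𝓝 p, Complex.exp (logJ q) = jacobian φ e q) →
      ∀ᶠ q in 𝓝 p, ∀ v, (F.vol q)⁻¹ * mvfderiv (CModel m) F.vol q v
        = 2 * mvfderiv (CModel m) logJ q v := by
    intro e φ logJ he hφ hps hJ hexp
    obtain ⟨-, -, d, hd⟩ := he.exists_vol_eq hφ hps
    filter_upwards [hexp.eventually_nhds, hd.eventually_nhds, he.eventually, hJ.eventually]
      with q h1 h2 h3 h4 v
    have h5 : ∀ᶠ r in 𝓝 q, F.vol r = d * Complex.exp (2 * logJ r) := by
      filter_upwards [h1, h2] with r h1 h2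
      rw [h2, ← h1, ← Complex.exp_nat_mul]
      norm_num
    have h6 : HolFunctionAt (m := m) (fun r => 2 * logJ r) q := (HolFunctionAt.const 2 q).mul h4
    have h7 : mvfderiv (CModel m) (fun r => Complex.exp (2 * logJ r)) q v
        = Complex.exp (2 * logJ q) * (2 * mvfderiv (CModel m) logJ q v) := by
      have h8 : mfderiv (CModel m) 𝓘(ℂ, ℂ) (Complex.exp ∘ fun r => 2 * logJ r) q
          = (mfderiv 𝓘(ℂ, ℂ) 𝓘(ℂ, ℂ) Complex.exp (2 * logJ q)).comp
            (mfderiv (CModel m) 𝓘(ℂ, ℂ) (fun r => 2 * logJ r) q) :=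
        mfderiv_comp q Complex.differentiableAt_exp.mdifferentiableAt h6.mdiff
      rw [← mvfderiv_const_mul_apply 2 h4]
      change mfderiv (CModel m) 𝓘(ℂ, ℂ) (Complex.exp ∘ fun r => 2 * logJ r) q v = _
      rw [h8, mfderiv_eq_fderiv]
      change fderiv ℂ Complex.exp (2 * logJ q) (mvfderiv (CModel m) (fun r => 2 * logJ r) q v) = _
      rw [(Complex.hasDerivAt_exp _).hasFDerivAt.fderiv]
      simp [_root_.mul_comm]
    have h8 : HolFunctionAt (m := m) (fun r => Complex.exp (2 * logJ r)) q :=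
      HolFunctionAt.comp_analyticAt (G := Complex.exp)
        (Complex.differentiable_exp.analyticAt _) h6
    have hne := h3.vol_ne_zero
    rw [mvfderiv_congr_eventually h5, mvfderiv_const_mul_apply _ h8, h7]
    rw [h5.self_of_nhds] at hne ⊢
    have hd0 : d ≠ 0 := left_ne_zero_of_mul hne
    field_simp
  constructor
  · rintro ⟨u, e, φ, logτ, logJ, hcan, hφ, hps, hτ, hJ, hdτ, hexp, hGeq⟩
    have he := hcan.isIdemFrame
    filter_upwards [key he hφ hps hJ hexp, hdτ, hGeq.eventually_nhds, hτ.eventually,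
      hJ.eventually] with q h1 h2 h3 h4 h5
    ext v
    rw [mvfderiv_congr_eventually h3, mvfderiv_sub_apply h4 ((HolFunctionAt.const _ q).mul h5),
      mvfderiv_const_mul_apply _ h5, h2]
    change _ = F.dLogTau q v - 1 / 48 * (F.vol q)⁻¹ * mvfderiv (CModel m) F.vol q v
    rw [_root_.mul_assoc, h1 v]
    ring
  · intro hdG
    obtain ⟨e, he⟩ := (not_not.1 hp : F.SemisimpleAt p).exists_isIdemFrame
    obtain ⟨φ, hps, hφ⟩ := F.metric_flat p
    obtain ⟨hJhol, hJ0, -⟩ := he.exists_vol_eq hφ hps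
    set c := jacobian φ e p
    -- The quotient J/J(p) is close to 1, where the principal logarithm is analytic; the constant
    -- log J(p) restores the value of the exponential.
    set logJ : M → ℂ := fun q => Complex.log (jacobian φ e q / c) + Complex.log c with hlogJ
    have hquot : HolFunctionAt (m := m) (fun q => jacobian φ e q / c) p :=
      hJhol.div (HolFunctionAt.const c p) hJ0
    have hlog : HolFunctionAt (m := m) logJ p := by
      refine HolFunctionAt.add ?_ (HolFunctionAt.const _ p)
      refine HolFunctionAt.comp_analyticAt (G := Complex.log) ?_ hquot
      rw [div_self hJ0]
      exact analyticAt_clog (by simp)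
    have hexp : ∀ᶠ q in 𝓝 p, Complex.exp (logJ q) = jacobian φ e q := by
      filter_upwards [hJhol.eventually_ne hJ0] with q hq
      simp only [hlogJ]
      rw [Complex.exp_add, Complex.exp_log (div_ne_zero hq hJ0), Complex.exp_log hJ0,
        div_mul_cancel₀ _ hJ0]
    have hτ : HolFunctionAt (m := m) (fun q => G q + 1 / 24 * logJ q) p :=
      hG.add ((HolFunctionAt.const _ p).mul hlog)
    refine ⟨_, e, φ, fun q => G q + 1 / 24 * logJ q, logJ, he.isCanonicalAt, hφ, hps, hτ, hlog, ?_,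
      hexp, Filter.Eventually.of_forall fun q => by ring⟩
    filter_upwards [key he hφ hps hlog hexp, hdG, hG.eventually, hlog.eventually] with q h1 h2 h3 h4
    ext v
    rw [mvfderiv_add_apply h3 ((HolFunctionAt.const _ q).mul h4), mvfderiv_const_mul_apply _ h4, h2]
    change F.dLogTau q v - 1 / 48 * (F.vol q)⁻¹ * mvfderiv (CModel m) F.vol q v + _ = _
    rw [_root_.mul_assoc, h1 v]
    ring

end FrobeniusManifold
end

/-! ### Semisimplicity and the trace form: the caustic as a zero set. -/

noncomputable section

section ReducedAlgebra

/-- A finite-dimensional reduced commutative complex algebra has a basis of orthogonal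
idempotents. -/
theorem exists_orthogonal_idempotents {R : Type*} [CommRing R] [Algebra ℂ R] [Module.Finite ℂ R]
    [IsReduced R] {m : ℕ} (hm : Module.finrank ℂ R = m) :
    ∃ b : Fin m → R, (∀ i j, b i * b j = if i = j then b i else 0) ∧ ∀ i, b i ≠ 0 := by
  classical
  have : IsArtinianRing R := IsArtinianRing.of_finite ℂ R
  have : Fintype (MaximalSpectrum R) := Fintype.ofFinite _
  set ε := IsArtinianRing.equivPi R
  set c : MaximalSpectrum R → R := fun I => ε.symm (Pi.single I 1) with hc
  have hε : ∀ I, ε (c I) = Pi.single I 1 := fun I => ε.apply_symm_apply _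
  have hmul : ∀ I J, c I * c J = if I = J then c I else 0 := by
    intro I J
    apply ε.injective
    rw [map_mul, hε, hε]
    split_ifs with h
    · subst h
      rw [hε, ← Pi.single_mul, one_mul]
    · rw [map_zero]
      funext K
      by_cases hK : K = I
      · subst hK
        simp [Pi.single_eq_of_ne h]
      · simp [Pi.single_eq_of_ne hK]
  have hne : ∀ I, c I ≠ 0 := by
    intro I h
    have h1 := hε I
    rw [h, map_zero] at h1
    have h2 := congrFun h1 I
    simp at h2
  have hind : LinearIndependent ℂ c := by
    rw [Fintype.linearIndependent_iff]
    intro a ha J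
    have h1 : c J * ∑ I, a I • c I = a J • c J := by
      rw [Finset.mul_sum, Finset.sum_eq_single J]
      · rw [mul_smul_comm, hmul, if_pos rfl]
      · intro I _ hIJ
        rw [mul_smul_comm, hmul, if_neg hIJ.symm, smul_zero]
      · simp
    rw [ha, mul_zero] at h1
    exact (smul_eq_zero.1 h1.symm).resolve_right (hne J)
  have hspan : ⊤ ≤ Submodule.span ℂ (Set.range c) := by
    intro v _
    -- The residue fields are finite over ℂ and hence equal to ℂ, so R is spanned by the idempotents
    -- of its local factors.
    have hsurj : ∀ I : MaximalSpectrum R, ∃ a : ℂ, algebraMap ℂ (R ⧸ I.asIdeal) a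
        = Ideal.Quotient.mk I.asIdeal v := by
      intro I
      have := I.isMaximal
      let _ : Field (R ⧸ I.asIdeal) := Ideal.Quotient.field _
      exact (IsAlgClosed.algebraMap_bijective_of_isIntegral (k := ℂ)
        (K := R ⧸ I.asIdeal)).2 _
    choose a ha using hsurj
    rw [Submodule.mem_span_range_iff_exists_fun]
    refine ⟨a, ε.injective ?_⟩
    rw [map_sum]
    funext J
    rw [Finset.sum_apply, Finset.sum_eq_single J]
    · rw [Algebra.smul_def, map_mul, hε, Pi.mul_apply, Pi.single_eq_same, mul_one,
        IsArtinianRing.equivPi_apply]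
      exact ha J
    · intro I _ hIJ
      rw [Algebra.smul_def, map_mul, hε, Pi.mul_apply, Pi.single_eq_of_ne hIJ.symm, mul_zero]
    · simp
  have hcard : Fintype.card (MaximalSpectrum R) = m := by
    rw [← hm]
    exact (Module.finrank_eq_card_basis (Module.Basis.mk hind hspan)).symm
  set σ : Fin m ≃ MaximalSpectrum R := (Fintype.equivFinOfCardEq hcard).symm
  refine ⟨fun i => c (σ i), fun i j => ?_, fun i => hne _⟩
  rw [hmul]
  simp

/-- If x is nilpotent, so is every product xy, and nilpotent endomorphisms have trace 0; thus x lies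
in the radical of the trace form. -/
theorem isReduced_of_trace_nondegenerate {R : Type*} [CommRing R] [Algebra ℂ R] [Module.Finite ℂ R]
    (h : ∀ x : R, (∀ y, LinearMap.trace ℂ R (LinearMap.mulLeft ℂ (x * y)) = 0) → x = 0) :
    IsReduced R := by
  refine ⟨fun x hx => h x fun y => ?_⟩
  have h1 : IsNilpotent (x * y) := (Commute.all x y).isNilpotent_mul_right hx
  have h2 : IsNilpotent (LinearMap.mulLeft ℂ (x * y)) := (LinearMap.isNilpotent_mulLeft_iff ℂ _).2 h1
  exact (LinearMap.isNilpotent_trace_of_isNilpotent h2).eq_zero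

end ReducedAlgebra

namespace FrobeniusManifold

variable {m : ℕ} {M : Type*} [TopologicalSpace M] [ChartedSpace (Fin m → ℂ) M]
  [IsManifold (CModel m) ω M] (F : FrobeniusManifold m M) {p q : M}
  {φ : OpenPartialHomeomorph M (Fin m → ℂ)}

/-- The tangent space with the multiplication of the Frobenius manifold. -/
def TangentAlgebra (_ : FrobeniusManifold m M) (q : M) : Type := TangentSpace (CModel m) q

instance (q : M) : AddCommGroup (F.TangentAlgebra q) :=
  inferInstanceAs (AddCommGroup (TangentSpace (CModel m) q))

instance (q : M) : Module ℂ (F.TangentAlgebra q) :=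
  inferInstanceAs (Module ℂ (TangentSpace (CModel m) q))

instance (q : M) : Module.Finite ℂ (F.TangentAlgebra q) :=
  inferInstanceAs (Module.Finite ℂ (TangentSpace (CModel m) q))

instance (q : M) : CommRing (F.TangentAlgebra q) :=
  { (inferInstance : AddCommGroup (F.TangentAlgebra q)) with
    mul := fun x y => F.mul q x y
    one := F.unit q
    mul_assoc := F.mul_assoc q
    mul_comm := F.mul_comm q
    one_mul := F.unit_mul q
    mul_one := fun x => (F.mul_comm q x (F.unit q)).trans (F.unit_mul q x)
    left_distrib := fun x y z => map_add (F.mul q x) y z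
    right_distrib := fun x y z => LinearMap.map_add₂ (F.mul q) x y z
    zero_mul := fun x => LinearMap.map_zero₂ (F.mul q) x
    mul_zero := fun x => map_zero (F.mul q x) }

instance (q : M) : Algebra ℂ (F.TangentAlgebra q) :=
  Algebra.ofModule (fun a x y => LinearMap.map_smul₂ (F.mul q) a x y)
    fun a x y => map_smul (F.mul q x) a y

variable {F}

theorem semisimpleAt_of_trace_nondegenerate
    (h : ∀ x, (∀ y, LinearMap.trace ℂ _ (F.mul q (F.mul q x y)) = 0) → x = 0) :
    F.SemisimpleAt q := by
  have : IsReduced (F.TangentAlgebra q) := isReduced_of_trace_nondegenerate h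
  obtain ⟨b, hb, hb0⟩ := exists_orthogonal_idempotents (R := F.TangentAlgebra q)
    (finrank_tangentSpace q)
  exact IsIdemBasis.semisimpleAt (F := F) (b := b) ⟨hb, hb0⟩

/-- Multiplication by a basis idempotent has trace 1, so the trace form of x with b_i is the i-th
coefficient of x. -/
theorem SemisimpleAt.trace_nondegenerate (hq : F.SemisimpleAt q) {x : TangentSpace (CModel m) q}
    (h : ∀ y, LinearMap.trace ℂ _ (F.mul q (F.mul q x y)) = 0) : x = 0 := by
  obtain ⟨b, hb⟩ := hq
  have hB : F.IsIdemBasis q b := ⟨hb, b.ne_zero⟩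
  have htr : ∀ i, LinearMap.trace ℂ _ (F.mul q (b i)) = 1 := by
    intro i
    rw [LinearMap.trace_eq_matrix_trace ℂ b, Matrix.trace, Finset.sum_eq_single i]
    · simp [LinearMap.toMatrix_apply, hb]
    · intro j _ hji
      simp [LinearMap.toMatrix_apply, hb, hji.symm]
    · simp
  obtain ⟨c, rfl⟩ := hB.exists_eq_sum x
  refine Finset.sum_eq_zero fun i _ => ?_
  have h1 := h (b i)
  rw [F.mul_comm, hB.mul_sum, map_smul, map_smul, htr, smul_eq_mul, mul_one] at h1
  rw [h1, zero_smul]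

/-- The discriminant of the trace form of the multiplication in the coordinates `φ`. -/
def traceDiscr (F : FrobeniusManifold m M) (φ : OpenPartialHomeomorph M (Fin m → ℂ)) (q : M) : ℂ :=
  Matrix.det (Matrix.of fun k l => ∑ j, mvfderiv (CModel m) φ q
    (F.mul q (F.mul q (chartField φ k q) (chartField φ l q)) (chartField φ j q)) j)

theorem traceDiscr_hol (hφ : φ ∈ IsManifold.maximalAtlas (CModel m) ω M) (hq : q ∈ φ.source) :
    HolFunctionAt (m := m) (F.traceDiscr φ) q := by
  have hol := holFieldAt_chartField hφ hq
  refine HolFunctionAt.det fun k l => ?_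
  simp only [Matrix.of_apply]
  refine HolFunctionAt.sum fun j _ => ?_
  exact (F.mul_hol q _ _ (F.mul_hol q _ _ (hol k) (hol l)) (hol j)).coeff hφ hq j

/-- The discriminant is nonzero exactly when the trace form is nondegenerate. So the caustic is
locally the zero set of one holomorphic function, as the extension theorem across hypersurfaces
requires. -/
theorem traceDiscr_ne_zero_iff (hφ : φ ∈ IsManifold.maximalAtlas (CModel m) ω M)
    (hq : q ∈ φ.source) : F.traceDiscr φ q ≠ 0 ↔ F.SemisimpleAt q := by
  set L : TangentSpace (CModel m) q ≃ₗ[ℂ] (Fin m → ℂ) :=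
    LinearEquiv.ofBijective (mvfderiv (CModel m) φ q).toLinearMap (mvfderiv_chart_bijective hφ hq)
    with hL
  set B : Module.Basis (Fin m) ℂ (TangentSpace (CModel m) q) := Module.Basis.ofEquivFun L with hB
  have hBk : ∀ k, B k = chartField φ k q := by
    intro k
    rw [hB, Module.Basis.coe_ofEquivFun, LinearEquiv.symm_apply_eq]
    exact (mvfderiv_chartField hφ hq k).symm
  have htr : ∀ v, LinearMap.trace ℂ _ (F.mul q v)
      = ∑ j, mvfderiv (CModel m) φ q (F.mul q v (chartField φ j q)) j := by
    intro v
    rw [LinearMap.trace_eq_matrix_trace ℂ B, Matrix.trace]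
    refine Finset.sum_congr rfl fun j _ => ?_
    rw [Matrix.diag_apply, LinearMap.toMatrix_apply, hBk]
    rfl
  have hdet : F.traceDiscr φ q = Matrix.det (Matrix.of fun k l =>
      LinearMap.trace ℂ _ (F.mul q (F.mul q (B k) (B l)))) := by
    unfold traceDiscr
    simp only [htr, hBk]
  rw [hdet]
  set A : Matrix (Fin m) (Fin m) ℂ := Matrix.of fun k l =>
      LinearMap.trace ℂ _ (F.mul q (F.mul q (B k) (B l))) with hA
  have hvec : ∀ (x : Fin m → ℂ) (l : Fin m), Matrix.vecMul x A l
      = LinearMap.trace ℂ _ (F.mul q (F.mul q (∑ k, x k • B k) (B l))) := by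
    intro x l
    simp only [Matrix.vecMul, dotProduct, hA, Matrix.of_apply, map_sum, map_smul,
      LinearMap.sum_apply, LinearMap.smul_apply, smul_eq_mul]
  constructor
  · intro h0
    refine semisimpleAt_of_trace_nondegenerate fun x hx => ?_
    have h1 : Matrix.vecMul (B.repr x) A = 0 := by
      funext l
      rw [hvec, B.sum_repr]
      exact hx _
    have h2 := Matrix.eq_zero_of_vecMul_eq_zero h0 h1
    rw [← B.sum_repr x]
    simp [h2]
  · intro hss h0
    obtain ⟨x, hx0, hx⟩ := Matrix.exists_vecMul_eq_zero_iff.2 h0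
    apply hx0
    have h1 : ∑ k, x k • B k = 0 := by
      refine hss.trace_nondegenerate fun y => ?_
      rw [← B.sum_repr y, map_sum, map_sum, map_sum]
      refine Finset.sum_eq_zero fun l _ => ?_
      rw [map_smul, map_smul, map_smul, ← hvec, hx]
      simp
    funext k
    exact Fintype.linearIndependent_iff.1 B.linearIndependent x h1 k

theorem isOpen_semisimple : IsOpen {q | F.SemisimpleAt q} := by
  rw [isOpen_iff_mem_nhds]
  intro q hq
  obtain ⟨e, he⟩ := SemisimpleAt.exists_isIdemFrame hq
  filter_upwards [he.idem] with r hr using hr.semisimpleAt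

end FrobeniusManifold
end

/-! ### Germs of type I_2(n) A_1^{m-2} in adapted coordinates. -/

noncomputable section

namespace FrobeniusManifold

open VectorField

variable {m : ℕ} {M : Type*} [TopologicalSpace M] [ChartedSpace (Fin m → ℂ) M]
  [IsManifold (CModel m) ω M]

/-- The coordinate fields `∂_k` of the chart `φ` multiply as in `I_2(n) A_1^{m-2}`. -/
structure IsGermChart (F : FrobeniusManifold m M) (n : ℕ) (φ : OpenPartialHomeomorph M (Fin m → ℂ))
    (i₀ i₁ : Fin m) : Prop where
  mem : φ ∈ IsManifold.maximalAtlas (CModel m) ω M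
  ne : i₀ ≠ i₁
  mul_zero_zero : ∀ q ∈ φ.source, F.mul q (chartField φ i₀ q) (chartField φ i₀ q)
    = chartField φ i₀ q
  mul_zero_one : ∀ q ∈ φ.source, F.mul q (chartField φ i₀ q) (chartField φ i₁ q)
    = chartField φ i₁ q
  mul_one_one : ∀ q ∈ φ.source, F.mul q (chartField φ i₁ q) (chartField φ i₁ q)
    = φ q i₁ ^ (n - 2) • chartField φ i₀ q
  mul_zero_ne : ∀ q ∈ φ.source, ∀ j, j ≠ i₀ → j ≠ i₁ →
    F.mul q (chartField φ i₀ q) (chartField φ j q) = 0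
  mul_one_ne : ∀ q ∈ φ.source, ∀ j, j ≠ i₀ → j ≠ i₁ →
    F.mul q (chartField φ i₁ q) (chartField φ j q) = 0
  mul_ne : ∀ q ∈ φ.source, ∀ j k, j ≠ i₀ → j ≠ i₁ → k ≠ i₀ → k ≠ i₁ →
    F.mul q (chartField φ j q) (chartField φ k q) = if j = k then chartField φ j q else 0

variable {F : FrobeniusManifold m M} {n : ℕ} {p q : M}
  {φ : OpenPartialHomeomorph M (Fin m → ℂ)} {i₀ i₁ : Fin m}

theorem HasGermI2.exists_isGermChart (h : F.HasGermI2 n p) :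
    ∃ φ i₀ i₁, F.IsGermChart n φ i₀ i₁ ∧ p ∈ φ.source ∧ φ p = 0 := by
  obtain ⟨hm, φ, hmem, hp, hp0, hmul⟩ := h
  have key : ∀ q ∈ φ.source, ∀ j k, ∀ v : TangentSpace (CModel m) q,
      modelMul hm n (φ q) (Pi.single j 1) (Pi.single k 1) = mvfderiv (CModel m) φ q v →
      F.mul q (chartField φ j q) (chartField φ k q) = v := by
    intro q hq j k v hv
    apply (mvfderiv_chart_bijective hmem hq).1
    rw [hmul q hq, mvfderiv_chartField hmem hq, mvfderiv_chartField hmem hq]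
    exact hv
  refine ⟨φ, ⟨0, by lia⟩, ⟨1, by lia⟩, ⟨hmem, by simp, ?_, ?_, ?_, ?_, ?_, ?_⟩, hp, hp0⟩
  · intro q hq
    refine key q hq _ _ _ ?_
    rw [mvfderiv_chartField hmem hq]
    funext i
    simp only [modelMul, Pi.single_apply, Fin.ext_iff]
    split_ifs <;> simp_all
  · intro q hq
    refine key q hq _ _ _ ?_
    rw [mvfderiv_chartField hmem hq]
    funext i
    simp only [modelMul, Pi.single_apply, Fin.ext_iff]
    split_ifs <;> simp_all
  · intro q hq
    refine key q hq _ _ _ ?_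
    rw [map_smul, mvfderiv_chartField hmem hq]
    funext i
    simp only [modelMul, Pi.single_apply, Fin.ext_iff, Pi.smul_apply]
    split_ifs <;> simp_all
  · intro q hq j hj0 hj1
    refine key q hq _ _ _ ?_
    rw [map_zero]
    funext i
    simp only [modelMul, Pi.single_apply, Fin.ext_iff, ne_eq] at *
    split_ifs <;> simp_all
  · intro q hq j hj0 hj1
    refine key q hq _ _ _ ?_
    rw [map_zero]
    funext i
    simp only [modelMul, Pi.single_apply, Fin.ext_iff, ne_eq] at *
    split_ifs <;> simp_all
  · intro q hq j k hj0 hj1 hk0 hk1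
    refine key q hq _ _ _ ?_
    by_cases hjk : j = k
    · subst hjk
      rw [if_pos rfl, mvfderiv_chartField hmem hq]
      funext i
      simp only [modelMul, Pi.single_apply, Fin.ext_iff, ne_eq] at *
      split_ifs <;> simp_all
    · rw [if_neg hjk, map_zero]
      funext i
      simp only [modelMul, Pi.single_apply, Fin.ext_iff, ne_eq] at *
      split_ifs <;> simp_all

namespace IsGermChart

variable (hc : F.IsGermChart n φ i₀ i₁)
include hc

theorem mul_eq_zero_of_ne (hq : q ∈ φ.source) {j k : Fin m} (hj0 : j ≠ i₀) (hj1 : j ≠ i₁)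
    (hjk : j ≠ k) : F.mul q (chartField φ j q) (chartField φ k q) = 0 := by
  by_cases hk0 : k = i₀
  · subst hk0
    rw [F.mul_comm, hc.mul_zero_ne q hq j hj0 hj1]
  by_cases hk1 : k = i₁
  · subst hk1
    rw [F.mul_comm, hc.mul_one_ne q hq j hj0 hj1]
  rw [hc.mul_ne q hq j k hj0 hj1 hk0 hk1, if_neg hjk]

theorem metric_eq_zero_of_ne (hq : q ∈ φ.source) {j k : Fin m} (hj0 : j ≠ i₀) (hj1 : j ≠ i₁)
    (hjk : j ≠ k) : F.metric q (chartField φ j q) (chartField φ k q) = 0 := by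
  have h := hc.mul_ne q hq j j hj0 hj1 hj0 hj1
  rw [if_pos rfl] at h
  rw [← h, F.metric_mul, hc.mul_eq_zero_of_ne hq hj0 hj1 hjk, map_zero]

/-- Invariance of g applied to δ_2 = δ_1 ∘ δ_2 and δ_2 ∘ δ_2 = t_2^{n-2} δ_1. -/
theorem metric_one_one (hq : q ∈ φ.source) :
    F.metric q (chartField φ i₁ q) (chartField φ i₁ q)
      = φ q i₁ ^ (n - 2) * F.metric q (chartField φ i₀ q) (chartField φ i₀ q) := by
  nth_rewrite 1 [← hc.mul_zero_one q hq]
  rw [F.metric_mul, hc.mul_one_one q hq, map_smul, smul_eq_mul]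

theorem metric_self_ne_zero (hq : q ∈ φ.source) {j : Fin m} (hj0 : j ≠ i₀) (hj1 : j ≠ i₁) :
    F.metric q (chartField φ j q) (chartField φ j q) ≠ 0 := by
  intro h
  have h0 : chartField φ j q = 0 := by
    apply F.metric_nondeg q
    intro w
    rw [eq_sum_chartField hc.mem hq w, map_sum]
    refine Finset.sum_eq_zero fun k _ => ?_
    rw [map_smul]
    rcases eq_or_ne j k with rfl | hjk
    · rw [h, smul_zero]
    · rw [hc.metric_eq_zero_of_ne hq hj0 hj1 hjk, smul_zero]
  have h1 := mvfderiv_chartField hc.mem hq j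
  rw [h0, map_zero] at h1
  have h2 := congrFun h1 j
  simp at h2

/-- On t_2 = 0 the entry g(δ_2, δ_2) = t_2^{n-2} g(δ_1, δ_1) vanishes because n ≥ 3, and δ_2 is
orthogonal to the other δ_j; nondegeneracy leaves only g(δ_1, δ_2). -/
theorem metric_zero_one_ne_zero (hn : 3 ≤ n) (hq : q ∈ φ.source) (ht : φ q i₁ = 0) :
    F.metric q (chartField φ i₀ q) (chartField φ i₁ q) ≠ 0 := by
  intro h
  have h0 : chartField φ i₁ q = 0 := by
    apply F.metric_nondeg q
    intro w
    rw [eq_sum_chartField hc.mem hq w, map_sum]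
    refine Finset.sum_eq_zero fun k _ => ?_
    rw [map_smul]
    by_cases hk0 : k = i₀
    · rw [hk0, F.metric_symm, h, smul_zero]
    by_cases hk1 : k = i₁
    · rw [hk1, hc.metric_one_one hq, ht, zero_pow (by lia), zero_mul, smul_zero]
    · rw [F.metric_symm, hc.metric_eq_zero_of_ne hq hk0 hk1 hk1, smul_zero]
  have h1 := mvfderiv_chartField hc.mem hq i₁
  rw [h0, map_zero] at h1
  have h2 := congrFun h1 i₁
  simp at h2

/-- On t_2 = 0 the nonzero vector δ_2 has square zero. -/
theorem not_semisimpleAt (hn : 3 ≤ n) (hq : q ∈ φ.source) (ht : φ q i₁ = 0) :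
    ¬ F.SemisimpleAt q := by
  rintro ⟨b, hb⟩
  have hB : F.IsIdemBasis q b := ⟨hb, b.ne_zero⟩
  have h1 := hc.mul_one_one q hq
  rw [ht, zero_pow (by lia), zero_smul] at h1
  have h0 : chartField φ i₁ q = 0 := by
    obtain ⟨c, hcv⟩ := hB.exists_eq_sum (chartField φ i₁ q)
    have hci : ∀ i, c i = 0 := by
      intro i
      have h2 : F.mul q (b i) (F.mul q (chartField φ i₁ q) (chartField φ i₁ q))
          = (c i * c i) • b i := by
        rw [← F.mul_assoc, hcv, hB.mul_sum, map_smul, LinearMap.smul_apply, hB.mul_sum, smul_smul]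
      rw [h1, map_zero] at h2
      exact mul_self_eq_zero.1 ((smul_eq_zero.1 h2.symm).resolve_right (hB.ne_zero i))
    rw [hcv]
    simp [hci]
  have h1 := mvfderiv_chartField hc.mem hq i₁
  rw [h0, map_zero] at h1
  have h2 := congrFun h1 i₁
  simp at h2

end IsGermChart

end FrobeniusManifold
end

/-! ### Square roots and the idempotent frame of the germ. -/

noncomputable section

namespace FrobeniusManifold

open VectorField

variable {m : ℕ} {M : Type*} [TopologicalSpace M] [ChartedSpace (Fin m → ℂ) M]
  [IsManifold (CModel m) ω M]

/-- Away from its zeros a holomorphic function has a local holomorphic square root. -/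
theorem HolFunctionAt.exists_sqrt {f : M → ℂ} {q : M} (hf : HolFunctionAt (m := m) f q)
    (h0 : f q ≠ 0) :
    ∃ r : M → ℂ, HolFunctionAt (m := m) r q ∧ ∀ᶠ x in 𝓝 q, r x ^ 2 = f x := by
  obtain ⟨s, hs⟩ := IsSquare.exists_sq (f q) (IsAlgClosed.exists_pow_nat_eq (f q) two_pos |>.elim
    fun z hz => ⟨z, by rw [← hz, sq]⟩)
  refine ⟨fun x => s * Complex.exp (1 / 2 * Complex.log (f x / f q)), ?_, ?_⟩
  · refine (HolFunctionAt.const s q).mul ?_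
    refine HolFunctionAt.comp_analyticAt
      (G := fun z => Complex.exp (1 / 2 * Complex.log (z / f q))) ?_ hf
    have h1 : AnalyticAt ℂ (fun z : ℂ => z / f q) (f q) := analyticAt_id.div_const
    refine (analyticAt_const.mul (h1.clog ?_)).cexp
    rw [div_self h0]
    exact Complex.one_mem_slitPlane
  · filter_upwards [hf.eventually_ne h0] with x hx
    rw [mul_pow, ← Complex.exp_nat_mul, ← hs]
    push_cast
    rw [← _root_.mul_assoc, mul_one_div_cancel two_ne_zero, one_mul,
      Complex.exp_log (div_ne_zero hx h0), mul_div_cancel₀ _ h0]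

/-- The coefficients of the metric in the chart `φ`. -/
def metricCoeff (F : FrobeniusManifold m M) (φ : OpenPartialHomeomorph M (Fin m → ℂ))
    (k l : Fin m) (q : M) : ℂ :=
  F.metric q (chartField φ k q) (chartField φ l q)

/-- The partial derivatives in the chart `φ`. -/
def chartDeriv (φ : OpenPartialHomeomorph M (Fin m → ℂ)) (k : Fin m) (f : M → ℂ) (q : M) : ℂ :=
  mvfderiv (CModel m) f q (chartField φ k q)

/-- The coefficients of the Euler field in the chart `φ`. -/
def eulerCoeff (F : FrobeniusManifold m M) (φ : OpenPartialHomeomorph M (Fin m → ℂ))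
    (k : Fin m) (q : M) : ℂ :=
  mvfderiv (CModel m) φ q (F.euler q) k

variable {F : FrobeniusManifold m M} {n : ℕ} {p q : M}
  {φ : OpenPartialHomeomorph M (Fin m → ℂ)} {i₀ i₁ : Fin m}

theorem metricCoeff_hol (hφ : φ ∈ IsManifold.maximalAtlas (CModel m) ω M) (hq : q ∈ φ.source)
    (k l : Fin m) : HolFunctionAt (m := m) (F.metricCoeff φ k l) q :=
  F.metric_hol q _ _ (holFieldAt_chartField hφ hq k) (holFieldAt_chartField hφ hq l)

theorem chartDeriv_hol (hφ : φ ∈ IsManifold.maximalAtlas (CModel m) ω M) (hq : q ∈ φ.source)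
    {f : M → ℂ} (hf : HolFunctionAt (m := m) f q) (k : Fin m) :
    HolFunctionAt (m := m) (chartDeriv φ k f) q :=
  hf.mvfderiv (holFieldAt_chartField hφ hq k)

theorem eulerCoeff_hol (hφ : φ ∈ IsManifold.maximalAtlas (CModel m) ω M) (hq : q ∈ φ.source)
    (k : Fin m) : HolFunctionAt (m := m) (F.eulerCoeff φ k) q :=
  (F.euler_hol q).coeff hφ hq k

theorem chartDeriv_chart (hφ : φ ∈ IsManifold.maximalAtlas (CModel m) ω M) (hq : q ∈ φ.source)
    (k l : Fin m) : chartDeriv φ k (fun x => φ x l) q = if l = k then 1 else 0 := by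
  rw [chartDeriv, mvfderiv_chart_apply hφ hq, mvfderiv_chartField hφ hq, Pi.single_apply]

/-- The orthogonal idempotents of `I_2(n) A_1^{m-2}`, where `r² = t_2^{n-2}`. -/
def germFrame (φ : OpenPartialHomeomorph M (Fin m → ℂ)) (i₀ i₁ : Fin m) (r : M → ℂ) (k : Fin m)
    (q : M) : TangentSpace (CModel m) q :=
  if k = i₀ then (1 / 2 : ℂ) • (chartField φ i₀ q + (r q)⁻¹ • chartField φ i₁ q)
  else if k = i₁ then (1 / 2 : ℂ) • (chartField φ i₀ q - (r q)⁻¹ • chartField φ i₁ q)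
  else chartField φ k q

theorem germFrame_zero (φ : OpenPartialHomeomorph M (Fin m → ℂ)) (i₀ i₁ : Fin m) (r : M → ℂ)
    (q : M) : germFrame φ i₀ i₁ r i₀ q
      = (1 / 2 : ℂ) • (chartField φ i₀ q + (r q)⁻¹ • chartField φ i₁ q) := if_pos rfl

theorem germFrame_of_ne {k : Fin m} (hk0 : k ≠ i₀) (hk1 : k ≠ i₁) (r : M → ℂ) (q : M) :
    germFrame φ i₀ i₁ r k q = chartField φ k q := by
  rw [germFrame, if_neg hk0, if_neg hk1]

namespace IsGermChart

section Frame

variable (hc : F.IsGermChart n φ i₀ i₁)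
include hc

theorem germFrame_one (r : M → ℂ) (q : M) : germFrame φ i₀ i₁ r i₁ q
      = (1 / 2 : ℂ) • (chartField φ i₀ q - (r q)⁻¹ • chartField φ i₁ q) := by
  rw [germFrame, if_neg hc.ne.symm, if_pos rfl]

theorem isIdemBasis_germFrame {r : M → ℂ} (hq : q ∈ φ.source) (hr : r q ≠ 0)
    (hrq : r q ^ 2 = φ q i₁ ^ (n - 2)) : F.IsIdemBasis q fun k => germFrame φ i₀ i₁ r k q := by
  have h01 := hc.mul_zero_one q hq
  have h10 : F.mul q (chartField φ i₁ q) (chartField φ i₀ q) = chartField φ i₁ q := by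
    rw [F.mul_comm, h01]
  have h11 := hc.mul_one_one q hq
  rw [← hrq] at h11
  have h00 := hc.mul_zero_zero q hq
  have hr2 : (r q)⁻¹ * ((r q)⁻¹ * r q ^ 2) = 1 := by field_simp
  have key : ∀ a b c d : ℂ, F.mul q (a • chartField φ i₀ q + b • chartField φ i₁ q)
      (c • chartField φ i₀ q + d • chartField φ i₁ q)
        = (a * c + b * d * r q ^ 2) • chartField φ i₀ q
          + (a * d + b * c) • chartField φ i₁ q := by
    intro a b c d
    simp only [map_add, map_smul, LinearMap.add_apply, LinearMap.smul_apply, h00, h01, h10, h11]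
    module
  have e0 : germFrame φ i₀ i₁ r i₀ q
      = (1 / 2 : ℂ) • chartField φ i₀ q + (1 / 2 * (r q)⁻¹) • chartField φ i₁ q := by
    rw [germFrame_zero]; module
  have e1 : germFrame φ i₀ i₁ r i₁ q
      = (1 / 2 : ℂ) • chartField φ i₀ q + (-(1 / 2) * (r q)⁻¹) • chartField φ i₁ q := by
    rw [hc.germFrame_one]; module
  have m00 : F.mul q (germFrame φ i₀ i₁ r i₀ q) (germFrame φ i₀ i₁ r i₀ q)
      = germFrame φ i₀ i₁ r i₀ q := by
    rw [e0, key]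
    congr 2 <;> field_simp <;> norm_num
  have m11 : F.mul q (germFrame φ i₀ i₁ r i₁ q) (germFrame φ i₀ i₁ r i₁ q)
      = germFrame φ i₀ i₁ r i₁ q := by
    rw [e1, key]
    congr 2 <;> field_simp <;> norm_num
  have m01 : F.mul q (germFrame φ i₀ i₁ r i₀ q) (germFrame φ i₀ i₁ r i₁ q) = 0 := by
    rw [e0, e1, key]
    have h1 : (1 / 2 * (1 / 2) + 1 / 2 * (r q)⁻¹ * (-(1 / 2) * (r q)⁻¹) * r q ^ 2 : ℂ) = 0 := by
      field_simp; norm_num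
    have h2 : (1 / 2 * (-(1 / 2) * (r q)⁻¹) + 1 / 2 * (r q)⁻¹ * (1 / 2) : ℂ) = 0 := by ring
    rw [h1, h2, zero_smul, zero_smul, add_zero]
  have mz : ∀ k l, l ≠ i₀ → l ≠ i₁ → k ≠ l →
      F.mul q (germFrame φ i₀ i₁ r k q) (germFrame φ i₀ i₁ r l q) = 0 := by
    intro k l hl0 hl1 hkl
    rw [germFrame_of_ne hl0 hl1]
    by_cases hk0 : k = i₀
    · subst hk0
      rw [e0, F.mul_comm, map_add, map_smul, map_smul, hc.mul_eq_zero_of_ne hq hl0 hl1 hl0,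
        hc.mul_eq_zero_of_ne hq hl0 hl1 hl1, smul_zero, smul_zero, add_zero]
    by_cases hk1 : k = i₁
    · subst hk1
      rw [e1, F.mul_comm, map_add, map_smul, map_smul, hc.mul_eq_zero_of_ne hq hl0 hl1 hl0,
        hc.mul_eq_zero_of_ne hq hl0 hl1 hl1, smul_zero, smul_zero, add_zero]
    rw [germFrame_of_ne hk0 hk1, hc.mul_eq_zero_of_ne hq hk0 hk1 hkl]
  constructor
  · intro k l
    rcases eq_or_ne k l with rfl | hkl
    · rw [if_pos rfl]
      by_cases hk0 : k = i₀
      · rw [hk0]; exact m00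
      by_cases hk1 : k = i₁
      · rw [hk1]; exact m11
      have := hc.mul_ne q hq k k hk0 hk1 hk0 hk1
      rw [germFrame_of_ne hk0 hk1]
      simpa using this
    · rw [if_neg hkl]
      by_cases hl : l ≠ i₀ ∧ l ≠ i₁
      · exact mz k l hl.1 hl.2 hkl
      by_cases hk : k ≠ i₀ ∧ k ≠ i₁
      · rw [F.mul_comm]; exact mz l k hk.1 hk.2 hkl.symm
      have hl' : l = i₀ ∨ l = i₁ := by tauto
      have hk' : k = i₀ ∨ k = i₁ := by tauto
      rcases hl' with rfl | rfl <;> rcases hk' with rfl | rfl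
      · exact absurd rfl hkl
      · rw [F.mul_comm]; exact m01
      · exact m01
      · exact absurd rfl hkl
  · intro k h
    have h1 : (mvfderiv (CModel m) φ q (germFrame φ i₀ i₁ r k q) : Fin m → ℂ) = 0 := by
      rw [h, map_zero]
    by_cases hk0 : k = i₀
    · rw [hk0, e0, map_add, map_smul, map_smul, mvfderiv_chartField hc.mem hq,
        mvfderiv_chartField hc.mem hq] at h1
      have := congrFun h1 i₀
      simp [hc.ne] at this
    by_cases hk1 : k = i₁
    · rw [hk1, e1, map_add, map_smul, map_smul, mvfderiv_chartField hc.mem hq,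
        mvfderiv_chartField hc.mem hq] at h1
      have := congrFun h1 i₀
      simp [hc.ne] at this
    rw [germFrame_of_ne hk0 hk1, mvfderiv_chartField hc.mem hq] at h1
    have := congrFun h1 k
    simp at this

theorem isIdemFrame_germFrame {r : M → ℂ} (hq : q ∈ φ.source) (hr : HolFunctionAt (m := m) r q)
    (hrq : ∀ᶠ x in 𝓝 q, r x ^ 2 = φ x i₁ ^ (n - 2)) (h0 : r q ≠ 0) :
    F.IsIdemFrame q (germFrame φ i₀ i₁ r) := by
  refine ⟨fun k => ?_, ?_⟩
  · have h := fun k => holFieldAt_chartField hc.mem hq k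
    by_cases hk0 : k = i₀
    · subst hk0
      exact HolFieldAt.smul (HolFunctionAt.const _ q) ((h k).add ((h i₁).smul (hr.inv h0))) |>.congr
        (.of_forall fun x => germFrame_zero φ k i₁ r x)
    by_cases hk1 : k = i₁
    · subst hk1
      exact HolFieldAt.smul (HolFunctionAt.const _ q) ((h i₀).sub ((h k).smul (hr.inv h0))) |>.congr
        (.of_forall fun x => hc.germFrame_one r x)
    exact (h k).congr (.of_forall fun x => germFrame_of_ne hk0 hk1 r x)
  · filter_upwards [hrq, hr.eventually_ne h0, φ.open_source.mem_nhds hq] with x h1 h2 h3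
    exact hc.isIdemBasis_germFrame h3 h2 h1

end Frame

end IsGermChart

end FrobeniusManifold
end

/-! ### Canonical coordinates and η_ij in the germ. -/

noncomputable section

namespace FrobeniusManifold

open VectorField

variable {m : ℕ} {M : Type*} [TopologicalSpace M] [ChartedSpace (Fin m → ℂ) M]
  [IsManifold (CModel m) ω M]
variable {F : FrobeniusManifold m M} {n : ℕ} {p q : M}
  {φ : OpenPartialHomeomorph M (Fin m → ℂ)} {i₀ i₁ : Fin m} {r : M → ℂ}

namespace IsGermChart

section Frame

variable (hc : F.IsGermChart n φ i₀ i₁)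
include hc

theorem chartField_zero_eq (r : M → ℂ) (q : M) : chartField φ i₀ q
    = germFrame φ i₀ i₁ r i₀ q + germFrame φ i₀ i₁ r i₁ q := by
  rw [germFrame_zero, hc.germFrame_one]
  module

theorem eta₂_germFrame {j : Fin m} (hj0 : j ≠ i₀) (hj1 : j ≠ i₁) :
    F.eta₂ (germFrame φ i₀ i₁ r) i₀ j q = 1 / 2 * (chartDeriv φ i₀ (F.metricCoeff φ j j) q
        + (r q)⁻¹ * chartDeriv φ i₁ (F.metricCoeff φ j j) q) ∧
      F.eta₂ (germFrame φ i₀ i₁ r) i₁ j q = 1 / 2 * (chartDeriv φ i₀ (F.metricCoeff φ j j) q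
        - (r q)⁻¹ * chartDeriv φ i₁ (F.metricCoeff φ j j) q) ∧
      ∀ k, k ≠ i₀ → k ≠ i₁ → F.eta₂ (germFrame φ i₀ i₁ r) k j q
        = chartDeriv φ k (F.metricCoeff φ j j) q := by
  have h1 : F.eta (germFrame φ i₀ i₁ r) j = F.metricCoeff φ j j := by
    funext x
    rw [eta, germFrame_of_ne hj0 hj1, metricCoeff]
  refine ⟨?_, ?_, fun k hk0 hk1 => ?_⟩
  · simp only [eta₂, h1, germFrame_zero, map_smul, map_add, smul_eq_mul, chartDeriv]
  · simp only [eta₂, h1, hc.germFrame_one, map_smul, map_sub, smul_eq_mul, chartDeriv]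
  · rw [eta₂, h1, germFrame_of_ne hk0 hk1, chartDeriv]

end Frame

section Pointwise

variable (hc : F.IsGermChart n φ i₀ i₁) (hq : q ∈ φ.source) (h0 : r q ≠ 0)
include hc hq h0

theorem eta_germFrame_zero (hrq : r q ^ 2 = φ q i₁ ^ (n - 2)) :
    F.eta (germFrame φ i₀ i₁ r) i₀ q
      = 1 / 2 * (F.metricCoeff φ i₀ i₀ q + (r q)⁻¹ * F.metricCoeff φ i₀ i₁ q) := by
  have h11 := hc.metric_one_one hq
  rw [← hrq] at h11
  have h10 := F.metric_symm q (chartField φ i₁ q) (chartField φ i₀ q)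
  simp only [eta, germFrame_zero, metricCoeff, map_add, map_smul, LinearMap.add_apply,
    LinearMap.smul_apply, smul_eq_mul, h10, h11]
  field_simp
  ring

theorem eta_germFrame_one (hrq : r q ^ 2 = φ q i₁ ^ (n - 2)) :
    F.eta (germFrame φ i₀ i₁ r) i₁ q
      = 1 / 2 * (F.metricCoeff φ i₀ i₀ q - (r q)⁻¹ * F.metricCoeff φ i₀ i₁ q) := by
  have h11 := hc.metric_one_one hq
  rw [← hrq] at h11
  have h10 := F.metric_symm q (chartField φ i₁ q) (chartField φ i₀ q)
  simp only [eta, hc.germFrame_one, metricCoeff, map_sub, map_smul, LinearMap.sub_apply,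
    LinearMap.smul_apply, smul_eq_mul, h10, h11]
  field_simp
  ring

theorem euler_eq_germFrame : F.euler q = ∑ k, (if k = i₀ then F.eulerCoeff φ i₀ q
      + r q * F.eulerCoeff φ i₁ q else if k = i₁ then F.eulerCoeff φ i₀ q
      - r q * F.eulerCoeff φ i₁ q else F.eulerCoeff φ k q) • germFrame φ i₀ i₁ r k q := by
  have h1 := eq_sum_chartField hc.mem hq (F.euler q)
  rw [h1, ← Finset.add_sum_erase _ _ (Finset.mem_univ i₀), ← Finset.add_sum_erase _ _
    (Finset.mem_erase.2 ⟨hc.ne.symm, Finset.mem_univ i₁⟩), ← Finset.add_sum_erase _ (fun k =>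
    (if k = i₀ then _ else _) • germFrame φ i₀ i₁ r k q) (Finset.mem_univ i₀),
    ← Finset.add_sum_erase _ (fun k => (if k = i₀ then _ else _) • germFrame φ i₀ i₁ r k q)
    (Finset.mem_erase.2 ⟨hc.ne.symm, Finset.mem_univ i₁⟩), ← add_assoc, ← add_assoc]
  congr 1
  · rw [if_pos rfl, if_neg hc.ne.symm, if_pos rfl, germFrame_zero, hc.germFrame_one]
    simp only [eulerCoeff]
    match_scalars
    · ring
    · field_simp; ring
  · refine Finset.sum_congr rfl fun k hk => ?_
    simp only [Finset.mem_erase, Finset.mem_univ, and_true] at hk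
    rw [if_neg hk.2, if_neg hk.1, germFrame_of_ne hk.2 hk.1]
    rfl

theorem canonicalCoord_germFrame (hrq : r q ^ 2 = φ q i₁ ^ (n - 2)) (k : Fin m) :
    F.canonicalCoord (germFrame φ i₀ i₁ r) k q = if k = i₀ then F.eulerCoeff φ i₀ q
      + r q * F.eulerCoeff φ i₁ q else if k = i₁ then F.eulerCoeff φ i₀ q
      - r q * F.eulerCoeff φ i₁ q else F.eulerCoeff φ k q := by
  have hb := hc.isIdemBasis_germFrame hq h0 hrq
  rw [canonicalCoord, hc.euler_eq_germFrame hq h0, hb.metric_sum, eta,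
    mul_div_cancel_right₀ _ (hb.metric_self_ne_zero k)]

theorem chartField_one_eq : chartField φ i₁ q
    = r q • (germFrame φ i₀ i₁ r i₀ q - germFrame φ i₀ i₁ r i₁ q) := by
  rw [germFrame_zero, hc.germFrame_one]
  match_scalars
  · field_simp; norm_num
  · ring

end Pointwise

section Local

variable (hc : F.IsGermChart n φ i₀ i₁) (hn : 3 ≤ n) (hq : q ∈ φ.source) (ht : φ q i₁ ≠ 0)
  (hr : HolFunctionAt (m := m) r q) (hrq : ∀ᶠ x in 𝓝 q, r x ^ 2 = φ x i₁ ^ (n - 2))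
include hc hn hq ht hr hrq

theorem sqrt_ne_zero : r q ≠ 0 := by
  intro h
  have h1 := hrq.self_of_nhds
  rw [h, zero_pow two_ne_zero] at h1
  exact ht (pow_eq_zero_iff (by lia) |>.1 h1.symm)

theorem chartDeriv_sqrt (k : Fin m) :
    chartDeriv φ k r q = if k = i₁ then ((n : ℂ) - 2) * r q / (2 * φ q i₁) else 0 := by
  have h0 := hc.sqrt_ne_zero hn hq ht hr hrq
  have h1 : chartDeriv φ k (fun x => r x ^ 2) q = chartDeriv φ k (fun x => φ x i₁ ^ (n - 2)) q := by
    rw [chartDeriv, mvfderiv_congr_eventually hrq]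
    rfl
  have h2 := chartDeriv_chart hc.mem hq k i₁
  rw [chartDeriv, mvfderiv_pow_apply hr, chartDeriv,
    mvfderiv_pow_apply (holFunctionAt_chart hc.mem hq i₁)] at h1
  rw [chartDeriv] at h2 ⊢
  rw [h2] at h1
  have h3 := hrq.self_of_nhds
  have h4 : φ q i₁ ^ (n - 2) = φ q i₁ ^ (n - 2 - 1) * φ q i₁ := by
    rw [← pow_succ]; congr 1; lia
  have h5 : ((n - 2 : ℕ) : ℂ) = (n : ℂ) - 2 := by
    rw [Nat.cast_sub (by lia)]; norm_num
  rw [h4] at h3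
  rw [h5] at h1
  rcases eq_or_ne k i₁ with rfl | hk
  · rw [if_pos rfl] at h1 ⊢
    rw [eq_div_iff (mul_ne_zero two_ne_zero ht)]
    apply mul_left_cancel₀ h0
    push_cast at h1
    simp only [pow_one, mul_one] at h1
    linear_combination φ q k * h1 - ((n : ℂ) - 2) * h3
  · rw [if_neg hk.symm] at h1
    rw [if_neg hk]
    simpa [h0] using h1

/-- Let ε be the δ_2-coefficient of E, so that u_1 - u_2 = 2rε. Since δ_2 = r(e_1 - e_2), one has
δ_2(u_1 - u_2) = 2r, while the other δ_k annihilate u_1 - u_2. Inserting δ_2 r = (n-2) r / (2 t_2)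
gives a linear equation for ε in which r no longer appears. -/
theorem eulerCoeff_deriv (k : Fin m) :
    φ q i₁ * chartDeriv φ k (F.eulerCoeff φ i₁) q
      = if k = i₁ then φ q i₁ - ((n : ℂ) - 2) / 2 * F.eulerCoeff φ i₁ q else 0 := by
  have h0 := hc.sqrt_ne_zero hn hq ht hr hrq
  have he := hc.isIdemFrame_germFrame hq hr hrq h0
  have hE := eulerCoeff_hol (F := F) hc.mem hq i₁
  set e := germFrame φ i₀ i₁ r
  have h1 : ∀ᶠ x in 𝓝 q, 2 * (r x * F.eulerCoeff φ i₁ x)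
      = F.canonicalCoord e i₀ x - F.canonicalCoord e i₁ x := by
    filter_upwards [hrq, hr.eventually_ne h0, φ.open_source.mem_nhds hq] with x h1 h2 h3
    rw [hc.canonicalCoord_germFrame h3 h2 h1, hc.canonicalCoord_germFrame h3 h2 h1, if_pos rfl,
      if_neg hc.ne.symm, if_pos rfl]
    ring
  have h2 : ∀ v, 2 * (r q * mvfderiv (CModel m) (F.eulerCoeff φ i₁) q v
      + F.eulerCoeff φ i₁ q * mvfderiv (CModel m) r q v)
      = mvfderiv (CModel m) (F.canonicalCoord e i₀) q v
        - mvfderiv (CModel m) (F.canonicalCoord e i₁) q v := by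
    intro v
    rw [← mvfderiv_sub_apply (he.canonicalCoord_hol i₀) (he.canonicalCoord_hol i₁),
      ← mvfderiv_congr_eventually h1, mvfderiv_const_mul_apply 2 (hr.mul hE),
      mvfderiv_mul_apply hr hE]
  have h3 := h2 (chartField φ k q)
  have h4 := hc.chartDeriv_sqrt hn hq ht hr hrq k
  rw [chartDeriv] at h4 ⊢
  rw [h4] at h3
  by_cases hk1 : k = i₁
  · subst hk1
    rw [if_pos rfl] at h3 ⊢
    have hd0 : mvfderiv (CModel m) (F.canonicalCoord e i₀) q (chartField φ k q) = r q := by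
      rw [hc.chartField_one_eq hq h0, map_smul, map_sub, he.mvfderiv_canonicalCoord,
        he.mvfderiv_canonicalCoord, if_pos rfl, if_neg hc.ne, smul_eq_mul, sub_zero, mul_one]
    have hd1 : mvfderiv (CModel m) (F.canonicalCoord e k) q (chartField φ k q) = -r q := by
      rw [hc.chartField_one_eq hq h0, map_smul, map_sub, he.mvfderiv_canonicalCoord,
        he.mvfderiv_canonicalCoord, if_pos rfl, if_neg hc.ne.symm, smul_eq_mul]
      ring
    rw [hd0, hd1] at h3
    field_simp at h3
    linear_combination 1 / 2 * h3
  · rw [if_neg hk1] at h3 ⊢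
    have h5 : mvfderiv (CModel m) (F.canonicalCoord e i₀) q (chartField φ k q)
        - mvfderiv (CModel m) (F.canonicalCoord e i₁) q (chartField φ k q) = 0 := by
      by_cases hk0 : k = i₀
      · subst hk0
        rw [hc.chartField_zero_eq r q]
        simp [he.mvfderiv_canonicalCoord, map_add, hc.ne, hc.ne.symm, e]
      · rw [← germFrame_of_ne (i₀ := i₀) hk0 hk1 r q, he.mvfderiv_canonicalCoord,
          he.mvfderiv_canonicalCoord, if_neg (Ne.symm hk0), if_neg (Ne.symm hk1), sub_zero]
    rw [h5] at h3
    have h6 : mvfderiv (CModel m) (F.eulerCoeff φ i₁) q (chartField φ k q) = 0 := by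
      simpa [h0] using h3
    rw [h6, mul_zero]

theorem eta₂_germFrame_zero_one :
    F.eta₂ (germFrame φ i₀ i₁ r) i₀ i₁ q = (((n : ℂ) - 2) / 2 * F.metricCoeff φ i₀ i₁ q
      + φ q i₁ * (φ q i₁ ^ (n - 2) * chartDeriv φ i₀ (F.metricCoeff φ i₀ i₀) q
        - chartDeriv φ i₁ (F.metricCoeff φ i₀ i₁) q)) / (4 * φ q i₁ * φ q i₁ ^ (n - 2)) := by
  have h0 := hc.sqrt_ne_zero hn hq ht hr hrq
  have he := hc.isIdemFrame_germFrame hq hr hrq h0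
  have g00 := metricCoeff_hol (F := F) hc.mem hq i₀ i₀
  have g01 := metricCoeff_hol (F := F) hc.mem hq i₀ i₁
  set e := germFrame φ i₀ i₁ r with he_def
  have h1 : ∀ᶠ x in 𝓝 q, F.eta e i₀ x
      = 1 / 2 * (F.metricCoeff φ i₀ i₀ x + (r x)⁻¹ * F.metricCoeff φ i₀ i₁ x) := by
    filter_upwards [hrq, hr.eventually_ne h0, φ.open_source.mem_nhds hq] with x h1 h2 h3
    exact hc.eta_germFrame_zero h3 h2 h1
  have h2 : ∀ᶠ x in 𝓝 q, F.eta e i₁ x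
      = 1 / 2 * (F.metricCoeff φ i₀ i₀ x - (r x)⁻¹ * F.metricCoeff φ i₀ i₁ x) := by
    filter_upwards [hrq, hr.eventually_ne h0, φ.open_source.mem_nhds hq] with x h1 h2 h3
    exact hc.eta_germFrame_one h3 h2 h1
  have hD0 := hc.chartDeriv_sqrt hn hq ht hr hrq i₀
  have hD1 := hc.chartDeriv_sqrt hn hq ht hr hrq i₁
  rw [if_neg hc.ne] at hD0
  rw [if_pos rfl] at hD1
  have h3 : ∀ v, mvfderiv (CModel m) (F.eta e i₀) q v
      = 1 / 2 * (mvfderiv (CModel m) (F.metricCoeff φ i₀ i₀) q v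
        + ((r q)⁻¹ * mvfderiv (CModel m) (F.metricCoeff φ i₀ i₁) q v
        + F.metricCoeff φ i₀ i₁ q * (- mvfderiv (CModel m) r q v / r q ^ 2))) := by
    intro v
    rw [mvfderiv_congr_eventually h1, mvfderiv_const_mul_apply _ (g00.add ((hr.inv h0).mul g01)),
      mvfderiv_add_apply g00 ((hr.inv h0).mul g01), mvfderiv_mul_apply (hr.inv h0) g01,
      mvfderiv_inv_apply hr h0]
  have h4 : ∀ v, mvfderiv (CModel m) (F.eta e i₁) q v
      = 1 / 2 * (mvfderiv (CModel m) (F.metricCoeff φ i₀ i₀) q v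
        - ((r q)⁻¹ * mvfderiv (CModel m) (F.metricCoeff φ i₀ i₁) q v
        + F.metricCoeff φ i₀ i₁ q * (- mvfderiv (CModel m) r q v / r q ^ 2))) := by
    intro v
    rw [mvfderiv_congr_eventually h2, mvfderiv_const_mul_apply _ (g00.sub ((hr.inv h0).mul g01)),
      mvfderiv_sub_apply g00 ((hr.inv h0).mul g01), mvfderiv_mul_apply (hr.inv h0) g01,
      mvfderiv_inv_apply hr h0]
  have h5 : F.eta₂ e i₀ i₁ q = 1 / 2 * (mvfderiv (CModel m) (F.eta e i₁) q (chartField φ i₀ q)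
      + (r q)⁻¹ * mvfderiv (CModel m) (F.eta e i₁) q (chartField φ i₁ q)) := by
    rw [eta₂, he_def, germFrame_zero, map_smul, map_add, map_smul]
    rfl
  have h6 : F.eta₂ e i₁ i₀ q = 1 / 2 * (mvfderiv (CModel m) (F.eta e i₀) q (chartField φ i₀ q)
      - (r q)⁻¹ * mvfderiv (CModel m) (F.eta e i₀) q (chartField φ i₁ q)) := by
    rw [eta₂, he_def, hc.germFrame_one, map_smul, map_sub, map_smul]
    rfl
  have hs := he.eta₂_symm i₀ i₁
  -- The expressions for η_12 and η_21 are exchanged by r ↦ -r. They are equal, so their mean may be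
  -- used, in which the odd powers of r cancel.
  have h7 : F.eta₂ e i₀ i₁ q = 1 / 2 * (F.eta₂ e i₀ i₁ q + F.eta₂ e i₁ i₀ q) := by
    rw [← hs]; ring
  rw [h7, h5, h6, h3, h3, h4, h4]
  simp only [chartDeriv] at hD0 hD1 ⊢
  simp only [hD0, hD1, ← hrq.self_of_nhds]
  field_simp
  ring

end Local

end IsGermChart

end FrobeniusManifold
end

/-! ### The Euler field of the germ and the algebra of the polar part. -/

noncomputable section

namespace FrobeniusManifold

open VectorField

variable {m : ℕ} {M : Type*} [TopologicalSpace M] [ChartedSpace (Fin m → ℂ) M]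
  [IsManifold (CModel m) ω M]
variable {F : FrobeniusManifold m M} {n : ℕ} {p q : M}
  {φ : OpenPartialHomeomorph M (Fin m → ℂ)} {i₀ i₁ : Fin m} {r : M → ℂ}

namespace IsGermChart

/-- In a germ of type `I_2(n) A_1^{m-2}`, the second coefficient of the Euler field is `(2/n) t_2`. -/
theorem eulerCoeff_eq (hc : F.IsGermChart n φ i₀ i₁) (hn : 3 ≤ n) (hp : p ∈ φ.source)
    (hp0 : φ p i₁ = 0) :
    ∀ᶠ q in 𝓝 p, φ q i₁ ≠ 0 → F.eulerCoeff φ i₁ q = 2 / n * φ q i₁ := by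
  obtain ⟨ε, hε, hball⟩ := Metric.isOpen_iff.1 φ.open_target (φ p) (φ.map_source hp)
  have hcont : ContinuousAt φ p := φ.continuousAt hp
  filter_upwards [φ.open_source.mem_nhds hp, hcont.preimage_mem_nhds (Metric.ball_mem_nhds _ hε)]
    with q hq hqb ht
  -- The solutions of t ε' = t - (n-2)/2 · ε are (2/n) t + C t^{-(n-2)/2}, and f is the
  -- single-valued function C². It is locally constant where t ≠ 0 and vanishes at t = 0, as n ≥ 3.
  set f : M → ℂ := fun x => (F.eulerCoeff φ i₁ x - 2 / n * φ x i₁) ^ 2 * φ x i₁ ^ (n - 2) with hf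
  have hholh : ∀ x ∈ φ.source, HolFunctionAt (m := m)
      (fun x => F.eulerCoeff φ i₁ x - 2 / n * φ x i₁) x := fun x hx =>
    (eulerCoeff_hol hc.mem hx i₁).sub
      ((HolFunctionAt.const _ x).mul (holFunctionAt_chart hc.mem hx i₁))
  have hhol : ∀ x ∈ φ.source, HolFunctionAt (m := m) f x := fun x hx =>
    ((hholh x hx).pow 2).mul ((holFunctionAt_chart hc.mem hx i₁).pow _)
  have hn0 : (n : ℂ) ≠ 0 := by
    have : n ≠ 0 := by lia
    exact_mod_cast this
  have hν : ((n - 2 : ℕ) : ℂ) = (n : ℂ) - 2 := by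
    rw [Nat.cast_sub (by lia)]; norm_num
  have hder : ∀ x ∈ φ.source, φ x i₁ ≠ 0 → fderiv ℂ (f ∘ φ.symm) (φ x) = 0 := by
    intro x hx htx
    have ht' := holFunctionAt_chart hc.mem hx i₁
    obtain ⟨r, hr, hrx⟩ := HolFunctionAt.exists_sqrt (ht'.pow (n - 2)) (pow_ne_zero _ htx)
    have hk : ∀ k, mvfderiv (CModel m) f x (chartField φ k x) = 0 := by
      intro k
      have h1 := hc.eulerCoeff_deriv hn hx htx hr hrx k
      have h2 := chartDeriv_chart hc.mem hx k i₁
      have h4 : φ x i₁ ^ (n - 2) = φ x i₁ ^ (n - 2 - 1) * φ x i₁ := by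
        rw [← pow_succ]; congr 1; lia
      rw [chartDeriv] at h1 h2
      rw [hf, mvfderiv_mul_apply ((hholh x hx).pow 2) (ht'.pow _), mvfderiv_pow_apply (hholh x hx),
        mvfderiv_pow_apply ht', mvfderiv_sub_apply (eulerCoeff_hol hc.mem hx i₁)
          ((HolFunctionAt.const _ x).mul ht'), mvfderiv_const_mul_apply _ ht', h2, hν, h4]
      rcases eq_or_ne k i₁ with rfl | hk1
      · rw [if_pos rfl] at h1 ⊢
        push_cast
        simp only [pow_one]
        field_simp
        linear_combination 2 * φ x k ^ (n - 2 - 1) * (F.eulerCoeff φ k x * n - 2 * φ x k) * n * h1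
      · rw [if_neg hk1] at h1
        rw [if_neg hk1.symm, (mul_eq_zero.1 h1).resolve_left htx]
        ring
    have hz : ∀ v : TangentSpace (CModel m) x, mvfderiv (CModel m) f x v = 0 := by
      intro v
      rw [eq_sum_chartField hc.mem hx v, map_sum]
      exact Finset.sum_eq_zero fun k _ => by rw [map_smul, hk, smul_zero]
    ext w
    obtain ⟨v, hv⟩ := (mvfderiv_chart_bijective hc.mem hx).2 w
    rw [← hv]
    exact (mvfderiv_eq_fderiv hc.mem hx (hhol x hx) v).symm.trans (hz v)
  -- The segment from φ q to φ p meets t = 0 only at its end, so f is constant along it, with the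
  -- value f p = 0.
  set z : ℝ → (Fin m → ℂ) := fun s => φ q + s • (φ p - φ q) with hz
  have hzb : ∀ s ∈ Set.Icc (0 : ℝ) 1, z s ∈ Metric.ball (φ p) ε := fun s hs =>
    (convex_ball (φ p) ε).add_smul_sub_mem hqb (Metric.mem_ball_self hε) hs
  have hzs : ∀ s ∈ Set.Icc (0 : ℝ) 1, φ.symm (z s) ∈ φ.source := fun s hs =>
    φ.map_target (hball (hzb s hs))
  have hφz : ∀ s ∈ Set.Icc (0 : ℝ) 1, φ (φ.symm (z s)) = z s := fun s hs =>
    φ.right_inv (hball (hzb s hs))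
  have hzt : ∀ s, z s i₁ = (1 - s) * φ q i₁ := by
    intro s
    simp only [hz, Pi.add_apply, Pi.smul_apply, Pi.sub_apply, hp0, Complex.real_smul]
    ring
  have hdz : ∀ s, HasDerivAt z (φ p - φ q) s := by
    intro s
    have := ((hasDerivAt_id s).smul_const (φ p - φ q)).const_add (φ q)
    rwa [one_smul] at this
  have hfan : ∀ s ∈ Set.Icc (0 : ℝ) 1, AnalyticAt ℂ (f ∘ φ.symm) (z s) := by
    intro s hs
    have := (holFunctionAt_iff hc.mem (hzs s hs)).1 (hhol _ (hzs s hs))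
    rwa [hφz s hs] at this
  have hconst := constant_of_has_deriv_right_zero (f := fun s : ℝ => (f ∘ φ.symm) (z s))
    (a := 0) (b := 1)
    (fun s hs => ((hfan s hs).continuousAt.comp (hdz s).continuousAt).continuousWithinAt)
    (fun s hs => by
      have hs' : s ∈ Set.Icc (0 : ℝ) 1 := ⟨hs.1, hs.2.le⟩
      have h1 := (hfan s hs').differentiableAt.hasFDerivAt
      have h2 : fderiv ℂ (f ∘ φ.symm) (z s) = 0 := by
        have := hder _ (hzs s hs') (by
          rw [hφz s hs', hzt]
          refine mul_ne_zero ?_ ht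
          rw [sub_ne_zero]
          exact_mod_cast hs.2.ne')
        rwa [hφz s hs'] at this
      rw [h2] at h1
      have h3 := (h1.restrictScalars ℝ).comp_hasDerivAt s (hdz s)
      exact (by simpa using h3 : HasDerivAt ((f ∘ φ.symm) ∘ z) 0 s).hasDerivWithinAt)
    1 (by simp)
  have h0 : z 0 = φ q := by simp [hz]
  have h1 : z 1 = φ p := by simp [hz]
  simp only [Function.comp, h0, h1, φ.left_inv hq, φ.left_inv hp] at hconst
  have hfp : f p = 0 := by
    simp only [hf, hp0]
    rw [zero_pow (by lia), mul_zero]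
  rw [hfp] at hconst
  have h5 := (mul_eq_zero.1 hconst.symm).resolve_right (pow_ne_zero _ ht)
  exact sub_eq_zero.1 (pow_eq_zero_iff two_ne_zero |>.1 h5)

end IsGermChart

/-- The left side is invariant under r ↦ -r, which exchanges the first two idempotents. It is
therefore rational in r² = t^{n-2}; its denominator N g comes from η_1 η_2 = -N/(4r²) and does not
vanish at t = 0. -/
theorem germ_odd_part {r N g₀ g₁ g c₁ c₂ a b : ℂ} (hr : r ≠ 0) (hN : N = g₁ ^ 2 - r ^ 2 * g₀ ^ 2)
    (hN0 : N ≠ 0) (hg : g ≠ 0) :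
    (c₁ + r * c₂) * ((1 / 2 * (a + r⁻¹ * b)) ^ 2 / (1 / 2 * (g₀ + r⁻¹ * g₁) * g))
      + (c₁ - r * c₂) * ((1 / 2 * (a - r⁻¹ * b)) ^ 2 / (1 / 2 * (g₀ - r⁻¹ * g₁) * g))
    = -(((r ^ 2 * a ^ 2 + b ^ 2) * (c₁ * g₀ - c₂ * g₁)
        + 2 * a * b * (-c₁ * g₁ + r ^ 2 * c₂ * g₀)) / (N * g)) := by
  have hf : N = -((r * g₀ + g₁) * (r * g₀ - g₁)) := by rw [hN]; ring
  have h1 : r * g₀ + g₁ ≠ 0 := fun h => hN0 (by rw [hf, h]; ring)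
  have h2 : r * g₀ - g₁ ≠ 0 := fun h => hN0 (by rw [hf, h]; ring)
  have e1 : g₀ + r⁻¹ * g₁ = (r * g₀ + g₁) / r := by field_simp
  have e2 : g₀ - r⁻¹ * g₁ = (r * g₀ - g₁) / r := by field_simp
  rw [e1, e2, hf]
  field_simp
  ring

/-- The difference changes sign under r ↦ -r; the factor r, which stems from δ_2 = r(e_1 - e_2),
makes the product rational in r². -/
theorem germ_even_part {r N g₀ g₁ g c₁ c₂ a b : ℂ} (hr : r ≠ 0) (hN : N = g₁ ^ 2 - r ^ 2 * g₀ ^ 2)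
    (hN0 : N ≠ 0) (hg : g ≠ 0) :
    r * ((c₁ + r * c₂) * ((1 / 2 * (a + r⁻¹ * b)) ^ 2 / (1 / 2 * (g₀ + r⁻¹ * g₁) * g))
      - (c₁ - r * c₂) * ((1 / 2 * (a - r⁻¹ * b)) ^ 2 / (1 / 2 * (g₀ - r⁻¹ * g₁) * g)))
    = -(((r ^ 2 * a ^ 2 + b ^ 2) * (-c₁ * g₁ + r ^ 2 * c₂ * g₀)
        + 2 * r ^ 2 * a * b * (c₁ * g₀ - c₂ * g₁)) / (N * g)) := by
  have hf : N = -((r * g₀ + g₁) * (r * g₀ - g₁)) := by rw [hN]; ring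
  have h1 : r * g₀ + g₁ ≠ 0 := fun h => hN0 (by rw [hf, h]; ring)
  have h2 : r * g₀ - g₁ ≠ 0 := fun h => hN0 (by rw [hf, h]; ring)
  have e1 : g₀ + r⁻¹ * g₁ = (r * g₀ + g₁) / r := by field_simp
  have e2 : g₀ - r⁻¹ * g₁ = (r * g₀ - g₁) / r := by field_simp
  rw [e1, e2, hf]
  field_simp
  ring

/-- This is the interaction of the first two idempotents along δ_2: with u_1 - u_2 = 4rt/n, η_12 =
Q/(4tr²) and η_1 η_2 = -N/(4r²) it equals -(2/n) Q²/(tN). Modulo t, Q² is ((n-2)/2)² g_1² and N is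
g_1², whence the polar part; the factor 8 is the inverse of the 1/8 in d log τ_I. -/
theorem germ_singular_part {r t n T' N Q R g₀ g₁ : ℂ} (hr : r ≠ 0) (ht : t ≠ 0) (hn : n ≠ 0)
    (hT : r ^ 2 = T' * t) (hN : N = g₁ ^ 2 - r ^ 2 * g₀ ^ 2) (hN0 : N ≠ 0)
    (hQ : Q = (n - 2) / 2 * g₁ + t * R) :
    r * (2 * (2 * (r * (2 / n * t))) * ((Q / (4 * t * r ^ 2)) ^ 2
        / (1 / 2 * (g₀ + r⁻¹ * g₁) * (1 / 2 * (g₀ - r⁻¹ * g₁)))))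
      = 8 * (-(n - 2) ^ 2 / (16 * n) / t
        - 1 / (4 * n) * (((n - 2) * g₁ * R + t * R ^ 2 + ((n - 2) / 2) ^ 2 * T' * g₀ ^ 2) / N)) := by
  have e1 : 1 / 2 * (g₀ + r⁻¹ * g₁) * (1 / 2 * (g₀ - r⁻¹ * g₁)) = -N / (4 * r ^ 2) := by
    rw [hN]; field_simp; ring
  have e2 : r * (2 * (2 * (r * (2 / n * t))) * ((Q / (4 * t * r ^ 2)) ^ 2 / (-N / (4 * r ^ 2))))
      = -(2 / n) * Q ^ 2 / (t * N) := by
    field_simp; ring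
  rw [e1, e2]
  have e3 : Q ^ 2 = ((n - 2) / 2) ^ 2 * (N + T' * t * g₀ ^ 2) + (n - 2) * g₁ * R * t + t ^ 2 * R ^ 2 := by
    rw [hN, hQ, hT]; ring
  rw [e3]
  field_simp
  ring

end FrobeniusManifold
end

/-! ### The coefficients of d log τ_I near a generic point of the caustic. -/

noncomputable section

namespace FrobeniusManifold

open VectorField

variable {m : ℕ} {M : Type*} [TopologicalSpace M] [ChartedSpace (Fin m → ℂ) M]
  [IsManifold (CModel m) ω M]

section Coefficients

variable (F : FrobeniusManifold m M) (n : ℕ) (φ : OpenPartialHomeomorph M (Fin m → ℂ))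
  (i₀ i₁ : Fin m)

/-- The negative of the determinant of the metric on the two-dimensional factor of
`I_2(n) A_1^{m-2}`. -/
def germDet (q : M) : ℂ :=
  F.metricCoeff φ i₀ i₁ q ^ 2 - φ q i₁ ^ (n - 2) * F.metricCoeff φ i₀ i₀ q ^ 2

/-- The part of `η_{12}` which is regular after multiplication with `t_2^{n-2}`. -/
def germRegular (q : M) : ℂ :=
  φ q i₁ ^ (n - 2) * chartDeriv φ i₀ (F.metricCoeff φ i₀ i₀) q
    - chartDeriv φ i₁ (F.metricCoeff φ i₀ i₁) q

/-- The interaction of the `j`-th one-dimensional factor with the sum of the first two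
idempotents. -/
def germOdd (j : Fin m) (q : M) : ℂ :=
  ((φ q i₁ ^ (n - 2) * chartDeriv φ i₀ (F.metricCoeff φ j j) q ^ 2
      + chartDeriv φ i₁ (F.metricCoeff φ j j) q ^ 2)
    * ((F.eulerCoeff φ i₀ q - F.eulerCoeff φ j q) * F.metricCoeff φ i₀ i₀ q
      - F.eulerCoeff φ i₁ q * F.metricCoeff φ i₀ i₁ q)
    + 2 * chartDeriv φ i₀ (F.metricCoeff φ j j) q * chartDeriv φ i₁ (F.metricCoeff φ j j) q
      * (-(F.eulerCoeff φ i₀ q - F.eulerCoeff φ j q) * F.metricCoeff φ i₀ i₁ q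
        + φ q i₁ ^ (n - 2) * F.eulerCoeff φ i₁ q * F.metricCoeff φ i₀ i₀ q))
    / (F.germDet n φ i₀ i₁ q * F.metricCoeff φ j j q)

/-- The interaction of the `j`-th one-dimensional factor with the difference of the first two
idempotents. -/
def germEven (j : Fin m) (q : M) : ℂ :=
  ((φ q i₁ ^ (n - 2) * chartDeriv φ i₀ (F.metricCoeff φ j j) q ^ 2
      + chartDeriv φ i₁ (F.metricCoeff φ j j) q ^ 2)
    * (-(F.eulerCoeff φ i₀ q - F.eulerCoeff φ j q) * F.metricCoeff φ i₀ i₁ q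
      + φ q i₁ ^ (n - 2) * F.eulerCoeff φ i₁ q * F.metricCoeff φ i₀ i₀ q)
    + 2 * φ q i₁ ^ (n - 2) * chartDeriv φ i₀ (F.metricCoeff φ j j) q
      * chartDeriv φ i₁ (F.metricCoeff φ j j) q
      * ((F.eulerCoeff φ i₀ q - F.eulerCoeff φ j q) * F.metricCoeff φ i₀ i₀ q
        - F.eulerCoeff φ i₁ q * F.metricCoeff φ i₀ i₁ q))
    / (F.germDet n φ i₀ i₁ q * F.metricCoeff φ j j q)

/-- The coefficients of the regular part of `d log τ_I`. -/
def germCoeff (k : Fin m) (q : M) : ℂ :=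
  if k = i₀ then -(1 / 8 * ∑ j ∈ (Finset.univ.erase i₀).erase i₁, F.germOdd n φ i₀ i₁ j q)
  else if k = i₁ then
    -(1 / (4 * n) * ((((n : ℂ) - 2) * F.metricCoeff φ i₀ i₁ q * F.germRegular n φ i₀ i₁ q
      + φ q i₁ * F.germRegular n φ i₀ i₁ q ^ 2
      + (((n : ℂ) - 2) / 2) ^ 2 * φ q i₁ ^ (n - 3) * F.metricCoeff φ i₀ i₀ q ^ 2)
        / F.germDet n φ i₀ i₁ q))
      - 1 / 8 * ∑ j ∈ (Finset.univ.erase i₀).erase i₁, F.germEven n φ i₀ i₁ j q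
  else 1 / 8 * (F.germOdd n φ i₀ i₁ k q + ∑ l ∈ ((Finset.univ.erase i₀).erase i₁).erase k,
    (F.eulerCoeff φ k q - F.eulerCoeff φ l q) * (chartDeriv φ k (F.metricCoeff φ l l) q ^ 2
      / (F.metricCoeff φ k k q * F.metricCoeff φ l l q)))

end Coefficients

variable {F : FrobeniusManifold m M} {n : ℕ} {p q : M}
  {φ : OpenPartialHomeomorph M (Fin m → ℂ)} {i₀ i₁ : Fin m} {r : M → ℂ}

namespace IsGermChart

variable (hc : F.IsGermChart n φ i₀ i₁) (hn : 3 ≤ n)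
include hc hn

theorem germDet_hol (hq : q ∈ φ.source) : HolFunctionAt (m := m) (F.germDet n φ i₀ i₁) q :=
  ((metricCoeff_hol hc.mem hq _ _).pow 2).sub
    (((holFunctionAt_chart hc.mem hq i₁).pow _).mul ((metricCoeff_hol hc.mem hq _ _).pow 2))

theorem germDet_ne_zero (hp : p ∈ φ.source) (hp0 : φ p i₁ = 0) : F.germDet n φ i₀ i₁ p ≠ 0 := by
  rw [germDet, hp0, zero_pow (by lia), zero_mul, sub_zero]
  exact pow_ne_zero _ (hc.metric_zero_one_ne_zero hn hp hp0)

theorem germCoeff_hol (hp : p ∈ φ.source) (hp0 : φ p i₁ = 0) (k : Fin m) :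
    HolFunctionAt (m := m) (F.germCoeff n φ i₀ i₁ k) p := by
  have g := fun k l => metricCoeff_hol (F := F) hc.mem hp k l
  have dg := fun j k l => chartDeriv_hol hc.mem hp (g k l) j
  have E := fun k => eulerCoeff_hol (F := F) hc.mem hp k
  have t := holFunctionAt_chart hc.mem hp i₁
  have T := t.pow (n - 2)
  have N := hc.germDet_hol hn hp
  have N0 := hc.germDet_ne_zero hn hp hp0
  have c := fun a : ℂ => HolFunctionAt.const (m := m) a p
  have R : HolFunctionAt (m := m) (F.germRegular n φ i₀ i₁) p := (T.mul (dg _ _ _)).sub (dg _ _ _)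
  have g0 : ∀ j ∈ (Finset.univ.erase i₀).erase i₁, F.metricCoeff φ j j p ≠ 0 := by
    intro j hj
    simp only [Finset.mem_erase, Finset.mem_univ, and_true] at hj
    exact hc.metric_self_ne_zero hp hj.2 hj.1
  have hodd : ∀ j ∈ (Finset.univ.erase i₀).erase i₁,
      HolFunctionAt (m := m) (F.germOdd n φ i₀ i₁ j) p := fun j hj =>
    ((((T.mul ((dg _ _ _).pow 2)).add ((dg _ _ _).pow 2)).mul ((((E _).sub (E _)).mul (g _ _)).sub
      ((E _).mul (g _ _)))).add ((((c 2).mul (dg _ _ _)).mul (dg _ _ _)).mul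
      ((((E _).sub (E _)).neg.mul (g _ _)).add ((T.mul (E _)).mul (g _ _))))).div (N.mul (g j j))
      (mul_ne_zero N0 (g0 j hj))
  have heven : ∀ j ∈ (Finset.univ.erase i₀).erase i₁,
      HolFunctionAt (m := m) (F.germEven n φ i₀ i₁ j) p := fun j hj =>
    ((((T.mul ((dg _ _ _).pow 2)).add ((dg _ _ _).pow 2)).mul ((((E _).sub (E _)).neg.mul
      (g _ _)).add ((T.mul (E _)).mul (g _ _)))).add (((((c 2).mul T).mul (dg _ _ _)).mul
      (dg _ _ _)).mul ((((E _).sub (E _)).mul (g _ _)).sub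
      ((E _).mul (g _ _))))).div (N.mul (g j j)) (mul_ne_zero N0 (g0 j hj))
  unfold germCoeff
  split_ifs with h0 h1
  · exact ((c _).mul (HolFunctionAt.sum hodd)).neg
  · exact ((c _).mul ((((((c _).mul (g _ _)).mul R).add (t.mul (R.pow 2))).add (((c _).mul
      (t.pow _)).mul ((g _ _).pow 2))).div N N0)).neg.sub ((c _).mul (HolFunctionAt.sum heven))
  · refine (c _).mul ((hodd k (by simp [h0, h1])).add (HolFunctionAt.sum fun l hl => ?_))
    exact ((E _).sub (E _)).mul (((dg _ _ _).pow 2).div ((g _ _).mul (g _ _))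
      (mul_ne_zero (g0 k (by simp [h0, h1])) (g0 l (Finset.mem_of_mem_erase hl))))

/-- The coordinate fields are δ_1 = e_1 + e_2, δ_2 = r(e_1 - e_2) and δ_k = e_k. The contribution of
the pair (1,2) is antisymmetric, so it cancels along δ_1 and doubles along δ_2, where it produces
the only pole. All other contributions are the regular symmetrized sums. -/
theorem dLogTau_chartField (hq : q ∈ φ.source) (ht : φ q i₁ ≠ 0) (hN : F.germDet n φ i₀ i₁ q ≠ 0)
    (hE : F.eulerCoeff φ i₁ q = 2 / n * φ q i₁) (k : Fin m) :
    F.dLogTau q (chartField φ k q) = F.germCoeff n φ i₀ i₁ k q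
      + if k = i₁ then -((n : ℂ) - 2) ^ 2 / (16 * n) / φ q i₁ else 0 := by
  have ht' := holFunctionAt_chart hc.mem hq i₁
  obtain ⟨r, hr, hrq⟩ := HolFunctionAt.exists_sqrt (ht'.pow (n - 2)) (pow_ne_zero _ ht)
  have h0 := hc.sqrt_ne_zero hn hq ht hr hrq
  have hrq' := hrq.self_of_nhds
  have he := hc.isIdemFrame_germFrame hq hr hrq h0
  have hn0 : (n : ℂ) ≠ 0 := by
    have : n ≠ 0 := by lia
    exact_mod_cast this
  -- Here r²/t = t^{n-3} is still regular, since n ≥ 3.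
  have hT : r q ^ 2 = φ q i₁ ^ (n - 3) * φ q i₁ := by
    rw [hrq', ← pow_succ]; congr 1; lia
  have hNr : F.germDet n φ i₀ i₁ q
      = F.metricCoeff φ i₀ i₁ q ^ 2 - r q ^ 2 * F.metricCoeff φ i₀ i₀ q ^ 2 := by
    rw [germDet, hrq']
  have hg : ∀ j ∈ (Finset.univ.erase i₀).erase i₁, F.metricCoeff φ j j q ≠ 0 := by
    intro j hj
    simp only [Finset.mem_erase, Finset.mem_univ, and_true] at hj
    exact hc.metric_self_ne_zero hq hj.2 hj.1
  have hu0 := hc.canonicalCoord_germFrame hq h0 hrq' i₀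
  have hu1 := hc.canonicalCoord_germFrame hq h0 hrq' i₁
  rw [if_pos rfl] at hu0
  rw [if_neg hc.ne.symm, if_pos rfl] at hu1
  have huj : ∀ j ∈ (Finset.univ.erase i₀).erase i₁,
      F.canonicalCoord (germFrame φ i₀ i₁ r) j q = F.eulerCoeff φ j q := by
    intro j hj
    simp only [Finset.mem_erase, Finset.mem_univ, and_true] at hj
    rw [hc.canonicalCoord_germFrame hq h0 hrq' j, if_neg hj.2, if_neg hj.1]
  have hη0 := hc.eta_germFrame_zero hq h0 hrq'
  have hη1 := hc.eta_germFrame_one hq h0 hrq'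
  have hηj : ∀ j ∈ (Finset.univ.erase i₀).erase i₁,
      F.eta (germFrame φ i₀ i₁ r) j q = F.metricCoeff φ j j q := by
    intro j hj
    simp only [Finset.mem_erase, Finset.mem_univ, and_true] at hj
    rw [eta, germFrame_of_ne hj.2 hj.1, metricCoeff]
  have h2 : ∀ j ∈ (Finset.univ.erase i₀).erase i₁, _ := fun j hj => by
    simp only [Finset.mem_erase, Finset.mem_univ, and_true] at hj
    exact hc.eta₂_germFrame (r := r) (q := q) hj.2 hj.1
  have h01 := hc.eta₂_germFrame_zero_one hn hq ht hr hrq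
  have hsymm := he.eta₂_symm
  set e := germFrame φ i₀ i₁ r with he_def
  have hm0 : i₁ ∈ Finset.univ.erase i₀ := by simp [hc.ne.symm]
  have hm1 : i₀ ∈ Finset.univ.erase i₁ := by simp [hc.ne]
  have hodd : ∀ j ∈ (Finset.univ.erase i₀).erase i₁,
      (F.canonicalCoord e i₀ q - F.canonicalCoord e j q)
          * (F.eta₂ e i₀ j q ^ 2 / (F.eta e i₀ q * F.eta e j q))
        + (F.canonicalCoord e i₁ q - F.canonicalCoord e j q)
          * (F.eta₂ e i₁ j q ^ 2 / (F.eta e i₁ q * F.eta e j q))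
        = -F.germOdd n φ i₀ i₁ j q := by
    intro j hj
    have h := germ_odd_part (c₁ := F.eulerCoeff φ i₀ q - F.eulerCoeff φ j q)
      (c₂ := F.eulerCoeff φ i₁ q) (a := chartDeriv φ i₀ (F.metricCoeff φ j j) q)
      (b := chartDeriv φ i₁ (F.metricCoeff φ j j) q) h0 hNr hN (hg j hj)
    rw [hu0, hu1, huj j hj, hη0, hη1, hηj j hj, (h2 j hj).1, (h2 j hj).2.1, germOdd, ← hrq', ← h]
    ring
  have heven : ∀ j ∈ (Finset.univ.erase i₀).erase i₁,
      r q * ((F.canonicalCoord e i₀ q - F.canonicalCoord e j q)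
          * (F.eta₂ e i₀ j q ^ 2 / (F.eta e i₀ q * F.eta e j q))
        - (F.canonicalCoord e i₁ q - F.canonicalCoord e j q)
          * (F.eta₂ e i₁ j q ^ 2 / (F.eta e i₁ q * F.eta e j q)))
        = -F.germEven n φ i₀ i₁ j q := by
    intro j hj
    have h := germ_even_part (c₁ := F.eulerCoeff φ i₀ q - F.eulerCoeff φ j q)
      (c₂ := F.eulerCoeff φ i₁ q) (a := chartDeriv φ i₀ (F.metricCoeff φ j j) q)
      (b := chartDeriv φ i₁ (F.metricCoeff φ j j) q) h0 hNr hN (hg j hj)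
    rw [hu0, hu1, huj j hj, hη0, hη1, hηj j hj, (h2 j hj).1, (h2 j hj).2.1, germEven, ← hrq', ← h]
    ring
  have hτ0 : F.tauCoeff e i₀ q = 1 / 8 * ((F.canonicalCoord e i₀ q - F.canonicalCoord e i₁ q)
      * (F.eta₂ e i₀ i₁ q ^ 2 / (F.eta e i₀ q * F.eta e i₁ q))
      + ∑ j ∈ (Finset.univ.erase i₀).erase i₁, (F.canonicalCoord e i₀ q - F.canonicalCoord e j q)
          * (F.eta₂ e i₀ j q ^ 2 / (F.eta e i₀ q * F.eta e j q))) := by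
    rw [tauCoeff, ← Finset.add_sum_erase _ _ hm0]
  have hτ1 : F.tauCoeff e i₁ q = 1 / 8 * (-(F.canonicalCoord e i₀ q - F.canonicalCoord e i₁ q)
      * (F.eta₂ e i₀ i₁ q ^ 2 / (F.eta e i₀ q * F.eta e i₁ q))
      + ∑ j ∈ (Finset.univ.erase i₀).erase i₁, (F.canonicalCoord e i₁ q - F.canonicalCoord e j q)
          * (F.eta₂ e i₁ j q ^ 2 / (F.eta e i₁ q * F.eta e j q))) := by
    rw [tauCoeff, ← Finset.add_sum_erase _ _ hm1, Finset.erase_right_comm, hsymm i₀ i₁]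
    ring
  unfold germCoeff
  by_cases hk0 : k = i₀
  · subst hk0
    have hs := Finset.sum_congr rfl hodd
    rw [Finset.sum_add_distrib, Finset.sum_neg_distrib] at hs
    rw [hc.chartField_zero_eq r q, map_add, ← he_def, he.dLogTau_apply, he.dLogTau_apply, hτ0, hτ1,
      if_pos rfl, if_neg hc.ne]
    linear_combination 1 / 8 * hs
  by_cases hk1 : k = i₁
  · subst hk1
    have hs := germ_singular_part (g₀ := F.metricCoeff φ i₀ i₀ q) h0 ht hn0 hT hNr hN
      (R := F.germRegular n φ i₀ k q) rfl
    have hs' := Finset.sum_congr rfl heven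
    rw [← Finset.mul_sum, Finset.sum_sub_distrib, Finset.sum_neg_distrib] at hs'
    have hu : F.canonicalCoord e i₀ q - F.canonicalCoord e k q = 2 * (r q * (2 / n * φ q k)) := by
      rw [hu0, hu1, hE]; ring
    rw [← hrq'] at h01
    have h01' : F.eta₂ e i₀ k q = (((n : ℂ) - 2) / 2 * F.metricCoeff φ i₀ k q
        + φ q k * F.germRegular n φ i₀ k q) / (4 * φ q k * r q ^ 2) := by
      rw [h01, germRegular, ← hrq']
    rw [← hη0, ← hη1, ← h01', ← hu] at hs
    rw [hc.chartField_one_eq hq h0, map_smul, map_sub, ← he_def, he.dLogTau_apply,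
      he.dLogTau_apply, hτ0, hτ1, if_neg hk0, if_pos rfl, if_pos rfl, smul_eq_mul]
    linear_combination 1 / 8 * hs + 1 / 8 * hs'
  · have hk : k ∈ (Finset.univ.erase i₀).erase i₁ := by simp [hk0, hk1]
    have hmk0 : i₀ ∈ Finset.univ.erase k := by simp [Ne.symm hk0]
    have hmk1 : i₁ ∈ (Finset.univ.erase k).erase i₀ := by simp [Ne.symm hk1, hc.ne.symm]
    have hset : ((Finset.univ.erase k).erase i₀).erase i₁
        = ((Finset.univ.erase i₀).erase i₁).erase k := by
      ext j; simp only [Finset.mem_erase, Finset.mem_univ, and_true]; tauto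
    rw [← germFrame_of_ne hk0 hk1 r q, ← he_def, he.dLogTau_apply, tauCoeff,
      ← Finset.add_sum_erase _ _ hmk0, ← Finset.add_sum_erase _ _ hmk1, hset, if_neg hk0,
      if_neg hk1, if_neg hk1, add_zero, ← add_assoc]
    congr 2
    · have h := hodd k hk
      rw [hsymm k i₀, hsymm k i₁]
      linear_combination -h
    · refine Finset.sum_congr rfl fun l hl => ?_
      have hl' := Finset.mem_of_mem_erase hl
      rw [huj k hk, huj l hl', hηj k hk, hηj l hl', (h2 l hl').2.2 k hk0 hk1]

end IsGermChart

end FrobeniusManifold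
end

/-! ### Forms in a chart, the volume of the germ and the expansion at generic points. -/

noncomputable section

section ChartForm

variable {m : ℕ} {M : Type*} [TopologicalSpace M] [ChartedSpace (Fin m → ℂ) M]
  [IsManifold (CModel m) ω M] {φ : OpenPartialHomeomorph M (Fin m → ℂ)} {p q : M}

/-- The 1-form with the given coefficients in the chart `φ`. -/
def chartForm (φ : OpenPartialHomeomorph M (Fin m → ℂ)) (b : Fin m → M → ℂ) (q : M) :
    TangentSpace (CModel m) q →L[ℂ] ℂ :=
  ∑ k, b k q • mvfderiv (CModel m) (fun x => φ x k) q

theorem chartForm_apply (hφ : φ ∈ IsManifold.maximalAtlas (CModel m) ω M) (hq : q ∈ φ.source)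
    (b : Fin m → M → ℂ) (k : Fin m) : chartForm φ b q (chartField φ k q) = b k q := by
  have h1 : chartForm φ b q (chartField φ k q)
      = ∑ l, b l q * mvfderiv (CModel m) (fun x => φ x l) q (chartField φ k q) := by
    rw [chartForm, sum_apply]
    rfl
  rw [h1, Finset.sum_eq_single k]
  · rw [mvfderiv_chart_apply hφ hq, mvfderiv_chartField hφ hq, Pi.single_eq_same, mul_one]
  · intro l _ hl
    rw [mvfderiv_chart_apply hφ hq, mvfderiv_chartField hφ hq, Pi.single_eq_of_ne hl, mul_zero]
  · simp

theorem chartForm_hol (hφ : φ ∈ IsManifold.maximalAtlas (CModel m) ω M) (hq : q ∈ φ.source)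
    {b : Fin m → M → ℂ} (hb : ∀ k, HolFunctionAt (m := m) (b k) q) :
    HolFormAt (chartForm φ b) q := by
  rw [holFormAt_iff_chart hφ hq]
  intro k
  refine (hb k).congr ?_
  filter_upwards [φ.open_source.mem_nhds hq] with x hx using chartForm_apply hφ hx b k

theorem form_ext_chart (hφ : φ ∈ IsManifold.maximalAtlas (CModel m) ω M) (hq : q ∈ φ.source)
    {α β : TangentSpace (CModel m) q →L[ℂ] ℂ}
    (h : ∀ k, α (chartField φ k q) = β (chartField φ k q)) : α = β := by
  ext v
  rw [eq_sum_chartField hφ hq v, map_sum, map_sum]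
  exact Finset.sum_congr rfl fun k _ => by rw [map_smul, map_smul, h]

theorem eventually_symm (hp : p ∈ φ.source) {P : M → Prop} (h : ∀ᶠ q in 𝓝 p, P q) :
    ∀ᶠ z in 𝓝 (φ p), P (φ.symm z) := by
  have h1 := φ.continuousAt_symm (φ.map_source hp)
  rw [ContinuousAt, φ.left_inv hp] at h1
  exact h1.eventually h

theorem holFunctionAt_comp_chart (hφ : φ ∈ IsManifold.maximalAtlas (CModel m) ω M)
    (hp : p ∈ φ.source) {f : (Fin m → ℂ) → ℂ} (hf : AnalyticAt ℂ f (φ p)) :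
    HolFunctionAt (m := m) (fun q => f (φ q)) p := by
  rw [holFunctionAt_iff hφ hp]
  refine hf.congr ?_
  filter_upwards [φ.open_target.mem_nhds (φ.map_source hp)] with z hz
  simp only [Function.comp, φ.right_inv hz]

/-- A function which vanishes where a coordinate vanishes is divisible by this coordinate. -/
theorem exists_eq_coord_mul (hφ : φ ∈ IsManifold.maximalAtlas (CModel m) ω M)
    (hp : p ∈ φ.source) {i : Fin m} (hp0 : φ p i = 0) {f : M → ℂ}
    (hf : HolFunctionAt (m := m) f p) (hf0 : ∀ᶠ q in 𝓝 p, φ q i = 0 → f q = 0) :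
    ∃ v : M → ℂ, HolFunctionAt (m := m) v p ∧ ∀ᶠ q in 𝓝 p, f q = φ q i * v q := by
  obtain ⟨v, hv, hfv⟩ := AnalyticAt.exists_eq_linear_mul
    (ℓ := (ContinuousLinearMap.proj i : (Fin m → ℂ) →L[ℂ] ℂ)) (w := Pi.single i 1)
    ((holFunctionAt_iff hφ hp).1 hf) (by simp) hp0 (by
      filter_upwards [eventually_symm hp hf0, φ.open_target.mem_nhds (φ.map_source hp)]
        with z hz hzt h0
      rw [φ.right_inv hzt] at hz
      exact hz h0)
  refine ⟨fun q => v (φ q), holFunctionAt_comp_chart hφ hp hv, ?_⟩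
  filter_upwards [(φ.continuousAt hp).eventually hfv, φ.open_source.mem_nhds hp] with q hq hqs
  simpa only [Function.comp, φ.left_inv hqs, ContinuousLinearMap.proj_apply] using hq

end ChartForm

namespace FrobeniusManifold

variable {m : ℕ} {M : Type*} [TopologicalSpace M] [ChartedSpace (Fin m → ℂ) M]
  [IsManifold (CModel m) ω M]

/-- The product of the volume with `t_2^{n-2}`, in a germ of type `I_2(n) A_1^{m-2}`. -/
def germVol (F : FrobeniusManifold m M) (n : ℕ) (φ : OpenPartialHomeomorph M (Fin m → ℂ))
    (i₀ i₁ : Fin m) (q : M) : ℂ :=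
  -(1 / 4) * F.germDet n φ i₀ i₁ q
    * ∏ j ∈ (Finset.univ.erase i₀).erase i₁, F.metricCoeff φ j j q

variable {F : FrobeniusManifold m M} {n : ℕ} {p q : M}
  {φ : OpenPartialHomeomorph M (Fin m → ℂ)} {i₀ i₁ : Fin m}

namespace IsGermChart

variable (hc : F.IsGermChart n φ i₀ i₁) (hn : 3 ≤ n)
include hc hn

theorem germVol_hol (hq : q ∈ φ.source) : HolFunctionAt (m := m) (F.germVol n φ i₀ i₁) q :=
  ((HolFunctionAt.const _ q).mul (hc.germDet_hol hn hq)).mul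
    (HolFunctionAt.prod fun _ _ => metricCoeff_hol hc.mem hq _ _)

theorem germVol_ne_zero (hp : p ∈ φ.source) (hp0 : φ p i₁ = 0) : F.germVol n φ i₀ i₁ p ≠ 0 := by
  refine mul_ne_zero (mul_ne_zero (by norm_num) (hc.germDet_ne_zero hn hp hp0))
    (Finset.prod_ne_zero_iff.2 fun j hj => ?_)
  simp only [Finset.mem_erase, Finset.mem_univ, and_true] at hj
  exact hc.metric_self_ne_zero hp hj.2 hj.1

theorem semisimpleAt (hq : q ∈ φ.source) (ht : φ q i₁ ≠ 0) : F.SemisimpleAt q := by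
  have ht' := holFunctionAt_chart hc.mem hq i₁
  obtain ⟨r, hr, hrq⟩ := HolFunctionAt.exists_sqrt (ht'.pow (n - 2)) (pow_ne_zero _ ht)
  have h0 := hc.sqrt_ne_zero hn hq ht hr hrq
  exact (hc.isIdemBasis_germFrame hq h0 hrq.self_of_nhds).semisimpleAt

/-- The first two factors have the product η_1 η_2 = -N/(4 t_2^{n-2}), and the others are unchanged.
So -(1/48) d log ∏ η_i contributes the residue (n-2)/48. -/
theorem vol_eq (hq : q ∈ φ.source) (ht : φ q i₁ ≠ 0) :
    F.vol q = F.germVol n φ i₀ i₁ q / φ q i₁ ^ (n - 2) := by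
  have ht' := holFunctionAt_chart hc.mem hq i₁
  obtain ⟨r, hr, hrq⟩ := HolFunctionAt.exists_sqrt (ht'.pow (n - 2)) (pow_ne_zero _ ht)
  have h0 := hc.sqrt_ne_zero hn hq ht hr hrq
  have hrq' := hrq.self_of_nhds
  have hη0 := hc.eta_germFrame_zero hq h0 hrq'
  have hη1 := hc.eta_germFrame_one hq h0 hrq'
  have hm0 : i₁ ∈ Finset.univ.erase i₀ := by simp [hc.ne.symm]
  rw [(hc.isIdemBasis_germFrame hq h0 hrq').vol_eq, ← Finset.mul_prod_erase _ _
    (Finset.mem_univ i₀), ← Finset.mul_prod_erase _ _ hm0, germVol, germDet]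
  simp only [eta] at hη0 hη1
  rw [hη0, hη1, ← hrq', Finset.prod_congr rfl (g := fun j => F.metricCoeff φ j j q)]
  · field_simp
    ring
  · intro j hj
    simp only [Finset.mem_erase, Finset.mem_univ, and_true] at hj
    rw [germFrame_of_ne hj.2 hj.1, metricCoeff]

theorem gForm_chartField (hq : q ∈ φ.source) (ht : φ q i₁ ≠ 0) (hW : F.germVol n φ i₀ i₁ q ≠ 0)
    (k : Fin m) :
    F.gForm q (chartField φ k q) = F.dLogTau q (chartField φ k q)
      - 1 / 48 * (chartDeriv φ k (F.germVol n φ i₀ i₁) q / F.germVol n φ i₀ i₁ q)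
      + if k = i₁ then ((n : ℂ) - 2) / 48 / φ q i₁ else 0 := by
  have ht' := holFunctionAt_chart hc.mem hq i₁
  have hWh := hc.germVol_hol hn hq
  have hv : ∀ᶠ x in 𝓝 q, F.vol x = F.germVol n φ i₀ i₁ x / φ x i₁ ^ (n - 2) := by
    filter_upwards [φ.open_source.mem_nhds hq, ht'.eventually_ne ht] with x hx hx'
    exact hc.vol_eq hn hx hx'
  have hν : ((n - 2 : ℕ) : ℂ) = (n : ℂ) - 2 := by
    rw [Nat.cast_sub (by lia)]; norm_num
  have h4 : φ q i₁ ^ (n - 2) = φ q i₁ ^ (n - 2 - 1) * φ q i₁ := by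
    rw [← pow_succ]; congr 1; lia
  have h2 := chartDeriv_chart hc.mem hq k i₁
  rw [chartDeriv] at h2
  have h6 : F.gForm q (chartField φ k q) = F.dLogTau q (chartField φ k q)
      - 1 / 48 * (F.vol q)⁻¹ * mvfderiv (CModel m) F.vol q (chartField φ k q) := rfl
  rw [h6, mvfderiv_congr_eventually hv, mvfderiv_div_apply hWh (ht'.pow _) (pow_ne_zero _ ht),
    mvfderiv_pow_apply ht', h2, hν, hv.self_of_nhds, h4, chartDeriv]
  have h7 : φ q i₁ ^ (n - 2 - 1) ≠ 0 := pow_ne_zero _ ht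
  rcases eq_or_ne k i₁ with rfl | hk
  · simp only [if_true]
    field_simp
    ring
  · rw [if_neg hk, if_neg hk.symm]
    field_simp
    ring

end IsGermChart

/-- Near a point where the germ is of type `I_2(n) A_1^{m-2}`, the form `d log τ_I` and the
differential of the G-function have a simple pole along the caustic. -/
theorem HasGermI2.exists_expansion (h : F.HasGermI2 n p) (hn : 3 ≤ n) :
    ∃ (t : M → ℂ) (β β' : ∀ q : M, TangentSpace (CModel m) q →L[ℂ] ℂ),
      HolFunctionAt (m := m) t p ∧ t p = 0 ∧ mvfderiv (CModel m) t p ≠ 0 ∧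
      HolFormAt β p ∧ HolFormAt β' p ∧
      (∀ f : M → ℂ, HolFunctionAt (m := m) f p → (∀ᶠ q in 𝓝 p, t q = 0 → f q = 0) →
        ∃ v : M → ℂ, HolFunctionAt (m := m) v p ∧ ∀ᶠ q in 𝓝 p, f q = t q * v q) ∧
      ∀ᶠ q in 𝓝 p, (q ∈ F.caustic ↔ t q = 0) ∧ (t q ≠ 0 →
        F.dLogTau q = (-((n : ℂ) - 2) ^ 2 / (16 * n) / t q) • mvfderiv (CModel m) t q + β q ∧
        F.gForm q = ((-((n : ℂ) - 2) ^ 2 / (16 * n) + ((n : ℂ) - 2) / 48) / t q)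
          • mvfderiv (CModel m) t q + β' q) := by
  obtain ⟨φ, i₀, i₁, hc, hp, hp0⟩ := h.exists_isGermChart
  have hp0 : φ p i₁ = 0 := congrFun hp0 i₁
  have hWp := hc.germVol_ne_zero hn hp hp0
  have hW := hc.germVol_hol hn hp
  have ht' := holFunctionAt_chart hc.mem hp i₁
  refine ⟨fun q => φ q i₁, chartForm φ (F.germCoeff n φ i₀ i₁),
    chartForm φ fun k q => F.germCoeff n φ i₀ i₁ k q
      - 1 / 48 * (chartDeriv φ k (F.germVol n φ i₀ i₁) q / F.germVol n φ i₀ i₁ q),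
    ht', hp0, fun h0 => ?_, chartForm_hol hc.mem hp (hc.germCoeff_hol hn hp hp0),
    chartForm_hol hc.mem hp fun k => (hc.germCoeff_hol hn hp hp0 k).sub
      ((HolFunctionAt.const _ p).mul ((chartDeriv_hol hc.mem hp hW k).div hW hWp)),
    fun f hf hf0 => exists_eq_coord_mul hc.mem hp hp0 hf hf0, ?_⟩
  · have h1 := chartDeriv_chart hc.mem hp i₁ i₁
    rw [chartDeriv, h0, if_pos rfl] at h1
    exact zero_ne_one h1
  · filter_upwards [φ.open_source.mem_nhds hp, hW.eventually_ne hWp, hc.eulerCoeff_eq hn hp hp0,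
      (hc.germDet_hol hn hp).eventually_ne (hc.germDet_ne_zero hn hp hp0)] with q hq hWq hE hN
    refine ⟨⟨fun hK => ?_, fun ht => hc.not_semisimpleAt hn hq ht⟩, fun ht => ?_⟩
    · by_contra ht
      exact hK (hc.semisimpleAt hn hq ht)
    have hk := hc.dLogTau_chartField hn hq ht hN (hE ht)
    have hd : ∀ k, mvfderiv (CModel m) (fun q => φ q i₁) q (chartField φ k q)
        = if i₁ = k then 1 else 0 := fun k => chartDeriv_chart hc.mem hq k i₁
    constructor
    · refine form_ext_chart hc.mem hq fun k => ?_
      change _ = _ * mvfderiv (CModel m) (fun q => φ q i₁) q (chartField φ k q)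
        + chartForm φ _ q (chartField φ k q)
      rw [hk, hd, chartForm_apply hc.mem hq]
      rcases eq_or_ne k i₁ with rfl | hk1
      · rw [if_pos rfl, if_pos rfl]; ring
      · rw [if_neg hk1, if_neg hk1.symm]; ring
    · refine form_ext_chart hc.mem hq fun k => ?_
      change _ = _ * mvfderiv (CModel m) (fun q => φ q i₁) q (chartField φ k q)
        + chartForm φ _ q (chartField φ k q)
      rw [hc.gForm_chartField hn hq ht hWq, hk, hd, chartForm_apply hc.mem hq]
      rcases eq_or_ne k i₁ with rfl | hk1
      · simp only [if_true]; ring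
      · rw [if_neg hk1, if_neg hk1, if_neg hk1.symm]; ring

end FrobeniusManifold
end

/-! ### Extension of forms over the caustic from its generic points. -/

noncomputable section

section FormOps

variable {m : ℕ} {M : Type*} [TopologicalSpace M] [ChartedSpace (Fin m → ℂ) M]
  [IsManifold (CModel m) ω M] {p q : M} {α β : ∀ q : M, TangentSpace (CModel m) q →L[ℂ] ℂ}
  {f : M → ℂ}

theorem HolFormAt.add (hα : HolFormAt α p) (hβ : HolFormAt β p) :
    HolFormAt (fun q => α q + β q) p :=
  fun X hX => (hα X hX).add (hβ X hX)

theorem HolFormAt.sub (hα : HolFormAt α p) (hβ : HolFormAt β p) :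
    HolFormAt (fun q => α q - β q) p :=
  fun X hX => (hα X hX).sub (hβ X hX)

theorem HolFormAt.smul (hf : HolFunctionAt (m := m) f p) (hα : HolFormAt α p) :
    HolFormAt (fun q => f q • α q) p :=
  fun X hX => hf.mul (hα X hX)

theorem HolFunctionAt.differential (hf : HolFunctionAt (m := m) f p) :
    HolFormAt (fun q => _root_.mvfderiv (CModel m) f q) p :=
  fun _ hX => hf.mvfderiv hX

theorem HolFormAt.eventually (hα : HolFormAt α p) : ∀ᶠ q in 𝓝 p, HolFormAt α q := by
  have hφ := IsManifold.chart_mem_maximalAtlas (I := CModel m) (n := ω) p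
  have hp := mem_chart_source (Fin m → ℂ) p
  filter_upwards [Filter.eventually_all.2 fun k =>
    ((holFormAt_iff_chart hφ hp).1 hα k).eventually, (chartAt _ p).open_source.mem_nhds hp]
    with q h1 h2 using (holFormAt_iff_chart hφ h2).2 h1

/-- Holomorphic forms which agree at points arbitrarily close to `p` agree at `p`. -/
theorem HolFormAt.eq_of_frequently (hα : HolFormAt α p) (hβ : HolFormAt β p)
    (h : ∃ᶠ q in 𝓝 p, α q = β q) : α p = β p := by
  have hφ := IsManifold.chart_mem_maximalAtlas (I := CModel m) (n := ω) p
  have hp := mem_chart_source (Fin m → ℂ) p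
  refine form_ext_chart hφ hp fun k => ?_
  by_contra hne
  have hc := (((holFormAt_iff_chart hφ hp).1 hα k).sub
    ((holFormAt_iff_chart hφ hp).1 hβ k)).eventually_ne (sub_ne_zero.2 hne)
  obtain ⟨q, h1, h2⟩ := (h.and_eventually hc).exists
  exact h2 (by rw [h1, sub_self])

end FormOps

namespace FrobeniusManifold

variable {m : ℕ} {M : Type*} [TopologicalSpace M] [ChartedSpace (Fin m → ℂ) M]
  [IsManifold (CModel m) ω M] {F : FrobeniusManifold m M} {n : ℕ} {p q : M}
  {γ : ∀ q : M, TangentSpace (CModel m) q →L[ℂ] ℂ}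

theorem holFormAt_dLogTau (hq : q ∉ F.caustic) : HolFormAt F.dLogTau q := by
  obtain ⟨e, he⟩ := (not_not.1 hq : F.SemisimpleAt q).exists_isIdemFrame
  exact he.holFormAt_dLogTau

theorem gForm_hol (hq : q ∉ F.caustic) : HolFormAt F.gForm q := by
  obtain ⟨e, he⟩ := (not_not.1 hq : F.SemisimpleAt q).exists_isIdemFrame
  exact he.gForm_hol

theorem formExtDeriv_dLogTau (hq : q ∉ F.caustic) {X Y : ∀ q : M, TangentSpace (CModel m) q}
    (hX : HolFieldAt X q) (hY : HolFieldAt Y q) : formExtDeriv F.dLogTau X Y q = 0 := by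
  obtain ⟨e, he⟩ := (not_not.1 hq : F.SemisimpleAt q).exists_isIdemFrame
  exact he.formExtDeriv_dLogTau hX hY

theorem eventually_notMem_caustic (hq : q ∉ F.caustic) : ∀ᶠ x in 𝓝 q, x ∉ F.caustic := by
  filter_upwards [(isOpen_semisimple (F := F)).mem_nhds (not_not.1 hq : F.SemisimpleAt q)]
    with x hx using not_not.2 hx

theorem IsMassive.frequently_notMem_caustic (hF : F.IsMassive) (q : M) :
    ∃ᶠ x in 𝓝 q, x ∉ F.caustic :=
  (mem_closure_iff_frequently.1 (hF q)).mono fun _ hx => not_not.2 hx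

/-- A form on the complement of the caustic which extends over the caustic at generic points
extends at all points. -/
theorem IsMassive.exists_local_extension (hF : F.IsMassive) {S U : Set M}
    (hgen : F.caustic ⊆ closure S) (hSK : S ⊆ F.caustic) (hU : IsOpen U)
    (hγ : ∀ q ∈ U, q ∉ F.caustic → HolFormAt γ q)
    (hγS : ∀ q ∈ U, q ∈ S → ∃ β : ∀ q : M, TangentSpace (CModel m) q →L[ℂ] ℂ,
      HolFormAt β q ∧ ∀ᶠ x in 𝓝 q, x ∉ F.caustic → β x = γ x) (hp : p ∈ U) :
    ∃ β : ∀ q : M, TangentSpace (CModel m) q →L[ℂ] ℂ,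
      HolFormAt β p ∧ ∀ᶠ x in 𝓝 p, x ∉ F.caustic → β x = γ x := by
  have hφ := IsManifold.chart_mem_maximalAtlas (I := CModel m) (n := ω) p
  have hps := mem_chart_source (Fin m → ℂ) p
  set φ := chartAt (Fin m → ℂ) p
  set Ω : Set (Fin m → ℂ) := φ.target ∩ φ.symm ⁻¹' U with hΩdef
  have hΩ : IsOpen Ω := φ.isOpen_inter_preimage_symm hU
  -- In the chart the caustic is the zero set of the discriminant Δ. The extension theorem is
  -- applied to each coefficient of γ, with massiveness supplying the density of {Δ ≠ 0}.
  set Δ : (Fin m → ℂ) → ℂ := F.traceDiscr φ ∘ φ.symm with hΔdef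
  have hΔK : ∀ z ∈ φ.target, (Δ z ≠ 0 ↔ φ.symm z ∉ F.caustic) := fun z hz => by
    rw [hΔdef, Function.comp, traceDiscr_ne_zero_iff hφ (φ.map_target hz)]
    exact not_not.symm
  have hev : ∀ z ∈ φ.target, ∀ {P : M → Prop}, (∀ᶠ q in 𝓝 (φ.symm z), P q) →
      ∀ᶠ w in 𝓝 z, P (φ.symm w) := fun z hz P h => by
    have := eventually_symm (φ.map_target hz) h
    rwa [φ.right_inv hz] at this
  have hΔ : AnalyticOnNhd ℂ Δ Ω := fun z hz => by
    have := (holFunctionAt_iff hφ (φ.map_target hz.1)).1 (traceDiscr_hol (F := F) hφ (φ.map_target hz.1))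
    rwa [φ.right_inv hz.1] at this
  have hdense : ∀ z ∈ Ω, ∃ᶠ w in 𝓝 z, Δ w ≠ 0 := fun z hz h => by
    have h1 : ∀ᶠ q in 𝓝 (φ.symm z), q ∈ F.caustic := by
      have h2 := φ.continuousAt (φ.map_target hz.1)
      rw [ContinuousAt, φ.right_inv hz.1] at h2
      filter_upwards [h2.eventually h, φ.open_source.mem_nhds (φ.map_target hz.1)] with q hq hqs
      by_contra hcon
      refine hq ((hΔK _ (φ.map_source hqs)).2 ?_)
      rwa [φ.left_inv hqs]
    exact hF.frequently_notMem_caustic _ (h1.mono fun _ h => not_not.2 h)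
  have key : ∀ k, ExtendsAt Δ (fun z => γ (φ.symm z) (chartField φ k (φ.symm z))) (φ p) := by
    intro k
    have hext : ∀ z ∈ Ω, (∃ β : ∀ q : M, TangentSpace (CModel m) q →L[ℂ] ℂ,
        HolFormAt β (φ.symm z) ∧ ∀ᶠ x in 𝓝 (φ.symm z), x ∉ F.caustic → β x = γ x) →
        ExtendsAt Δ (fun z => γ (φ.symm z) (chartField φ k (φ.symm z))) z := by
      rintro z hz ⟨β, hβ, hβγ⟩
      have h1 := (holFunctionAt_iff hφ (φ.map_target hz.1)).1
        ((holFormAt_iff_chart hφ (φ.map_target hz.1)).1 hβ k)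
      rw [φ.right_inv hz.1] at h1
      refine ⟨_, h1, ?_⟩
      filter_upwards [hev z hz.1 hβγ, φ.open_target.mem_nhds hz.1] with w hw hwt hΔw
      rw [Function.comp, hw ((hΔK w hwt).1 hΔw)]
    refine extendsAt_of_subset_closure hΩ hΔ hdense (fun z hz hΔz => hext z hz ?_)
      (fun z hz hΔz => ?_) ⟨φ.map_source hps, by simpa [φ.left_inv hps] using hp⟩
    · exact ⟨γ, hγ _ hz.2 ((hΔK z hz.1).1 hΔz), .of_forall fun _ _ => rfl⟩
    · have hzK : φ.symm z ∈ F.caustic := by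
        by_contra hcon
        exact (hΔK z hz.1).2 hcon hΔz
      rw [mem_closure_iff_frequently]
      intro hcon
      have h2 := φ.continuousAt (φ.map_target hz.1)
      rw [ContinuousAt, φ.right_inv hz.1] at h2
      obtain ⟨q, hqS, hq1, hq2, hqU⟩ := ((mem_closure_iff_frequently.1 (hgen hzK)).and_eventually
        ((h2.eventually hcon).and ((Filter.eventually_mem_set.2
          (φ.open_source.mem_nhds (φ.map_target hz.1))).and
          (Filter.eventually_mem_set.2 (hU.mem_nhds hz.2))))).exists
      refine hq1 ⟨?_, ?_⟩
      · by_contra hne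
        have := (hΔK _ (φ.map_source hq2)).1 hne
        rw [φ.left_inv hq2] at this
        exact this (hSK hqS)
      · refine hext _ ⟨φ.map_source hq2, by simpa [φ.left_inv hq2] using hqU⟩ ?_
        rw [φ.left_inv hq2]
        exact hγS q hqU hqS
  choose f hf hfγ using key
  refine ⟨chartForm φ fun k q => f k (φ q),
    chartForm_hol hφ hps fun k => holFunctionAt_comp_chart hφ hps (hf k), ?_⟩
  filter_upwards [(φ.continuousAt hps).eventually (Filter.eventually_all.2 hfγ),
    φ.open_source.mem_nhds hps] with q hq hqs hqK
  refine form_ext_chart hφ hqs fun k => ?_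
  rw [chartForm_apply hφ hqs, hq k ((hΔK _ (φ.map_source hqs)).2 (by rwa [φ.left_inv hqs])),
    φ.left_inv hqs]

/-- Semisimple points are dense, so any two local extensions agree on overlaps. Taking at each point
the value of its own extension then defines a holomorphic form. -/
theorem IsMassive.exists_extension (hF : F.IsMassive) {S U : Set M}
    (hgen : F.caustic ⊆ closure S) (hSK : S ⊆ F.caustic) (hU : IsOpen U)
    (hγ : ∀ q ∈ U, q ∉ F.caustic → HolFormAt γ q)
    (hγS : ∀ q ∈ U, q ∈ S → ∃ β : ∀ q : M, TangentSpace (CModel m) q →L[ℂ] ℂ,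
      HolFormAt β q ∧ ∀ᶠ x in 𝓝 q, x ∉ F.caustic → β x = γ x) :
    ∃ β : ∀ q : M, TangentSpace (CModel m) q →L[ℂ] ℂ,
      (∀ q ∈ U, HolFormAt β q) ∧ ∀ q ∈ U, q ∉ F.caustic → β q = γ q := by
  classical
  have h : ∀ p : U, _ := fun p => hF.exists_local_extension hgen hSK hU hγ hγS p.2
  choose β hβ hβγ using h
  refine ⟨fun q => if hq : q ∈ U then β ⟨q, hq⟩ q else 0, fun p hp => ?_, fun q hq hqK => ?_⟩
  · refine (hβ ⟨p, hp⟩).congr ?_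
    filter_upwards [hU.mem_nhds hp, (hβ ⟨p, hp⟩).eventually, (hβγ ⟨p, hp⟩).eventually_nhds]
      with q hq h1 h2
    rw [dif_pos hq]
    refine (hβ ⟨q, hq⟩).eq_of_frequently h1 ?_
    refine (hF.frequently_notMem_caustic q).and_eventually ((hβγ ⟨q, hq⟩).and h2) |>.mono ?_
    rintro x ⟨hx, h3, h4⟩
    rw [h3 hx, h4 hx]
  · change dite _ _ _ = _
    rw [dif_pos hq]
    exact (hβγ ⟨q, hq⟩).self_of_nhds hqK

end FrobeniusManifold
end

/-! ### The logarithmic pole and the residue of d log τ_I. -/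

noncomputable section

namespace FrobeniusManifold

variable {m : ℕ} {M : Type*} [TopologicalSpace M] [ChartedSpace (Fin m → ℂ) M]
  [IsManifold (CModel m) ω M] {F : FrobeniusManifold m M} {n : ℕ}

/-- At a generic point of the caustic h vanishes on t = 0, so h = t v, and h cancels the simple pole
c dt/t of d log τ_I. The resulting extension spreads to the whole caustic. -/
theorem IsMassive.hasLogPoleAlong (hF : F.IsMassive) (hn : 3 ≤ n)
    (hgen : F.caustic ⊆ closure {p | p ∈ F.caustic ∧ F.HasGermI2 n p}) :
    HasLogPoleAlong F.caustic F.dLogTau := by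
  intro U h hU hh hhK
  constructor
  · suffices hS : ∀ q ∈ U, q ∈ {p | p ∈ F.caustic ∧ F.HasGermI2 n p} → _ by
      obtain ⟨β, hβ, hβγ⟩ := hF.exists_extension (γ := fun q => h q • F.dLogTau q) hgen
        (fun _ hx => hx.1) hU (fun q hq hqK => (holFormAt_dLogTau hqK).smul (hh q hq)) hS
      exact ⟨β, hβ, fun q hq => hβγ q hq.1 hq.2⟩
    rintro p hp ⟨-, hgerm⟩
    obtain ⟨t, β, _, ht, -, -, hβ, -, hdiv, hev⟩ := hgerm.exists_expansion hn
    obtain ⟨v, hv, hhv⟩ := hdiv h (hh p hp) (by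
      filter_upwards [hev, hU.mem_nhds hp] with q hq hqU h0 using hhK q ⟨hqU, hq.1.2 h0⟩)
    refine ⟨fun q => (-((n : ℂ) - 2) ^ 2 / (16 * n) * v q) • mvfderiv (CModel m) t q + h q • β q,
      (ht.differential.smul ((HolFunctionAt.const _ p).mul hv)).add (hβ.smul (hh p hp)), ?_⟩
    filter_upwards [hev, hhv] with q hq hhq hqK
    have ht0 : t q ≠ 0 := fun h0 => hqK (hq.1.2 h0)
    rw [(hq.2 ht0).1, smul_add, smul_smul, hhq]
    congr 2
    field_simp
  -- The form is closed off the caustic, so its differential is extended by zero.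
  · refine ⟨fun _ => 0, fun q _ X Y _ _ => HolFunctionAt.const 0 q, fun q hq X Y hX hY => ?_⟩
    rw [formExtDeriv_dLogTau hq.2 hX hY, mul_zero]
    rfl

/-- Writing h = t v near a generic point, v(p) ≠ 0 because dh ≠ 0 there. Hence dh/h and dt/t differ
by the holomorphic form dv/v and have the same residue. -/
theorem IsMassive.hasResidueAlongReg (hF : F.IsMassive) (hn : 3 ≤ n)
    (hgen : F.caustic ⊆ closure {p | p ∈ F.caustic ∧ F.HasGermI2 n p}) :
    HasResidueAlongReg F.caustic F.dLogTau (-((n : ℂ) - 2) ^ 2 / (16 * n)) := by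
  intro U h hU hh hhK hdh
  set c : ℂ := -((n : ℂ) - 2) ^ 2 / (16 * n) with hc
  suffices hS : ∀ q ∈ U, q ∈ {p | p ∈ F.caustic ∧ F.HasGermI2 n p} → _ by
    obtain ⟨β, hβ, hβγ⟩ := hF.exists_extension
      (γ := fun q => F.dLogTau q - (c / h q) • mvfderiv (CModel m) h q) hgen
      (fun _ hx => hx.1) hU (fun q hq hqK => (holFormAt_dLogTau hqK).sub
        ((hh q hq).differential.smul ((HolFunctionAt.const c q).div (hh q hq)
          fun h0 => hqK ((hhK q hq).2 h0)))) hS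
    refine ⟨β, hβ, fun q hq => ?_⟩
    rw [hβγ q hq.1 hq.2]
    abel
  rintro p hp ⟨hpK, hgerm⟩
  obtain ⟨t, β, _, ht, ht0, -, hβ, -, hdiv, hev⟩ := hgerm.exists_expansion hn
  obtain ⟨v, hv, hhv⟩ := hdiv h (hh p hp) (by
    filter_upwards [hev, hU.mem_nhds hp] with q hq hqU h0 using (hhK q hqU).1 (hq.1.2 h0))
  have hv0 : v p ≠ 0 := by
    intro hv0
    apply hdh p ⟨hp, hpK⟩
    ext w
    rw [mvfderiv_congr_eventually hhv, mvfderiv_mul_apply ht hv, ht0, hv0]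
    simp
  refine ⟨fun q => β q - (c / v q) • mvfderiv (CModel m) v q,
    hβ.sub (hv.differential.smul ((HolFunctionAt.const c p).div hv hv0)), ?_⟩
  filter_upwards [hev, hhv.eventually_nhds, hv.eventually_ne hv0, ht.eventually, hv.eventually]
    with q hq hhq hvq htq hvh hqK
  have htq0 : t q ≠ 0 := fun h0 => hqK (hq.1.2 h0)
  ext w
  change β q w - c / v q * mvfderiv (CModel m) v q w
    = F.dLogTau q w - c / h q * mvfderiv (CModel m) h q w
  rw [(hq.2 htq0).1, mvfderiv_congr_eventually hhq, mvfderiv_mul_apply htq hvh, hhq.self_of_nhds]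
  change _ = c / t q * mvfderiv (CModel m) t q w + β q w - _
  field_simp
  ring

end FrobeniusManifold
end

/-! ### Gluing of functions given up to constants on a simply connected space. -/

noncomputable section

section Cocycle

theorem continuousAt_iff_eventually_eq {X A : Type*} [TopologicalSpace X] [TopologicalSpace A]
    [DiscreteTopology A] {h : X → A} {x : X} : ContinuousAt h x ↔ ∀ᶠ y in 𝓝 x, h y = h x := by
  rw [ContinuousAt, nhds_discrete A, Filter.tendsto_pure]

/-- On a simply connected space, a locally constant cocycle is a coboundary. -/
theorem exists_coboundary_of_cocycle {X A ι : Type*} [TopologicalSpace X] [SimplyConnectedSpace X]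
    [LocallyPathConnectedSpace X] [AddCommGroup A] [TopologicalSpace A] [DiscreteTopology A]
    {U : ι → Set X} (hU : ∀ i, IsOpen (U i)) (hcover : ∀ x, ∃ i, x ∈ U i) {g : ι → ι → X → A}
    (hg : ∀ i j, ContinuousOn (g i j) (U i ∩ U j)) (hself : ∀ i, ∀ x ∈ U i, g i i x = 0)
    (hcomp : ∀ i j k, ∀ x ∈ U i ∩ U j ∩ U k, g i j x + g j k x = g i k x) :
    ∃ c : ι → X → A, (∀ i, ContinuousOn (c i) (U i)) ∧
      ∀ i j, ∀ x ∈ U i ∩ U j, c j x = c i x + g i j x := by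
  choose idx hidx using hcover
  -- The cocycle glues the trivial coverings U i × A by translations. The result is a covering of X,
  -- it has a section because X is simply connected, and the fibre coordinates of the section form
  -- the coboundary.
  let Z : FiberBundleCore ι X A :=
    { baseSet := U
      isOpen_baseSet := hU
      indexAt := idx
      mem_baseSet_at := hidx
      coordChange := fun i j x v => v + g i j x
      coordChange_self := fun i x hx v => by rw [hself i x hx, add_zero]
      continuousOn_coordChange := fun i j => by
        have h1 : ContinuousOn (fun p : X × A => g i j p.1) ((U i ∩ U j) ×ˢ Set.univ) :=
          (hg i j).comp continuousOn_fst fun p hp => hp.1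
        have h2 : Continuous fun p : A × A => p.1 + p.2 := continuous_of_discreteTopology
        exact h2.comp_continuousOn (continuousOn_snd.prodMk h1)
      coordChange_comp := fun i j k x hx v => by rw [add_assoc, hcomp i j k x hx] }
  have hcov : IsCoveringMap (Bundle.TotalSpace.proj : Z.TotalSpace → X) :=
    FiberBundle.isCoveringMap (F := A) (E := Z.Fiber)
  obtain ⟨x₀⟩ : Nonempty X := (inferInstance : PathConnectedSpace X).nonempty
  obtain ⟨s, ⟨-, hs⟩, -⟩ := hcov.existsUnique_continuousMap_lifts (ContinuousMap.id X) x₀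
    (⟨x₀, (0 : A)⟩ : Z.TotalSpace) rfl
  have hsx : ∀ x, (s x).1 = x := fun x => congrFun hs x
  refine ⟨fun i x => (Z.localTriv i (s x)).2, fun i => ?_, fun i j x hx => ?_⟩
  · refine continuous_snd.comp_continuousOn ((Z.localTriv i).continuousOn.comp
      s.continuous.continuousOn fun x hx => ?_)
    rw [Z.mem_localTriv_source, hsx]
    exact hx
  · have h : ∀ v : A, v + g (idx x) j x = v + g (idx x) i x + g i j x := fun v => by
      rw [add_assoc, hcomp _ _ _ x ⟨⟨hidx x, hx.1⟩, hx.2⟩]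
    have key : ∀ e : Z.TotalSpace, e.1 = x →
        (Z.localTriv j e).2 = (Z.localTriv i e).2 + g i j x := by
      rintro ⟨y, v⟩ hy
      subst hy
      exact h v
    exact key (s x) (hsx x)

/-- The complex numbers with the discrete topology. -/
def DiscreteComplex : Type := ℂ

instance : AddCommGroup DiscreteComplex := inferInstanceAs (AddCommGroup ℂ)

instance : TopologicalSpace DiscreteComplex := ⊥

instance : DiscreteTopology DiscreteComplex := ⟨rfl⟩

/-- On a simply connected space, functions which are given locally up to a constant glue up to a
constant. -/
theorem exists_glued_function {X : Type*} [TopologicalSpace X] [SimplyConnectedSpace X]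
    [LocallyPathConnectedSpace X] {U : X → Set X} (hU : ∀ i, IsOpen (U i)) (hmem : ∀ i, i ∈ U i)
    {f : X → X → ℂ} (hf : ∀ i j, ∀ x ∈ U i ∩ U j, ∀ᶠ y in 𝓝 x, f i y - f j y = f i x - f j x) :
    ∃ G : X → ℂ, ∀ i, ∀ᶠ y in 𝓝 i, G y - f i y = G i - f i i := by
  let g : X → X → X → DiscreteComplex := fun i j x => (f i x - f j x : ℂ)
  have hg : ∀ i j, ContinuousOn (g i j) (U i ∩ U j) := fun i j x hx =>
    (continuousAt_iff_eventually_eq.2 (show ∀ᶠ y in 𝓝 x, g i j y = g i j x from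
      hf i j x hx)).continuousWithinAt
  have hself : ∀ i, ∀ x ∈ U i, g i i x = 0 := fun i x _ => sub_self (f i x)
  have hcomp : ∀ i j k, ∀ x ∈ U i ∩ U j ∩ U k, g i j x + g j k x = g i k x :=
    fun i j k x _ => sub_add_sub_cancel (f i x) (f j x) (f k x)
  obtain ⟨c, hc, hcg⟩ := exists_coboundary_of_cocycle hU (fun x => ⟨x, hmem x⟩) hg hself hcomp
  have hc' : ∀ i, ∀ᶠ y in 𝓝 i, c i y = c i i := fun i =>
    continuousAt_iff_eventually_eq.1 ((hc i).continuousAt ((hU i).mem_nhds (hmem i)))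
  let d : X → X → ℂ := c
  have hd : ∀ i j, ∀ x ∈ U i ∩ U j, d j x = d i x + (f i x - f j x) := hcg
  -- By the coboundary relation f y y + d y y = f i y + d i y for y near i, and d i is locally
  -- constant.
  refine ⟨fun x => f x x + d x x, fun i => ?_⟩
  filter_upwards [hc' i, (hU i).mem_nhds (hmem i)] with y hy hyU
  have h2 : d i y = d i i := hy
  rw [hd i y y ⟨hyU, hmem y⟩, h2]
  ring

end Cocycle

end

/-! ### Primitives of closed holomorphic 1-forms. -/

noncomputable section

section Primitive

open VectorField

variable {m : ℕ} {M : Type*} [TopologicalSpace M] [ChartedSpace (Fin m → ℂ) M]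
  [IsManifold (CModel m) ω M] {p q : M} {β γ : ∀ q : M, TangentSpace (CModel m) q →L[ℂ] ℂ}
  {X Y : ∀ q : M, TangentSpace (CModel m) q}

theorem formExtDeriv_congr (h : ∀ᶠ q in 𝓝 p, β q = γ q) :
    formExtDeriv β X Y p = formExtDeriv γ X Y p := by
  rw [formExtDeriv, formExtDeriv, h.self_of_nhds,
    mvfderiv_congr_eventually (f := fun q => β q (Y q)) (g := fun q => γ q (Y q)) (h.mono fun q hq => by rw [hq]),
    mvfderiv_congr_eventually (f := fun q => β q (X q)) (g := fun q => γ q (X q))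
      (h.mono fun q hq => by rw [hq])]

theorem formExtDeriv_hol (hβ : HolFormAt β p) (hX : HolFieldAt X p) (hY : HolFieldAt Y p) :
    HolFunctionAt (m := m) (formExtDeriv β X Y) p :=
  (((hβ Y hY).mvfderiv hX).sub ((hβ X hX).mvfderiv hY)).sub (hβ _ (hX.mlieBracket hY))

/-- A closed holomorphic 1-form has local primitives. -/
theorem exists_local_primitive (hβ : ∀ q, HolFormAt β q)
    (hclosed : ∀ q X Y, HolFieldAt X q → HolFieldAt Y q → formExtDeriv β X Y q = 0) (p : M) :
    ∃ (U : Set M) (f : M → ℂ), IsOpen U ∧ p ∈ U ∧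
      ∀ q ∈ U, HolFunctionAt (m := m) f q ∧ mvfderiv (CModel m) f q = β q := by
  have hφ := IsManifold.chart_mem_maximalAtlas (I := CModel m) (n := ω) p
  have hp := mem_chart_source (Fin m → ℂ) p
  set φ := chartAt (Fin m → ℂ) p
  obtain ⟨ε, hε, hball⟩ := Metric.isOpen_iff.1 φ.open_target (φ p) (φ.map_source hp)
  set b : Fin m → (Fin m → ℂ) → ℂ := fun k z => β (φ.symm z) (chartField φ k (φ.symm z)) with hb
  have hban : ∀ k, ∀ z ∈ φ.target, AnalyticAt ℂ (b k) z := fun k z hz => by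
    have := (holFunctionAt_iff hφ (φ.map_target hz)).1
      ((holFormAt_iff_chart hφ (φ.map_target hz)).1 (hβ _) k)
    rwa [φ.right_inv hz] at this
  set w : (Fin m → ℂ) → (Fin m → ℂ) →L[ℂ] ℂ := fun z =>
    ∑ k, b k z • (ContinuousLinearMap.proj k : (Fin m → ℂ) →L[ℂ] ℂ) with hw
  have hwan : ∀ z ∈ φ.target, HasFDerivAt w
      (∑ k, (fderiv ℂ (b k) z).smulRight (ContinuousLinearMap.proj k : (Fin m → ℂ) →L[ℂ] ℂ)) z :=
    fun z hz => HasFDerivAt.fun_sum fun k _ =>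
      (hban k z hz).differentiableAt.hasFDerivAt.smul_const
        (ContinuousLinearMap.proj k : (Fin m → ℂ) →L[ℂ] ℂ)
  have hwapp : ∀ z x, w z x = ∑ k, b k z * x k := fun z x => by
    simp only [hw, sum_apply]
    rfl
  have hsymm : ∀ z ∈ φ.target, ∀ k l, fderiv ℂ (b k) z (Pi.single l 1)
      = fderiv ℂ (b l) z (Pi.single k 1) := by
    intro z hz k l
    have hq := φ.map_target hz
    have hk := fun k => (holFormAt_iff_chart hφ hq).1 (hβ _) k
    have h1 := hclosed (φ.symm z) _ _ (holFieldAt_chartField hφ hq l)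
      (holFieldAt_chartField hφ hq k)
    rw [formExtDeriv, mlieBracket_chartField hφ hq, map_zero, sub_zero,
      mvfderiv_eq_fderiv hφ hq (hk k), mvfderiv_eq_fderiv hφ hq (hk l),
      mvfderiv_chartField hφ hq, mvfderiv_chartField hφ hq, φ.right_inv hz] at h1
    exact sub_eq_zero.1 h1
  have hwd : DifferentiableOn ℝ w (Metric.ball (φ p) ε) := fun z hz =>
    ((hwan z (hball hz)).restrictScalars ℝ).differentiableAt.differentiableWithinAt
  -- The Poincaré lemma on a ball. The symmetry of the derivative of w is closedness of β evaluated
  -- on coordinate fields, whose brackets vanish.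
  obtain ⟨f, hf⟩ := (convex_ball (φ p) ε).exists_forall_hasFDerivAt_of_fderiv_symmetric
    Metric.isOpen_ball hwd
    (by
      intro z hz x y
      rw [((hwan z (hball hz)).restrictScalars ℝ).fderiv]
      have h1 : ∀ x y : Fin m → ℂ, (∑ k, (fderiv ℂ (b k) z).smulRight
          (ContinuousLinearMap.proj k : (Fin m → ℂ) →L[ℂ] ℂ)) x y
          = ∑ k, ∑ l, x l * y k * fderiv ℂ (b k) z (Pi.single l 1) := by
        intro x y
        simp only [sum_apply]
        refine Finset.sum_congr rfl fun k _ => ?_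
        change fderiv ℂ (b k) z x * y k = _
        conv_lhs => rw [pi_eq_sum_univ' x, map_sum, Finset.sum_mul]
        refine Finset.sum_congr rfl fun l _ => ?_
        rw [map_smul, smul_eq_mul]
        ring
      change (∑ k, (fderiv ℂ (b k) z).smulRight
        (ContinuousLinearMap.proj k : (Fin m → ℂ) →L[ℂ] ℂ)) x y = (∑ k, (fderiv ℂ (b k) z).smulRight
        (ContinuousLinearMap.proj k : (Fin m → ℂ) →L[ℂ] ℂ)) y x
      rw [h1, h1, Finset.sum_comm]
      refine Finset.sum_congr rfl fun k _ => Finset.sum_congr rfl fun l _ => ?_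
      rw [hsymm z (hball hz) l k]
      ring)
  refine ⟨φ.source ∩ φ ⁻¹' Metric.ball (φ p) ε, fun q => f (φ q),
    φ.isOpen_inter_preimage Metric.isOpen_ball, ⟨hp, Metric.mem_ball_self hε⟩, ?_⟩
  rintro q ⟨hq, hqb⟩
  -- The primitive is complex differentiable on the ball, and Osgood's lemma makes it analytic.
  have hfan : AnalyticAt ℂ f (φ q) :=
    DifferentiableOn.analyticAt_of_finiteDimensional (U := Metric.ball (φ p) ε)
      (fun z hz => (hf z hz).differentiableAt.differentiableWithinAt)
      (Metric.isOpen_ball.mem_nhds hqb)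
  have hfq := holFunctionAt_comp_chart hφ hq hfan
  refine ⟨hfq, form_ext_chart hφ hq fun k => ?_⟩
  rw [mvfderiv_eq_fderiv hφ hq hfq, mvfderiv_chartField hφ hq]
  have h1 : ((fun q => f (φ q)) ∘ φ.symm) =ᶠ[𝓝 (φ q)] f := by
    filter_upwards [φ.open_target.mem_nhds (φ.map_source hq)] with z hz
    simp only [Function.comp, φ.right_inv hz]
  rw [h1.fderiv_eq, (hf _ hqb).fderiv, hwapp, Finset.sum_eq_single k]
  · rw [Pi.single_eq_same, mul_one]
    exact congrArg (fun x => β x (chartField φ k x)) (φ.left_inv hq)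
  · intro l _ hl
    rw [Pi.single_eq_of_ne hl, mul_zero]
  · simp

theorem eventually_eq_of_mvfderiv_eq_zero {f : M → ℂ} (hf : HolFunctionAt (m := m) f p)
    (h : ∀ᶠ q in 𝓝 p, mvfderiv (CModel m) f q = 0) : ∀ᶠ q in 𝓝 p, f q = f p := by
  have hφ := IsManifold.chart_mem_maximalAtlas (I := CModel m) (n := ω) p
  have hp := mem_chart_source (Fin m → ℂ) p
  set φ := chartAt (Fin m → ℂ) p
  obtain ⟨ε, hε, hball⟩ := Metric.eventually_nhds_iff_ball.1 (eventually_symm hp (hf.eventually.and h)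
    |>.and (φ.open_target.mem_nhds (φ.map_source hp)))
  have hd : ∀ z ∈ Metric.ball (φ p) ε, HasFDerivAt (f ∘ φ.symm) (0 : (Fin m → ℂ) →L[ℂ] ℂ) z := by
    intro z hz
    obtain ⟨⟨h1, h2⟩, h3 : z ∈ φ.target⟩ := hball z hz
    have hq := φ.map_target h3
    have h4 := (holFunctionAt_iff hφ hq).1 h1
    rw [φ.right_inv h3] at h4
    have h5 : fderiv ℂ (f ∘ φ.symm) z = 0 := by
      ext w
      obtain ⟨v, hv⟩ := (mvfderiv_chart_bijective hφ hq).2 w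
      have h6 := mvfderiv_eq_fderiv hφ hq h1 v
      rw [hv, h2, φ.right_inv h3] at h6
      exact h6.symm
    rw [← h5]
    exact h4.differentiableAt.hasFDerivAt
  filter_upwards [(φ.continuousAt hp).preimage_mem_nhds (Metric.ball_mem_nhds _ hε),
    φ.open_source.mem_nhds hp] with q hqb hq
  have := (convex_ball (φ p) ε).is_const_of_fderivWithin_eq_zero (𝕜 := ℂ) (f := f ∘ φ.symm)
    (fun z hz => (hd z hz).differentiableAt.differentiableWithinAt)
    (fun z hz => by
      rw [fderivWithin_of_isOpen Metric.isOpen_ball hz, (hd z hz).fderiv]) hqb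
    (Metric.mem_ball_self hε)
  simpa only [Function.comp, φ.left_inv hq, φ.left_inv hp] using this

/-- On a simply connected manifold, a closed holomorphic 1-form has a primitive. -/
theorem exists_primitive [SimplyConnectedSpace M] (hβ : ∀ q, HolFormAt β q)
    (hclosed : ∀ q X Y, HolFieldAt X q → HolFieldAt Y q → formExtDeriv β X Y q = 0) :
    ∃ G : M → ℂ, ∀ q, HolFunctionAt (m := m) G q ∧ mvfderiv (CModel m) G q = β q := by
  have := ChartedSpace.locallyPathConnectedSpace (Fin m → ℂ) M
  choose U f hU hmem hf using exists_local_primitive hβ hclosed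
  obtain ⟨G, hG⟩ := exists_glued_function hU hmem (f := f) (by
    rintro i j x ⟨hi, hj⟩
    refine eventually_eq_of_mvfderiv_eq_zero (f := fun y => f i y - f j y)
      ((hf i x hi).1.sub (hf j x hj).1) ?_
    filter_upwards [(hU i).mem_nhds hi, (hU j).mem_nhds hj] with y hyi hyj
    ext v
    rw [mvfderiv_sub_apply (hf i y hyi).1 (hf j y hyj).1, (hf i y hyi).2, (hf j y hyj).2, sub_self]
    rfl)
  refine ⟨G, fun q => ?_⟩
  have h1 : ∀ᶠ y in 𝓝 q, G y = f q y + (G q - f q q) :=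
    (hG q).mono fun y hy => by rw [← hy]; ring
  obtain ⟨h2, h3⟩ := hf q q (hmem q)
  refine ⟨(h2.add (HolFunctionAt.const (G q - f q q) q)).congr h1, ?_⟩
  ext v
  rw [mvfderiv_congr_eventually h1, mvfderiv_add_apply h2 (HolFunctionAt.const _ q),
    mvfderiv_const_apply, add_zero, h3]

end Primitive
end

/-! ### Extension of the G-function over the caustic. -/

noncomputable section

namespace FrobeniusManifold

open VectorField

variable {m : ℕ} {M : Type*} [TopologicalSpace M] [ChartedSpace (Fin m → ℂ) M]
  [IsManifold (CModel m) ω M] {F : FrobeniusManifold m M} {n : ℕ} {p q : M}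

theorem formExtDeriv_gForm (hq : q ∉ F.caustic) {X Y : ∀ q : M, TangentSpace (CModel m) q}
    (hX : HolFieldAt X q) (hY : HolFieldAt Y q) : formExtDeriv F.gForm X Y q = 0 := by
  obtain ⟨e, he⟩ := (not_not.1 hq : F.SemisimpleAt q).exists_isIdemFrame
  have hv := he.vol_hol
  have h0 := he.vol_ne_zero
  have hd := he.formExtDeriv_dLogTau hX hY
  have happ : ∀ Z : ∀ q : M, TangentSpace (CModel m) q, HolFieldAt Z q → ∀ w,
      mvfderiv (CModel m) (fun r => F.gForm r (Z r)) q w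
        = mvfderiv (CModel m) (fun r => F.dLogTau r (Z r)) q w
          - 1 / 48 * ((F.vol q)⁻¹ * mvfderiv (CModel m)
              (fun r => mvfderiv (CModel m) F.vol r (Z r)) q w
            + mvfderiv (CModel m) F.vol q (Z q)
              * (-mvfderiv (CModel m) F.vol q w / F.vol q ^ 2)) := by
    intro Z hZ w
    have h1 : (fun r => F.gForm r (Z r)) = fun r => F.dLogTau r (Z r)
        - 1 / 48 * ((F.vol r)⁻¹ * mvfderiv (CModel m) F.vol r (Z r)) := by
      funext r
      rw [← _root_.mul_assoc]
      rfl
    rw [h1, mvfderiv_sub_apply (he.holFormAt_dLogTau Z hZ) ((HolFunctionAt.const _ q).mul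
      ((hv.inv h0).mul (hv.mvfderiv hZ))), mvfderiv_const_mul_apply _ ((hv.inv h0).mul
      (hv.mvfderiv hZ)), mvfderiv_mul_apply (hv.inv h0) (hv.mvfderiv hZ), mvfderiv_inv_apply hv h0]
  have hb : F.gForm q (mlieBracket (CModel m) X Y q) = F.dLogTau q (mlieBracket (CModel m) X Y q)
      - 1 / 48 * (F.vol q)⁻¹ * mvfderiv (CModel m) F.vol q (mlieBracket (CModel m) X Y q) := rfl
  rw [mvfderiv_mlieBracket hv hX hY] at hb
  rw [formExtDeriv, happ Y hY, happ X hX, hb]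
  rw [formExtDeriv] at hd
  linear_combination hd

/-- A holomorphic form which extends a closed form on the complement of the caustic is closed. -/
theorem IsMassive.formExtDeriv_eq_zero (hF : F.IsMassive)
    {β γ : ∀ q : M, TangentSpace (CModel m) q →L[ℂ] ℂ} (hβ : ∀ q, HolFormAt β q)
    (hβγ : ∀ q, q ∉ F.caustic → β q = γ q)
    (hγ : ∀ q, q ∉ F.caustic → ∀ X Y : ∀ q : M, TangentSpace (CModel m) q,
      HolFieldAt X q → HolFieldAt Y q → formExtDeriv γ X Y q = 0)
    {X Y : ∀ q : M, TangentSpace (CModel m) q} (hX : HolFieldAt X p) (hY : HolFieldAt Y p) :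
    formExtDeriv β X Y p = 0 := by
  by_contra hne
  obtain ⟨q, hq, h1, h2, h3⟩ := ((hF.frequently_notMem_caustic p).and_eventually
    (((formExtDeriv_hol (hβ p) hX hY).eventually_ne hne).and
      (hX.eventually.and hY.eventually))).exists
  apply h1
  rw [formExtDeriv_congr ((eventually_notMem_caustic hq).mono hβγ)]
  exact hγ q hq X Y h2 h3

/-- For n = 3 the residue of the differential of the G-function is -1/48 + 1/48 = 0. The form thus
extends at generic points of the caustic and then everywhere; the extension is closed and has a
primitive because M is simply connected. -/
theorem IsMassive.gFunctionExtends [SimplyConnectedSpace M] (hF : F.IsMassive)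
    (hgen : F.caustic ⊆ closure {p | p ∈ F.caustic ∧ F.HasGermI2 3 p}) : F.GFunctionExtends := by
  obtain ⟨β, hβ, hβγ⟩ := hF.exists_extension (γ := F.gForm) hgen (fun _ hx => hx.1) isOpen_univ
    (fun _ _ hqK => gForm_hol hqK) (by
      rintro p - ⟨-, hgerm⟩
      obtain ⟨t, _, β', -, -, -, -, hβ', -, hev⟩ := hgerm.exists_expansion le_rfl
      refine ⟨β', hβ', ?_⟩
      filter_upwards [hev] with q hq hqK
      rw [(hq.2 fun h0 => hqK (hq.1.2 h0)).2]
      norm_num)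
  obtain ⟨G, hG⟩ := exists_primitive (fun q => hβ q trivial) fun q X Y hX hY =>
    hF.formExtDeriv_eq_zero (fun q => hβ q trivial) (fun q => hβγ q trivial)
      (fun q hq X Y => formExtDeriv_gForm hq) hX hY
  refine ⟨G, fun p => (hG p).1, fun p hp => (isGFunctionAt_iff hp (hG p).1).2 ?_⟩
  filter_upwards [eventually_notMem_caustic hp] with q hq
  rw [(hG q).2, hβγ q trivial hq]

/-- If the G-function extends over a point where the germ is of type `I_2(n) A_1^{m-2}`, then the
residue of its differential vanishes. -/
theorem HasGermI2.eq_three_of_gFunctionExtends (h : F.HasGermI2 n p) (hn : 3 ≤ n)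
    (hF : F.IsMassive) (hG : F.GFunctionExtends) : n = 3 := by
  obtain ⟨G, hGhol, hGfun⟩ := hG
  obtain ⟨t, _, β, ht, ht0, hdt, -, hβ, -, hev⟩ := h.exists_expansion hn
  set c : ℂ := -((n : ℂ) - 2) ^ 2 / (16 * n) + ((n : ℂ) - 2) / 48 with hc
  -- Off the caustic c dt = t (dG - β), with both sides holomorphic at p. By density the identity
  -- holds at p, where t = 0 and dt ≠ 0, so c = 0.
  have h1 : c • mvfderiv (CModel m) t p = t p • (mvfderiv (CModel m) G p - β p) := by
    refine HolFormAt.eq_of_frequently (α := fun q => c • mvfderiv (CModel m) t q)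
      (β := fun q => t q • (mvfderiv (CModel m) G q - β q))
      (ht.differential.smul (HolFunctionAt.const c p))
      (((hGhol p).differential.sub hβ).smul ht) ?_
    refine ((hF.frequently_notMem_caustic p).and_eventually hev).mono ?_
    rintro q ⟨hq, h1, h2⟩
    have htq : t q ≠ 0 := fun h0 => hq (h1.2 h0)
    have h3 := ((isGFunctionAt_iff hq (hGhol q)).1 (hGfun q hq)).self_of_nhds
    rw [h3, (h2 htq).2, add_sub_cancel_right, smul_smul, mul_div_cancel₀ _ htq]
  rw [ht0, zero_smul] at h1
  have hc0 : c = 0 := (smul_eq_zero.1 h1).resolve_right hdt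
  have hn0 : (n : ℂ) ≠ 0 := by
    have : n ≠ 0 := by lia
    exact_mod_cast this
  have hn2 : (n : ℂ) - 2 ≠ 0 := by
    have : n ≠ 2 := by lia
    rw [sub_ne_zero]
    exact_mod_cast this
  rw [hc] at hc0
  field_simp at hc0
  -- The residue c is -(n-2)(n-3)/(24n), and n ≠ 2.
  have h2 : (n : ℂ) = 3 := by
    rw [mul_zero] at hc0
    linear_combination -(1 / 32) * (mul_eq_zero.1 hc0).resolve_left hn2
  exact_mod_cast h2

end FrobeniusManifold
end

theorem theorem6p3 {m : ℕ} {M : Type*} [TopologicalSpace M] [T2Space M]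
    [ChartedSpace (Fin m → ℂ) M] [IsManifold (CModel m) ω M] [SimplyConnectedSpace M]
    (F : FrobeniusManifold m M) (hF : F.IsMassive) (n : ℕ) (hn : 3 ≤ n)
    (hgen : F.caustic ⊆ closure {p | p ∈ F.caustic ∧ F.HasGermI2 n p}) :
    (HasLogPoleAlong F.caustic F.dLogTau ∧
      HasResidueAlongReg F.caustic F.dLogTau (-((n : ℂ) - 2) ^ 2 / (16 * n))) ∧
    (F.caustic.Nonempty → (F.GFunctionExtends ↔ n = 3)) := by
  refine ⟨⟨hF.hasLogPoleAlong hn hgen, hF.hasResidueAlongReg hn hgen⟩, fun ⟨p, hp⟩ => ⟨fun hG => ?_,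
    fun h3 => ?_⟩⟩
  -- A nonempty caustic contains a point of type I_2(n) A_1^{m-2}, where the residue can be read
  -- off.
  · obtain ⟨q, -, hq⟩ := closure_nonempty_iff.1 ⟨p, hgen hp⟩
    exact hq.eq_three_of_gFunctionExtends hn hF hG
  · subst h3
    exact hF.gFunctionExtends hgen
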